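/- Let $\mathbb K\in\{\mathbb R,\mathbb C\}$ and let $\mathfrak g$ be an asymptotic-estimate (AE) Lie algebra over $\mathbb K$: a Hausdorff locally convex space with a Lie bracket such that every continuous seminorm $p$ has an asymptotic estimate, i.e. a continuous seminorm $q$ with $p(w(\xi_1,\dots,\xi_n))\le q(\xi_1)\cdots q(\xi_n)$ for all $n\ge 1$ and all arbitrarily nested brackets $w(\xi_1,\dots,\xi_n)$ of $\xi_1,\dots,\xi_n\in\mathfrak g$. **Notation.** $\mathrm T^\bullet(\mathfrak g)=\bigoplus_n\mathfrak g^{\otimes n}$ is the tensor algebra, $\mathrm{Sym}^\bullet(\mathfrak g)=\bigoplus_n\mathrm{Sym}^n(\mathfrak g)\subseteq \mathrm T^\bullet(\mathfrak g)$ the space of symmetric tensors with the symmetric tensor product $xy=\mathscr S(x\otimes y)$, where $\mathscr S$ is the symmetrizer, and $\pi_n$ is the projection onto degree $n$. For a continuous seminorm $p$ let $p^n$ be its $n$-th projective tensor power ($p^0=|\cdot|$), and $p_R=\sum_n n!^R p^n$. The $\mathrm{Sym}_R$-topology is the locally convex topology given by all the $p_R$; $\mathrm{Sym}_R^\bullet(\mathfrak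 g)$ is $\mathrm{Sym}^\bullet(\mathfrak g)$ with this topology, $\widehat{\mathrm{Sym}}{}_R^\bullet(\mathfrak g)$ its completion. Let $\mathfrak q\colon \mathrm{Sym}^\bullet(\mathfrak g)\to U(\mathfrak g)$, $\xi_1\cdots\xi_n\mapsto\frac1{n!}\sum_{\sigma}\xi_{\sigma(1)}\odot\cdots\odot\xi_{\sigma(n)}$, which is a linear bijection (Poincaré–Birkhoff–Witt). For $x\in\mathrm{Sym}^k(\mathfrak g)$, $y\in\mathrm{Sym}^\ell(\mathfrak g)$ put $C_n(x,y)=\pi_{k+\ell-n}\bigl(\mathfrak q^{-1}(\mathfrak q(x)\odot\mathfrak q(y))\bigr)$ for $0\le n\le k+\ell$, $C_n(x,y)=0$ for $n>k+\ell$, and extend bilinearly; the Gutt star product is $x\star_z y=\sum_n z^nC_n(x,y)$. On $\mathrm T^\bullet(\mathfrak g)$, $C_n$ and $\star_z$ are understood after applying $\mathscr S$ to both arguments. Let $c_R=32\cdot 2^{\max(R-2,0)}$ (so $c_R=32$ for $R\le2$). **Theorem.** Let $R\ge 1$. 1. (Continuity) For every $z\in\mathbb K$ the product $\star_z$ is jointly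 continuous on $\mathrm{Sym}_R^\bullet(\mathfrak g)$. If $q$ is an asymptotic estimate for the continuous seminorm $p$, then $$p_R(x\star_zy)\le (cq)_R(x)\,(cq)_R(y),\qquad c=c_R(|z|+1),$$ for all $x,y\in\mathrm T^\bullet(\mathfrak g)$, and for all $x,y\in\widehat{\mathrm{Sym}}{}_R^\bullet(\mathfrak g)$. Moreover, for every $r\ge0$ all $C_n$ are continuous for the $\mathrm{Sym}_r$-topology, and for $x,y\in \mathrm T^\bullet(\mathfrak g)$ $$p_r(C_n(x,y))\le\frac{n!^{1-r}}{2\cdot 8^n}(c_rq)_r(x)(c_rq)_r(y)\quad(n\ge1),\qquad p_r(C_0(x,y))\le (c_rq)_r(x)(c_rq)_r(y).$$ 2. (Hopf algebra) The undeformed coproduct $\Delta(\xi_1\cdots\xi_n)=\sum_{I\subseteq\{1,\dots,n\}}\xi_I\otimes\xi_{I^c}$ (where $\xi_I=\prod_{i\in I}\xi_i$), the antipode $S(\xi_1\cdots\xi_n)=(-1)^n\xi_1\cdots\xi_n$ and the counit $\epsilon=\pi_0$ are continuous, and for every $z\in\mathbb K$ the continuous extensions of $\star_z,1,\Delta,\epsilon,S$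 make $\widehat{\mathrm{Sym}}{}_R^\bullet(\mathfrak g)$ a locally convex Hopf algebra: the product is jointly continuous and the Hopf algebra axioms hold with respect to the completed projective tensor product. 3. (Dependence on $z$) For all $x,y\in\widehat{\mathrm{Sym}}{}_R^\bullet(\mathfrak g)$ and all $z\in\mathbb K$ one has $x\star_zy=\sum_{n\ge0}z^nC_n(x,y)$, with the continuously extended $C_n$, and the series converges absolutely with respect to every $p_R$. Thus $z\mapsto x\star_zy$ is entire. On $\mathrm{Sym}^\bullet(\mathfrak g)$, $\star_0$ is the symmetric tensor product. 4. (Functoriality) Let $\phi\colon\mathfrak g\to\mathfrak h$ be a continuous homomorphism of AE-Lie algebras. The map $\mathrm{Sym}(\phi)\colon\xi_1\cdots\xi_n\mapsto\phi(\xi_1)\cdots\phi(\xi_n)$ from $\mathrm{Sym}_R^\bullet(\mathfrak g)$ to $\mathrm{Sym}_R^\bullet(\mathfrak h)$ extends $\phi$, is continuous, and is a unital homomorphism for $\star_z$ for all $z\in\mathbb K$. Its continuous extension $\widehat{\mathrm{Sym}}{}_R^\bullet(\mathfrak g)\to\widehat{\mathrm{Sym}}{}_R^\bullet(\mathfrak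 h)$ is, for all $z$, a homomorphism of locally convex Hopf algebras, and these extensions respect identities and compositions. -/

import Mathlib

open scoped NNReal TensorProduct DirectSum
open UniformSpace

noncomputable section

namespace Gutt

/-! ### Asymptotic estimates -/

section AE

variable {𝕜 : Type*} [RCLike 𝕜] {𝔤 : Type*} [LieRing 𝔤] [LieAlgebra 𝕜 𝔤]

/-- Evaluation of a word (an arbitrarily bracketed product of elements of `𝔤`), with the Lie
bracket as product. -/
def evalWord : FreeMagma 𝔤 → 𝔤
  | .of x => x
  | .mul a b => ⁅evalWord a, evalWord b⁆

/-- The product `q x₁ ⋯ q xₙ` over the letters of a word. -/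
def wordWeight (q : Seminorm 𝕜 𝔤) : FreeMagma 𝔤 → ℝ
  | .of x => q x
  | .mul a b => wordWeight q a * wordWeight q b

/-- `q` is an asymptotic estimate for `p`: `p (w(x₁, …, xₙ)) ≤ q x₁ ⋯ q xₙ` for all words. -/
def IsAsymptoticEstimate (p q : Seminorm 𝕜 𝔤) : Prop :=
  ∀ w : FreeMagma 𝔤, p (evalWord w) ≤ wordWeight q w

end AE

/-- A (real or complex) asymptotic-estimate Lie algebra: a Hausdorff locally convex space with a
Lie bracket such that every continuous seminorm has a continuous asymptotic estimate.
(Words with two letters show that the bracket is then continuous.) -/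
class AELieAlgebra (𝕜 : Type*) [RCLike 𝕜] (𝔤 : Type*) [LieRing 𝔤] [LieAlgebra 𝕜 𝔤]
    [TopologicalSpace 𝔤] : Prop where
  hausdorff : T2Space 𝔤
  locallyConvex : PolynormableSpace 𝕜 𝔤
  exists_estimate : ∀ p : Seminorm 𝕜 𝔤, Continuous p →
    ∃ q : Seminorm 𝕜 𝔤, Continuous q ∧ IsAsymptoticEstimate p q

/-! ### Projective cross seminorms -/

section InfSeminorm

variable {𝕜 : Type*} [RCLike 𝕜] {A M : Type*} [AddCommGroup M] [Module 𝕜 M]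

/-- The seminorm `x ↦ inf {∑ w(aᵢ) | x = ∑ e(aᵢ)}`, for a family of generators `e : A → M` with
weights `w`, on which scalars act compatibly. -/
def infSeminorm (e : A → M) (w : A → ℝ) (s : 𝕜 → A → A) (he : ∀ c a, e (s c a) = c • e a)
    (hw : ∀ c a, w (s c a) = ‖c‖ * w a) (h0 : ∀ a, 0 ≤ w a)
    (hspan : ∀ x : M, ∃ l : List A, (l.map e).sum = x) : Seminorm 𝕜 M :=
  have hpos : ∀ l : List A, 0 ≤ (l.map w).sum := fun l =>
    List.sum_nonneg (by intro r hr; obtain ⟨a, -, rfl⟩ := List.mem_map.1 hr; exact h0 a)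
  have hbdd : ∀ x : M, BddBelow
      (Set.range fun l : {l : List A // (l.map e).sum = x} => (l.1.map w).sum) := fun _ =>
    ⟨0, by rintro _ ⟨l, rfl⟩; exact hpos _⟩
  Seminorm.ofSMulLE
    (fun x => ⨅ l : {l : List A // (l.map e).sum = x}, (l.1.map w).sum)
    (le_antisymm ((ciInf_le (hbdd 0) ⟨[], by simp⟩).trans (by simp))
      (Real.iInf_nonneg fun l => hpos _))
    (by
      intro x y
      have : Nonempty {l : List A // (l.map e).sum = x} := let ⟨l, h⟩ := hspan x; ⟨⟨l, h⟩⟩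
      have : Nonempty {l : List A // (l.map e).sum = y} := let ⟨l, h⟩ := hspan y; ⟨⟨l, h⟩⟩
      refine le_ciInf_add_ciInf fun l m => ?_
      refine (ciInf_le (hbdd _) ⟨l.1 ++ m.1, ?_⟩).trans ?_
      · rw [List.map_append, List.sum_append, l.2, m.2]
      · simp)
    (by
      intro c x
      have : Nonempty {l : List A // (l.map e).sum = x} := let ⟨l, h⟩ := hspan x; ⟨⟨l, h⟩⟩
      rw [Real.mul_iInf_of_nonneg (norm_nonneg c)]
      refine le_ciInf fun l => ?_
      refine (ciInf_le (hbdd _) ⟨l.1.map (s c), ?_⟩).trans (le_of_eq ?_)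
      · have h : (c • (l.1.map e).sum) = c • x := by rw [l.2]
        rw [← h, List.map_map, List.smul_sum, List.map_map]
        congr 1
        exact List.map_congr_left fun a _ => he c a
      · simp only [List.map_map]
        rw [← List.sum_map_mul_left]
        congr 1
        exact List.map_congr_left fun a _ => hw c a)

end InfSeminorm

section Algebraic

variable (𝕜 : Type*) [RCLike 𝕜] (V : Type*) [AddCommGroup V] [Module 𝕜 V]

/-- The `n`-th tensor power `pⁿ` of a seminorm `p`:
`pⁿ(x) = inf {∑ᵢ |cᵢ| p(vᵢ₁) ⋯ p(vᵢₙ) | x = ∑ᵢ cᵢ vᵢ₁ ⊗ ⋯ ⊗ vᵢₙ}`.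
For `n = 0` this is the absolute value on the ground field. -/
def tensorPowSeminorm {𝕜 V} [RCLike 𝕜] [AddCommGroup V] [Module 𝕜 V] (p : Seminorm 𝕜 V) (n : ℕ) :
    Seminorm 𝕜 (⨂[𝕜]^n V) :=
  infSeminorm (A := 𝕜 × (Fin n → V)) (fun a => a.1 • PiTensorProduct.tprod 𝕜 a.2)
    (fun a => ‖a.1‖ * ∏ i, p (a.2 i)) (fun c a => (c * a.1, a.2))
    (fun _ _ => mul_smul _ _ _) (fun c a => by simp [mul_assoc])
    (fun a => mul_nonneg (norm_nonneg _) (Finset.prod_nonneg fun _ _ => apply_nonneg _ _))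
    (fun x => by
      induction x using PiTensorProduct.induction_on with
      | smul_tprod r f => exact ⟨[(r, f)], by simp⟩
      | add x y hx hy =>
        obtain ⟨l, hl⟩ := hx
        obtain ⟨m, hm⟩ := hy
        exact ⟨l ++ m, by rw [List.map_append, List.sum_append, hl, hm]⟩)

/-- The tensor algebra `T(V) = ⨁ₙ V^{⊗n}`. -/
abbrev TensorAlg : Type _ := ⨁ n : ℕ, ⨂[𝕜]^n V

/-- The symmetrizer `v₁ ⊗ ⋯ ⊗ vₙ ↦ (1/n!) ∑_σ v_{σ(1)} ⊗ ⋯ ⊗ v_{σ(n)}`. -/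
def symmetrizer (n : ℕ) : (⨂[𝕜]^n V) →ₗ[𝕜] (⨂[𝕜]^n V) :=
  (n.factorial : 𝕜)⁻¹ • ∑ σ : Equiv.Perm (Fin n),
    (PiTensorProduct.reindex 𝕜 (fun _ : Fin n => V) σ).toLinearMap

/-- The `n`-th symmetric power, as the space of symmetric tensors. -/
def SymPow (n : ℕ) : Submodule 𝕜 (⨂[𝕜]^n V) := LinearMap.range (symmetrizer 𝕜 V n)

/-- The symmetrizer as a map onto the symmetric tensors. -/
def toSymPow (n : ℕ) : (⨂[𝕜]^n V) →ₗ[𝕜] SymPow 𝕜 V n := (symmetrizer 𝕜 V n).rangeRestrict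

/-- The symmetric algebra `Sym(V) = ⨁ₙ Symⁿ(V)`. Its elements are those of the locally convex space
`Sym_R(V)`; the parameter `R` only serves to select the topology. -/
def SymR (_R : ℝ) : Type _ := ⨁ n : ℕ, SymPow 𝕜 V n

variable (R : ℝ)

instance : AddCommGroup (SymR 𝕜 V R) := inferInstanceAs (AddCommGroup (⨁ n : ℕ, SymPow 𝕜 V n))
instance : Module 𝕜 (SymR 𝕜 V R) := inferInstanceAs (Module 𝕜 (⨁ n : ℕ, SymPow 𝕜 V n))

/-- The inclusion `Symⁿ(V) → Sym(V)`. -/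
def symOf (n : ℕ) : SymPow 𝕜 V n →ₗ[𝕜] SymR 𝕜 V R :=
  DirectSum.lof 𝕜 ℕ (fun n => SymPow 𝕜 V n) n

/-- The homogeneous component of degree `n`. -/
def symComponent (n : ℕ) : SymR 𝕜 V R →ₗ[𝕜] SymPow 𝕜 V n :=
  DirectSum.component 𝕜 ℕ (fun n => SymPow 𝕜 V n) n

/-- The projection `π_n : Sym(V) → Sym(V)` onto the homogeneous part of degree `n`. -/
def symProj (n : ℕ) : SymR 𝕜 V R →ₗ[𝕜] SymR 𝕜 V R := symOf 𝕜 V R n ∘ₗ symComponent 𝕜 V R n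

/-- A linear map out of `Sym(V)` from its restrictions to the homogeneous components. -/
def symDesc {𝕜 V} [RCLike 𝕜] [AddCommGroup V] [Module 𝕜 V] {R : ℝ} {W : Type*} [AddCommGroup W]
    [Module 𝕜 W] (f : ∀ n, SymPow 𝕜 V n →ₗ[𝕜] W) : SymR 𝕜 V R →ₗ[𝕜] W :=
  DirectSum.toModule 𝕜 ℕ W f

/-- The inclusion `Sym(V) ⊆ T(V)`. -/
def symIncl : SymR 𝕜 V R →ₗ[𝕜] TensorAlg 𝕜 V :=
  symDesc fun n => DirectSum.lof 𝕜 ℕ (fun n => ⨂[𝕜]^n V) n ∘ₗ (SymPow 𝕜 V n).subtype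

/-- The symmetrization map `T(V) → Sym(V)`. -/
def symmetrize : TensorAlg 𝕜 V →ₗ[𝕜] SymR 𝕜 V R :=
  DirectSum.toModule 𝕜 ℕ _ fun n => symOf 𝕜 V R n ∘ₗ toSymPow 𝕜 V n

/-- The symmetric product `v₁ ⋯ vₙ` of `n` vectors. -/
def symProd (n : ℕ) : MultilinearMap 𝕜 (fun _ : Fin n => V) (SymR 𝕜 V R) :=
  (symmetrize 𝕜 V R ∘ₗ DirectSum.lof 𝕜 ℕ (fun n => ⨂[𝕜]^n V) n).compMultilinearMap
    (PiTensorProduct.tprod 𝕜)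

/-- The unit `1 ∈ Sym⁰(V)`, the empty product. -/
def symOne : SymR 𝕜 V R := symProd 𝕜 V R 0 Fin.elim0

/-- The symmetric tensor product `xy = S(x ⊗ y)` on `Sym(V)`. -/
def symMul {𝕜 V R} [RCLike 𝕜] [AddCommGroup V] [Module 𝕜 V] (x y : SymR 𝕜 V R) : SymR 𝕜 V R :=
  symmetrize 𝕜 V R (symIncl 𝕜 V R x * symIncl 𝕜 V R y)

/-- The antipode `S(ξ₁ ⋯ ξₙ) = (-1)ⁿ ξ₁ ⋯ ξₙ`. -/
def antipode : SymR 𝕜 V R →ₗ[𝕜] SymR 𝕜 V R := symDesc fun n => (-1 : 𝕜) ^ n • symOf 𝕜 V R n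

/-- The counit: projection onto `Sym⁰(V) = 𝕜`. -/
def counit : SymR 𝕜 V R →ₗ[𝕜] 𝕜 :=
  (PiTensorProduct.isEmptyEquiv (R := 𝕜) (s := fun _ : Fin 0 => V) (Fin 0)).toLinearMap ∘ₗ
    (SymPow 𝕜 V 0).subtype ∘ₗ symComponent 𝕜 V R 0

/-- The multilinear map `(ξ₁, …, ξₙ) ↦ ∑_{I ⊆ {1, …, n}} ξ_I ⊗ ξ_{Iᶜ}`, where `ξ_I` is the symmetric
product of the `ξᵢ` with `i ∈ I`. -/
def shuffle (n : ℕ) :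
    MultilinearMap 𝕜 (fun _ : Fin n => V) (SymR 𝕜 V R ⊗[𝕜] SymR 𝕜 V R) :=
  ∑ I : Finset (Fin n),
    (MultilinearMap.domCoprod (symProd 𝕜 V R I.card) (symProd 𝕜 V R Iᶜ.card)).domDomCongr
      (finSumEquivOfFinset (s := I) rfl rfl)

/-- The undeformed (shuffle) coproduct
`Δ(ξ₁ ⋯ ξₙ) = ∑_{I ⊆ {1, …, n}} ξ_I ⊗ ξ_{Iᶜ}`. -/
def coproduct : SymR 𝕜 V R →ₗ[𝕜] SymR 𝕜 V R ⊗[𝕜] SymR 𝕜 V R :=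
  symDesc fun n => PiTensorProduct.lift (shuffle 𝕜 V R n) ∘ₗ (SymPow 𝕜 V n).subtype

/-- The map `Sym(V) → Sym(W)`, `ξ₁ ⋯ ξₙ ↦ φ(ξ₁) ⋯ φ(ξₙ)` induced by a linear map `φ`. -/
def symMap {𝕜 V W : Type*} [RCLike 𝕜] [AddCommGroup V] [Module 𝕜 V] [AddCommGroup W] [Module 𝕜 W]
    (R : ℝ) (φ : V →ₗ[𝕜] W) : SymR 𝕜 V R →ₗ[𝕜] SymR 𝕜 W R :=
  symDesc fun n => symmetrize 𝕜 W R ∘ₗ DirectSum.lof 𝕜 ℕ (fun n => ⨂[𝕜]^n W) n ∘ₗ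
    PiTensorProduct.map (fun _ => φ) ∘ₗ (SymPow 𝕜 V n).subtype

/-- A bilinear map on `Sym(V)` from its restrictions to pairs of homogeneous components. -/
def symBilin {𝕜 V} [RCLike 𝕜] [AddCommGroup V] [Module 𝕜 V] {R : ℝ} {W : Type*} [AddCommGroup W]
    [Module 𝕜 W] (f : ∀ k l, SymPow 𝕜 V k →ₗ[𝕜] SymPow 𝕜 V l →ₗ[𝕜] W) :
    SymR 𝕜 V R →ₗ[𝕜] SymR 𝕜 V R →ₗ[𝕜] W :=
  symDesc fun k => (symDesc fun l => (f k l).flip).flip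

end Algebraic

/-! ### The Gutt star product -/

section Star

variable (𝕜 : Type*) [RCLike 𝕜] (𝔤 : Type*) [LieRing 𝔤] [LieAlgebra 𝕜 𝔤] (R : ℝ)

/-- The map `𝔮 : Sym(𝔤) → U(𝔤)`, `ξ₁ ⋯ ξₙ ↦ (1/n!) ∑_σ ξ_{σ(1)} ⊙ ⋯ ⊙ ξ_{σ(n)}`. Since `ξ₁ ⋯ ξₙ` is
the tensor `(1/n!) ∑_σ ξ_{σ(1)} ⊗ ⋯ ⊗ ξ_{σ(n)}`, it replaces `⊗` by the product `⊙` of `U(𝔤)`. -/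
def quantization : SymR 𝕜 𝔤 R →ₗ[𝕜] UniversalEnvelopingAlgebra 𝕜 𝔤 :=
  symDesc fun n => PiTensorProduct.lift
    ((MultilinearMap.mkPiAlgebraFin 𝕜 n (UniversalEnvelopingAlgebra 𝕜 𝔤)).compLinearMap
      fun _ => (UniversalEnvelopingAlgebra.mkAlgHom 𝕜 𝔤).toLinearMap ∘ₗ TensorAlgebra.ι 𝕜) ∘ₗ
    (SymPow 𝕜 𝔤 n).subtype

open Classical in
/-- The inverse of `𝔮` (which is bijective by the Poincaré–Birkhoff–Witt theorem). -/
def dequantization : UniversalEnvelopingAlgebra 𝕜 𝔤 →ₗ[𝕜] SymR 𝕜 𝔤 R :=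
  if h : Function.Bijective (quantization 𝕜 𝔤 R) then
    (LinearEquiv.ofBijective (quantization 𝕜 𝔤 R) h).symm.toLinearMap
  else 0

/-- `(x, y) ↦ 𝔮⁻¹(𝔮(x) ⊙ 𝔮(y))` for homogeneous `x` of degree `k` and `y` of degree `l`. -/
def pulledBackMul (k l : ℕ) : SymPow 𝕜 𝔤 k →ₗ[𝕜] SymPow 𝕜 𝔤 l →ₗ[𝕜] SymR 𝕜 𝔤 R :=
  ((LinearMap.mul 𝕜 (UniversalEnvelopingAlgebra 𝕜 𝔤)).compl₁₂
    (quantization 𝕜 𝔤 R ∘ₗ symOf 𝕜 𝔤 R k) (quantization 𝕜 𝔤 R ∘ₗ symOf 𝕜 𝔤 R l)).compr₂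
      (dequantization 𝕜 𝔤 R)

/-- The bilinear operators `Cₙ`: for `x` of degree `k` and `y` of degree `l`,
`Cₙ(x, y) = π_{k+l-n}(𝔮⁻¹(𝔮(x) ⊙ 𝔮(y)))` if `n ≤ k + l` and `Cₙ(x, y) = 0` otherwise. -/
def starCoeff (n : ℕ) : SymR 𝕜 𝔤 R →ₗ[𝕜] SymR 𝕜 𝔤 R →ₗ[𝕜] SymR 𝕜 𝔤 R :=
  symBilin fun k l =>
    if n ≤ k + l then (pulledBackMul 𝕜 𝔤 R k l).compr₂ (symProj 𝕜 𝔤 R (k + l - n)) else 0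

/-- The Gutt star product: for `x` of degree `k` and `y` of degree `l`,
`x ⋆_z y = ∑_{n=0}^{k+l} zⁿ π_{k+l-n}(𝔮⁻¹(𝔮(x) ⊙ 𝔮(y)))`. -/
def guttStar (z : 𝕜) : SymR 𝕜 𝔤 R →ₗ[𝕜] SymR 𝕜 𝔤 R →ₗ[𝕜] SymR 𝕜 𝔤 R :=
  symBilin fun k l => ∑ n ∈ Finset.range (k + l + 1),
    z ^ n • (pulledBackMul 𝕜 𝔤 R k l).compr₂ (symProj 𝕜 𝔤 R (k + l - n))

end Star

/-! ### The topologies -/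

section Topology

variable {𝕜 : Type*} [RCLike 𝕜] {V : Type*} [AddCommGroup V] [Module 𝕜 V]

lemma finite_support_weighted (R : ℝ) (p : Seminorm 𝕜 V) (x : TensorAlg 𝕜 V) :
    (Function.support fun n : ℕ => (n.factorial : ℝ) ^ R * tensorPowSeminorm p n (x n)).Finite := by
  classical
  refine (DFinsupp.support x).finite_toSet.subset fun n hn => ?_
  simp only [Finset.mem_coe, DFinsupp.mem_support_toFun]
  intro h
  apply hn
  change (n.factorial : ℝ) ^ R * tensorPowSeminorm p n (x n) = 0
  rw [show x n = 0 from h, map_zero, mul_zero]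

/-- The seminorm `p_R = ∑ₙ n!^R pⁿ` on the tensor algebra. -/
def tensorSeminormR (R : ℝ) (p : Seminorm 𝕜 V) : Seminorm 𝕜 (TensorAlg 𝕜 V) :=
  Seminorm.of (fun x => ∑' n : ℕ, (n.factorial : ℝ) ^ R * tensorPowSeminorm p n (x n))
    (by
      intro x y
      rw [← Summable.tsum_add (summable_of_hasFiniteSupport (finite_support_weighted R p x))
        (summable_of_hasFiniteSupport (finite_support_weighted R p y))]
      refine Summable.tsum_le_tsum (fun n => ?_)
        (summable_of_hasFiniteSupport (finite_support_weighted R p (x + y)))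
        ((summable_of_hasFiniteSupport (finite_support_weighted R p x)).add
          (summable_of_hasFiniteSupport (finite_support_weighted R p y)))
      rw [← mul_add]
      exact mul_le_mul_of_nonneg_left (map_add_le_add _ _ _)
        (Real.rpow_nonneg (Nat.cast_nonneg _) _))
    (by
      intro c x
      rw [← tsum_mul_left]
      refine tsum_congr fun n => ?_
      rw [show (c • x) n = c • x n from rfl, map_smul_eq_mul]
      ring)

/-- The seminorm `p_R` on `Sym(V)`, the restriction of `p_R` on the tensor algebra. -/
def symSeminormR (R : ℝ) (p : Seminorm 𝕜 V) : Seminorm 𝕜 (SymR 𝕜 V R) :=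
  (tensorSeminormR R p).comp (symIncl 𝕜 V R)

variable (𝕜 V) in
/-- The seminorms `p_R`, for all continuous seminorms `p` on `V`. -/
def symFamily [TopologicalSpace V] (R : ℝ) :
    SeminormFamily 𝕜 (SymR 𝕜 V R) {p : Seminorm 𝕜 V // Continuous p} :=
  fun p => symSeminormR R p.1

instance {E : Type*} [AddCommGroup E] [Module 𝕜 E] [TopologicalSpace E] :
    Nonempty {p : Seminorm 𝕜 E // Continuous p} := ⟨⟨0, continuous_const⟩⟩

/-- The uniform structure on a vector space defined by a family of seminorms. -/
abbrev uniformSpaceOfSeminorms {E ι : Type*} [AddCommGroup E] [Module 𝕜 E] [Nonempty ι]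
    (P : SeminormFamily 𝕜 E ι) : UniformSpace E :=
  @IsTopologicalAddGroup.rightUniformSpace E _ P.moduleFilterBasis.topology
    (P.addGroupFilterBasis.isTopologicalAddGroup)

lemma isUniformAddGroup_ofSeminorms {E ι : Type*} [AddCommGroup E] [Module 𝕜 E] [Nonempty ι]
    (P : SeminormFamily 𝕜 E ι) : @IsUniformAddGroup E (uniformSpaceOfSeminorms P) _ :=
  @isUniformAddGroup_of_addCommGroup E _ P.moduleFilterBasis.topology
    (P.addGroupFilterBasis.isTopologicalAddGroup)

lemma withSeminorms_ofSeminorms {E ι : Type*} [AddCommGroup E] [Module 𝕜 E] [Nonempty ι]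
    (P : SeminormFamily 𝕜 E ι) :
    @WithSeminorms 𝕜 E ι _ _ _ P (uniformSpaceOfSeminorms P).toTopologicalSpace :=
  @WithSeminorms.mk 𝕜 E ι _ _ _ P (uniformSpaceOfSeminorms P).toTopologicalSpace rfl

lemma uniformContinuousConstSMul_ofSeminorms {E ι : Type*} [AddCommGroup E] [Module 𝕜 E]
    [Nonempty ι] (P : SeminormFamily 𝕜 E ι) :
    @UniformContinuousConstSMul 𝕜 E (uniformSpaceOfSeminorms P) _ := by
  let := uniformSpaceOfSeminorms P
  have := isUniformAddGroup_ofSeminorms P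
  have := (withSeminorms_ofSeminorms P).continuousSMul
  exact uniformContinuousConstSMul_of_continuousConstSMul 𝕜 E

variable [TopologicalSpace V] (R : ℝ)

/-- The `Sym_R`-topology: the locally convex topology defined by all the seminorms `p_R`. -/
instance : UniformSpace (SymR 𝕜 V R) := uniformSpaceOfSeminorms (symFamily 𝕜 V R)
instance : IsUniformAddGroup (SymR 𝕜 V R) := isUniformAddGroup_ofSeminorms (symFamily 𝕜 V R)
instance : UniformContinuousConstSMul 𝕜 (SymR 𝕜 V R) :=
  uniformContinuousConstSMul_ofSeminorms (symFamily 𝕜 V R)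

variable (𝕜 V) in
/-- The completion of `Sym_R(V)`. -/
abbrev SymHat : Type _ := Completion (SymR 𝕜 V R)

/-- The continuous extension of the seminorm `p_R` to the completion of `Sym_R(V)`, for a continuous
seminorm `p` on `V`. -/
def seminormHat (p : Seminorm 𝕜 V) : SymHat 𝕜 V R → ℝ := Completion.extension (symSeminormR R p)

end Topology

/-! ### Completed projective tensor products and extensions by continuity -/

section ProjectiveTensor

variable (𝕜 : Type*) [RCLike 𝕜]

/-- The projective tensor product `p ⊗ q` of two seminorms:
`(p ⊗ q)(t) = inf {∑ᵢ p(xᵢ) q(yᵢ) | t = ∑ᵢ xᵢ ⊗ yᵢ}`. -/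
def projSeminorm {𝕜 E F : Type*} [RCLike 𝕜] [AddCommGroup E] [Module 𝕜 E] [AddCommGroup F]
    [Module 𝕜 F] (p : Seminorm 𝕜 E) (q : Seminorm 𝕜 F) : Seminorm 𝕜 (E ⊗[𝕜] F) :=
  infSeminorm (A := E × F) (fun a => a.1 ⊗ₜ[𝕜] a.2) (fun a => p a.1 * q a.2)
    (fun c a => (c • a.1, a.2)) (fun _ _ => rfl)
    (fun c a => by simp [map_smul_eq_mul, mul_assoc])
    (fun a => mul_nonneg (apply_nonneg _ _) (apply_nonneg _ _))
    (fun x => by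
      induction x using TensorProduct.induction_on with
      | zero => exact ⟨[], rfl⟩
      | tmul x y => exact ⟨[(x, y)], by simp⟩
      | add x y hx hy =>
        obtain ⟨l, hl⟩ := hx
        obtain ⟨m, hm⟩ := hy
        exact ⟨l ++ m, by rw [List.map_append, List.sum_append, hl, hm]⟩)

variable (E F G : Type*) [AddCommGroup E] [Module 𝕜 E] [AddCommGroup F] [Module 𝕜 F]
  [AddCommGroup G] [Module 𝕜 G]

/-- The tensor product `E ⊗_π F`, to be equipped with the projective topology. -/
def ProjTensor : Type _ := E ⊗[𝕜] F

instance : AddCommGroup (ProjTensor 𝕜 E F) := inferInstanceAs (AddCommGroup (E ⊗[𝕜] F))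
instance : Module 𝕜 (ProjTensor 𝕜 E F) := inferInstanceAs (Module 𝕜 (E ⊗[𝕜] F))

/-- The identity, from the algebraic tensor product to `E ⊗_π F`. -/
def toProj : (E ⊗[𝕜] F) ≃ₗ[𝕜] ProjTensor 𝕜 E F := LinearEquiv.refl 𝕜 _

/-- The seminorms `p ⊗ q`, for all continuous seminorms `p` on `E` and `q` on `F`. -/
def projFamily [TopologicalSpace E] [TopologicalSpace F] : SeminormFamily 𝕜 (ProjTensor 𝕜 E F)
    ({p : Seminorm 𝕜 E // Continuous p} × {q : Seminorm 𝕜 F // Continuous q}) :=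
  fun pq => (projSeminorm pq.1.1 pq.2.1).comp (toProj 𝕜 E F).symm.toLinearMap

section

variable [TopologicalSpace E] [TopologicalSpace F]

instance : UniformSpace (ProjTensor 𝕜 E F) := uniformSpaceOfSeminorms (projFamily 𝕜 E F)
instance : IsUniformAddGroup (ProjTensor 𝕜 E F) := isUniformAddGroup_ofSeminorms (projFamily 𝕜 E F)
instance : UniformContinuousConstSMul 𝕜 (ProjTensor 𝕜 E F) :=
  uniformContinuousConstSMul_ofSeminorms (projFamily 𝕜 E F)

/-- The completed projective tensor product. -/
abbrev CTensor : Type _ := Completion (ProjTensor 𝕜 E F)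

end

section Extension

variable {𝕜 E F G}
variable [UniformSpace E] [IsUniformAddGroup E] [UniformContinuousConstSMul 𝕜 E]
  [UniformSpace F] [IsUniformAddGroup F] [UniformContinuousConstSMul 𝕜 F]
  [UniformSpace G] [IsUniformAddGroup G] [UniformContinuousConstSMul 𝕜 G]

variable (𝕜 E) in
/-- The canonical linear map from a space to its completion. -/
def toHat : E →ₗ[𝕜] Completion E :=
  { Completion.toCompl with map_smul' := fun c x => Completion.coe_smul c x }

variable [T0Space G] [CompleteSpace G]

open Classical in
/-- The extension by continuity of a continuous linear map `f : E → G` to the completion of `E`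
(and `0` if `f` is not continuous). -/
def extendLin (f : E →ₗ[𝕜] G) : Completion E →L[𝕜] G :=
  if h : Continuous f then (⟨f, h⟩ : E →L[𝕜] G).fromCompletion else 0

section

variable (B : E →ₗ[𝕜] F →ₗ[𝕜] G)

/-- Extension by continuity to `Ê × F̂` of a map defined on `E × F`. -/
def extendBilinFun (x : Completion E) (y : Completion F) : G :=
  ((Completion.isDenseInducing_toCompl E).prodMap (Completion.isDenseInducing_toCompl F)).extend
    (fun p : E × F => B p.1 p.2) (x, y)

lemma continuous_extendBilinFun (hB : Continuous fun p : E × F => B p.1 p.2) :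
    Continuous fun p : Completion E × Completion F => extendBilinFun B p.1 p.2 := by
  let f : E →+ F →+ G := (AddMonoidHom.mk' (fun x => (B x).toAddMonoidHom) (by
    intro x y; ext z; simp))
  exact (Completion.isDenseInducing_toCompl E).extend_Z_bilin (φ := f)
    (Completion.isDenseInducing_toCompl F) hB

lemma extendBilinFun_coe (hB : Continuous fun p : E × F => B p.1 p.2) (x : E) (y : F) :
    extendBilinFun B (x : Completion E) (y : Completion F) = B x y :=
  ((Completion.isDenseInducing_toCompl E).prodMap
    (Completion.isDenseInducing_toCompl F)).extend_eq hB (x, y)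

lemma extendBilinFun_add_left (hB : Continuous fun p : E × F => B p.1 p.2)
    (x x' : Completion E) (y : Completion F) :
    extendBilinFun B (x + x') y = extendBilinFun B x y + extendBilinFun B x' y := by
  have hc := continuous_extendBilinFun B hB
  have h1 : Continuous fun t : Completion E × Completion E × Completion F =>
      extendBilinFun B (t.1 + t.2.1) t.2.2 :=
    hc.comp ((continuous_fst.add (continuous_fst.comp continuous_snd)).prodMk
      (continuous_snd.comp continuous_snd))
  have h2 : Continuous fun t : Completion E × Completion E × Completion F =>
      extendBilinFun B t.1 t.2.2 + extendBilinFun B t.2.1 t.2.2 :=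
    (hc.comp (continuous_fst.prodMk (continuous_snd.comp continuous_snd))).add
      (hc.comp continuous_snd)
  refine Completion.induction_on₃ x x' y (isClosed_eq h1 h2) fun a a' b => ?_
  rw [← Completion.coe_add, extendBilinFun_coe B hB, extendBilinFun_coe B hB,
    extendBilinFun_coe B hB, map_add, LinearMap.add_apply]

lemma extendBilinFun_add_right (hB : Continuous fun p : E × F => B p.1 p.2)
    (x : Completion E) (y y' : Completion F) :
    extendBilinFun B x (y + y') = extendBilinFun B x y + extendBilinFun B x y' := by
  have hc := continuous_extendBilinFun B hB
  have h1 : Continuous fun t : Completion E × Completion F × Completion F =>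
      extendBilinFun B t.1 (t.2.1 + t.2.2) :=
    hc.comp (continuous_fst.prodMk ((continuous_fst.comp continuous_snd).add
      (continuous_snd.comp continuous_snd)))
  have h2 : Continuous fun t : Completion E × Completion F × Completion F =>
      extendBilinFun B t.1 t.2.1 + extendBilinFun B t.1 t.2.2 :=
    (hc.comp (continuous_fst.prodMk (continuous_fst.comp continuous_snd))).add
      (hc.comp (continuous_fst.prodMk (continuous_snd.comp continuous_snd)))
  refine Completion.induction_on₃ x y y' (isClosed_eq h1 h2) fun a b b' => ?_
  rw [← Completion.coe_add, extendBilinFun_coe B hB, extendBilinFun_coe B hB,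
    extendBilinFun_coe B hB, map_add]

lemma extendBilinFun_smul_left (hB : Continuous fun p : E × F => B p.1 p.2)
    (c : 𝕜) (x : Completion E) (y : Completion F) :
    extendBilinFun B (c • x) y = c • extendBilinFun B x y := by
  have hc := continuous_extendBilinFun B hB
  have h1 : Continuous fun t : Completion E × Completion F => extendBilinFun B (c • t.1) t.2 :=
    hc.comp (((continuous_const_smul c).comp continuous_fst).prodMk continuous_snd)
  have h2 : Continuous fun t : Completion E × Completion F => c • extendBilinFun B t.1 t.2 :=
    (continuous_const_smul c).comp hc
  refine Completion.induction_on₂ x y (isClosed_eq h1 h2) fun a b => ?_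
  rw [← Completion.coe_smul, extendBilinFun_coe B hB, extendBilinFun_coe B hB, map_smul,
    LinearMap.smul_apply]

lemma extendBilinFun_smul_right (hB : Continuous fun p : E × F => B p.1 p.2)
    (c : 𝕜) (x : Completion E) (y : Completion F) :
    extendBilinFun B x (c • y) = c • extendBilinFun B x y := by
  have hc := continuous_extendBilinFun B hB
  have h1 : Continuous fun t : Completion E × Completion F => extendBilinFun B t.1 (c • t.2) :=
    hc.comp (continuous_fst.prodMk ((continuous_const_smul c).comp continuous_snd))
  have h2 : Continuous fun t : Completion E × Completion F => c • extendBilinFun B t.1 t.2 :=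
    (continuous_const_smul c).comp hc
  refine Completion.induction_on₂ x y (isClosed_eq h1 h2) fun a b => ?_
  rw [← Completion.coe_smul, extendBilinFun_coe B hB, extendBilinFun_coe B hB, map_smul]

/-- The extension by continuity of a continuous bilinear map. -/
def extendBilinOfContinuous (hB : Continuous fun p : E × F => B p.1 p.2) :
    Completion E →ₗ[𝕜] Completion F →ₗ[𝕜] G :=
  LinearMap.mk₂ 𝕜 (extendBilinFun B) (extendBilinFun_add_left B hB)
    (extendBilinFun_smul_left B hB) (extendBilinFun_add_right B hB)
    (extendBilinFun_smul_right B hB)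

end

open Classical in
/-- The extension by continuity of a (jointly) continuous bilinear map `B : E × F → G` to the
completions (and `0` if `B` is not continuous). -/
def extendBilin (B : E →ₗ[𝕜] F →ₗ[𝕜] G) : Completion E →ₗ[𝕜] Completion F →ₗ[𝕜] G :=
  if h : Continuous fun p : E × F => B p.1 p.2 then extendBilinOfContinuous B h else 0

end Extension

section Maps

variable {𝕜} {E F G H E' F' : Type*}
  [AddCommGroup E] [Module 𝕜 E] [UniformSpace E] [IsUniformAddGroup E]
  [UniformContinuousConstSMul 𝕜 E]
  [AddCommGroup F] [Module 𝕜 F] [UniformSpace F] [IsUniformAddGroup F]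
  [UniformContinuousConstSMul 𝕜 F]
  [AddCommGroup G] [Module 𝕜 G] [UniformSpace G] [IsUniformAddGroup G]
  [UniformContinuousConstSMul 𝕜 G]
  [AddCommGroup E'] [Module 𝕜 E'] [TopologicalSpace E']
  [AddCommGroup F'] [Module 𝕜 F'] [TopologicalSpace F']

/-- The linear map `Ê ⊗̂_π F̂ → G` given by a continuous bilinear map `B` into a complete space:
`x ⊗ y ↦ B x y`. -/
def liftHat [T0Space G] [CompleteSpace G] (B : E →ₗ[𝕜] F →ₗ[𝕜] G) : CTensor 𝕜 E F →L[𝕜] G :=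
  extendLin (TensorProduct.lift B ∘ₗ (toProj 𝕜 E F).symm.toLinearMap)

/-- The canonical map from the algebraic to the completed projective tensor product. -/
def tensorHat (𝕜 E F : Type*) [RCLike 𝕜] [AddCommGroup E] [Module 𝕜 E] [TopologicalSpace E]
    [AddCommGroup F] [Module 𝕜 F] [TopologicalSpace F] : (E ⊗[𝕜] F) →ₗ[𝕜] CTensor 𝕜 E F :=
  toHat 𝕜 (ProjTensor 𝕜 E F) ∘ₗ (toProj 𝕜 E F).toLinearMap

/-- The completed tensor product `f ⊗̂ g` of two continuous linear maps. -/
def mapHat (f : E →L[𝕜] E') (g : F →L[𝕜] F') : CTensor 𝕜 E F →L[𝕜] CTensor 𝕜 E' F' :=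
  extendLin (tensorHat 𝕜 E' F' ∘ₗ TensorProduct.map f.toLinearMap g.toLinearMap ∘ₗ
    (toProj 𝕜 E F).symm.toLinearMap)

/-- The continuous bilinear map `(x ⊗ y, c) ↦ x ⊗ (y ⊗ c)`, extended to `E ⊗̂_π F` in the first
argument. -/
def assocBilin (𝕜 E F G : Type*) [RCLike 𝕜]
    [AddCommGroup E] [Module 𝕜 E] [UniformSpace E]
    [AddCommGroup F] [Module 𝕜 F] [UniformSpace F]
    [AddCommGroup G] [Module 𝕜 G] [UniformSpace G] [IsUniformAddGroup G]
    [UniformContinuousConstSMul 𝕜 G] :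
    CTensor 𝕜 E F →ₗ[𝕜] G →ₗ[𝕜] CTensor 𝕜 E (CTensor 𝕜 F G) :=
  (extendBilin (((TensorProduct.mk 𝕜 (E ⊗[𝕜] F) G).compr₂
    (tensorHat 𝕜 E (CTensor 𝕜 F G) ∘ₗ (tensorHat 𝕜 F G).lTensor E ∘ₗ
      (TensorProduct.assoc 𝕜 E F G).toLinearMap)) ∘ₗ
        (toProj 𝕜 E F).symm.toLinearMap)).compl₂ (toHat 𝕜 G)

/-- The associativity isomorphism `(E ⊗̂ F) ⊗̂ G → E ⊗̂ (F ⊗̂ G)`, `(x ⊗ y) ⊗ c ↦ x ⊗ (y ⊗ c)`. -/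
def assocHat (𝕜 E F G : Type*) [RCLike 𝕜]
    [AddCommGroup E] [Module 𝕜 E] [UniformSpace E]
    [AddCommGroup F] [Module 𝕜 F] [UniformSpace F]
    [AddCommGroup G] [Module 𝕜 G] [UniformSpace G] [IsUniformAddGroup G]
    [UniformContinuousConstSMul 𝕜 G] :
    CTensor 𝕜 (CTensor 𝕜 E F) G →L[𝕜] CTensor 𝕜 E (CTensor 𝕜 F G) :=
  liftHat (assocBilin 𝕜 E F G)

/-- The product `(a ⊗ b)(c ⊗ d) = ac ⊗ bd` on `E ⊗̂_π E` for a continuous bilinear product on `E`. -/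
def tensorMulHat (mul : E →ₗ[𝕜] E →ₗ[𝕜] E) :
    CTensor 𝕜 E E →ₗ[𝕜] CTensor 𝕜 E E →ₗ[𝕜] CTensor 𝕜 E E :=
  extendBilin (((TensorProduct.map₂ mul mul).compl₁₂ (toProj 𝕜 E E).symm.toLinearMap
    (toProj 𝕜 E E).symm.toLinearMap).compr₂ (tensorHat 𝕜 E E))

end Maps

/-- Locally convex (topological) Hopf algebra structures on a locally convex space `H`: the product
is jointly continuous and the Hopf algebra axioms hold with respect to the completed projective
tensor product. -/
structure IsLocallyConvexHopf {𝕜 : Type*} [RCLike 𝕜] {H : Type*} [AddCommGroup H] [Module 𝕜 H]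
    [UniformSpace H] [IsUniformAddGroup H] [UniformContinuousConstSMul 𝕜 H]
    [CompleteSpace H] [T0Space H]
    (mul : H →ₗ[𝕜] H →ₗ[𝕜] H) (one : H)
    (Δ : H →L[𝕜] CTensor 𝕜 H H) (ε : H →L[𝕜] 𝕜) (S : H →L[𝕜] H) : Prop where
  locallyConvex : PolynormableSpace 𝕜 H
  continuous_mul : Continuous fun p : H × H => mul p.1 p.2
  mul_assoc : ∀ x y w, mul (mul x y) w = mul x (mul y w)
  one_mul : ∀ x, mul one x = x
  mul_one : ∀ x, mul x one = x
  coassoc : ∀ x, assocHat 𝕜 H H H (mapHat Δ (.id 𝕜 H) (Δ x)) = mapHat (.id 𝕜 H) Δ (Δ x)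
  counit_left : ∀ x, liftHat ((LinearMap.lsmul 𝕜 H) ∘ₗ ε.toLinearMap) (Δ x) = x
  counit_right : ∀ x, liftHat ((LinearMap.lsmul 𝕜 H) ∘ₗ ε.toLinearMap).flip (Δ x) = x
  comul_mul : ∀ x y, Δ (mul x y) = tensorMulHat mul (Δ x) (Δ y)
  comul_one : Δ one = tensorHat 𝕜 H H (one ⊗ₜ one)
  counit_mul : ∀ x y, ε (mul x y) = ε x * ε y
  counit_one : ε one = 1
  antipode_left : ∀ x, liftHat mul (mapHat S (.id 𝕜 H) (Δ x)) = ε x • one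
  antipode_right : ∀ x, liftHat mul (mapHat (.id 𝕜 H) S (Δ x)) = ε x • one

/-- Homomorphisms of locally convex Hopf algebras: continuous linear maps compatible with products,
units, coproducts, counits and antipodes. -/
structure IsHopfHom {𝕜 : Type*} [RCLike 𝕜]
    {H : Type*} [AddCommGroup H] [Module 𝕜 H] [UniformSpace H] [IsUniformAddGroup H]
    [UniformContinuousConstSMul 𝕜 H]
    {K : Type*} [AddCommGroup K] [Module 𝕜 K] [UniformSpace K] [IsUniformAddGroup K]
    [UniformContinuousConstSMul 𝕜 K]
    (mulH : H →ₗ[𝕜] H →ₗ[𝕜] H) (oneH : H)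
    (ΔH : H →L[𝕜] CTensor 𝕜 H H) (εH : H →L[𝕜] 𝕜) (SH : H →L[𝕜] H)
    (mulK : K →ₗ[𝕜] K →ₗ[𝕜] K) (oneK : K)
    (ΔK : K →L[𝕜] CTensor 𝕜 K K) (εK : K →L[𝕜] 𝕜) (SK : K →L[𝕜] K)
    (f : H →L[𝕜] K) : Prop where
  map_mul : ∀ x y, f (mulH x y) = mulK (f x) (f y)
  map_one : f oneH = oneK
  map_comul : ∀ x, mapHat f f (ΔH x) = ΔK (f x)
  map_counit : ∀ x, εK (f x) = εH x
  map_antipode : ∀ x, f (SH x) = SK (f x)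

end ProjectiveTensor

/-! ### The structure maps on the completion -/

section Completed

variable (𝕜 : Type*) [RCLike 𝕜] (V : Type*) [AddCommGroup V] [Module 𝕜 V] [TopologicalSpace V]
  (R : ℝ)

/-- The unit of the completion. -/
def oneHat : SymHat 𝕜 V R := toHat 𝕜 (SymR 𝕜 V R) (symOne 𝕜 V R)

/-- The coproduct, with values in the projective tensor product of two copies of the
completion. -/
def coproductToHat : SymR 𝕜 V R →ₗ[𝕜] CTensor 𝕜 (SymHat 𝕜 V R) (SymHat 𝕜 V R) :=
  tensorHat 𝕜 (SymHat 𝕜 V R) (SymHat 𝕜 V R) ∘ₗ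
    TensorProduct.map (toHat 𝕜 (SymR 𝕜 V R)) (toHat 𝕜 (SymR 𝕜 V R)) ∘ₗ coproduct 𝕜 V R

/-- The extension of the undeformed coproduct to the completion. -/
def coproductHat : SymHat 𝕜 V R →L[𝕜] CTensor 𝕜 (SymHat 𝕜 V R) (SymHat 𝕜 V R) :=
  extendLin (coproductToHat 𝕜 V R)

/-- The extension of the counit to the completion. -/
def counitHat : SymHat 𝕜 V R →L[𝕜] 𝕜 := extendLin (counit 𝕜 V R)

/-- The extension of the antipode to the completion. -/
def antipodeHat : SymHat 𝕜 V R →L[𝕜] SymHat 𝕜 V R :=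
  extendLin (toHat 𝕜 (SymR 𝕜 V R) ∘ₗ antipode 𝕜 V R)

/-- The extension of `Sym(φ)` to the completions. -/
def symMapHat {𝕜 V W : Type*} [RCLike 𝕜] [AddCommGroup V] [Module 𝕜 V] [TopologicalSpace V]
    [AddCommGroup W] [Module 𝕜 W] [TopologicalSpace W] (R : ℝ) (φ : V →ₗ[𝕜] W) :
    SymHat 𝕜 V R →L[𝕜] SymHat 𝕜 W R :=
  extendLin (toHat 𝕜 (SymR 𝕜 W R) ∘ₗ symMap R φ)

end Completed

section CompletedStar

variable (𝕜 : Type*) [RCLike 𝕜] (𝔤 : Type*) [LieRing 𝔤] [LieAlgebra 𝕜 𝔤] [TopologicalSpace 𝔤]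
  (R : ℝ)

/-- The extension of the Gutt star product to the completion. -/
def starHat (z : 𝕜) : SymHat 𝕜 𝔤 R →ₗ[𝕜] SymHat 𝕜 𝔤 R →ₗ[𝕜] SymHat 𝕜 𝔤 R :=
  extendBilin ((guttStar 𝕜 𝔤 R z).compr₂ (toHat 𝕜 (SymR 𝕜 𝔤 R)))

/-- The extension of the operators `Cₙ` to the completion. -/
def starCoeffHat (n : ℕ) : SymHat 𝕜 𝔤 R →ₗ[𝕜] SymHat 𝕜 𝔤 R →ₗ[𝕜] SymHat 𝕜 𝔤 R :=
  extendBilin ((starCoeff 𝕜 𝔤 R n).compr₂ (toHat 𝕜 (SymR 𝕜 𝔤 R)))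

end CompletedStar

/-- The constant `32 · 2^{max(R - 2, 0)}` in the continuity estimates; it is `32` for `R ≤ 2`. -/
def estimateConst (R : ℝ) : ℝ≥0 := 32 * (2 : ℝ≥0) ^ max (R - 2) 0

end Gutt

end

open Finset.HasAntidiagonal (antidiagonal)

noncomputable section

namespace Gutt

set_option linter.unusedSectionVars false

/-! ### Symmetric tensors and polarization -/

section SymBasics

/-! The algebra rests on one operator. To first order in ξ the Baker–Campbell–Hausdorff series reads
ξ ⋆_z e^v = (f(z ad_v) ξ) · e^v with f(t) = t/(e^t - 1) = ∑ (B_j/j!) t^j. Taken degree by degree on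
the divided powers v^m/m!, this is the operator L_ξ called `leftMul`. By polarization the powers of
single vectors span Sym, so a linear identity needs to be checked only on divided powers of one v
(`symLinear_ext_divPow`), where it becomes an identity about f.

Two such identities carry the algebra. The functional equation `bern_commute`, applied to the
commuting operators ad_v ⊗ 1 and 1 ⊗ ad_v, gives [L_ξ, L_η] = z L_[ξ,η] (`leftMul_commutator`). The
identity f(l - r)(e^l - e^r)/(l - r) = e^r (`bern_exp_commute`), applied to left and right
multiplication by λ(v), shows that any linear λ into an algebra with [λξ, λη] = z λ[ξ,η] turns L_ξ
into multiplication by λ(ξ) (`mul_symEval`). The first makes Sym a U(𝔤)-module, whence 𝔮 is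
injective; the second makes 𝔮 surjective. So Poincaré–Birkhoff–Witt is proved along the way. The
Gutt product is then v^k ⋆_z y = L_v^k y (`guttStar_eq`). Choosing λ = L gives associativity, and
λ(ξ) = L_ξ ⊗ 1 + 1 ⊗ L_ξ gives compatibility with Δ. Powers of a single v multiply as polynomials,
so the undeformed antipode serves every z.

For the estimates, an asymptotic estimate q of p yields a seminorm s with p ≤ s ≤ q and s[x,y] ≤
s(x)s(y) (`wordSeminorm`). With the weights n! a contraction by the bracket has norm at most 1,
because the n + 1 choices of the contracted factor are paid for by (n+1)! = (n+1) n!. Together with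
|B_j|/j! ≤ 2^(-j) this shows that one left multiplication costs the passage from the weights w_k to
w_(k+1), where w_k(m) = k! binom(m+2k, m) 2^(-m) m! (`weightedSym_leftMul_le`). After k
multiplications, w_0 and w_k are compared with the weights n!^r by elementary inequalities
(`starWeight_le`), which produce the factor n!^(1-r)/(2·8^n) in the bound for C_n. For R ≥ 1 this
decays geometrically, and the powers of |z| are absorbed in (|z|+1)^(k+l).

All bounds are inequalities between continuous seminorms and extend to the completion. There the
series is controlled by the tail of ∑ 8^(-n), and the Hopf identities hold because they hold on a
dense subspace. -/

lemma sum_neg_one_pow_card_superset {ι : Type*} [Fintype ι] [DecidableEq ι] (T : Finset ι)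
    (hT : T ≠ Finset.univ) :
    ∑ S : Finset ι, (if T ⊆ S then (-1 : ℤ) ^ S.card else 0) = 0 := by
  obtain ⟨i, hi⟩ : ∃ i, i ∉ T := by
    by_contra! h
    exact hT (Finset.eq_univ_iff_forall.2 h)
  -- Toggling an element i outside T preserves T ⊆ S and reverses the sign.
  refine Finset.sum_involution (fun S _ => symmDiff S {i}) ?_ ?_ ?_ ?_
  · intro S _
    have key : T ⊆ symmDiff S {i} ↔ T ⊆ S := by
      constructor
      · intro h x hx
        have := h hx
        simp only [Finset.mem_symmDiff, Finset.mem_singleton] at this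
        rcases this with h | h
        · exact h.1
        · exact absurd (h.1 ▸ hx) hi
      · intro h x hx
        simp only [Finset.mem_symmDiff, Finset.mem_singleton]
        exact Or.inl ⟨h hx, fun e => hi (e ▸ hx)⟩
    simp only [key]
    split_ifs
    · by_cases hS : i ∈ S
      · have : symmDiff S {i} = S.erase i := by
          ext x; simp only [Finset.mem_symmDiff, Finset.mem_singleton, Finset.mem_erase]
          grind
        rw [this, ← Finset.card_erase_add_one hS]
        ring
      · have : symmDiff S {i} = insert i S := by
          ext x; simp only [Finset.mem_symmDiff, Finset.mem_singleton, Finset.mem_insert]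
          grind
        rw [this, Finset.card_insert_of_notMem hS]
        ring
    · simp
  · intro S _ _ h
    have : i ∈ symmDiff S {i} ↔ i ∈ S := by rw [h]
    simp only [Finset.mem_symmDiff, Finset.mem_singleton] at this
    grind
  · intro S _
    exact Finset.mem_univ _
  · intro S _
    simp

/-- Polarization: a symmetric multilinear map that vanishes on the diagonal is zero. -/
lemma multilinear_eq_zero_of_diag {𝕜 V W : Type*} [Field 𝕜] [CharZero 𝕜] [AddCommGroup V]
    [Module 𝕜 V] [AddCommGroup W] [Module 𝕜 W] {n : ℕ}
    (M : MultilinearMap 𝕜 (fun _ : Fin n => V) W)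
    (hsymm : ∀ (σ : Equiv.Perm (Fin n)) f, M (f ∘ σ) = M f)
    (hdiag : ∀ v, M (fun _ => v) = 0) (f : Fin n → V) : M f = 0 := by
  classical
  -- Expand M on the diagonal at the vector ∑_{j ∈ S} f j.
  have h1 : ∀ S : Finset (Fin n), ∑ r : Fin n → Fin n,
      (if Finset.univ.image r ⊆ S then M (f ∘ r) else 0) = 0 := by
    intro S
    have := hdiag (∑ j ∈ S, f j)
    rw [M.map_sum_finset (fun _ j => f j) (fun _ => S)] at this
    rw [← Finset.sum_filter, ← this]
    refine Finset.sum_congr ?_ fun _ _ => rfl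
    ext r
    simp [Fintype.mem_piFinset, Finset.image_subset_iff]
  -- Inclusion–exclusion: the alternating sum over S removes every r whose image is not everything.
  have h2 : ∑ r : Fin n → Fin n, (∑ S : Finset (Fin n),
      (if Finset.univ.image r ⊆ S then (-1 : ℤ) ^ S.card else 0)) • M (f ∘ r) = 0 := by
    calc _ = ∑ r : Fin n → Fin n, ∑ S : Finset (Fin n), (-1 : ℤ) ^ S.card •
          (if Finset.univ.image r ⊆ S then M (f ∘ r) else 0) := by
          refine Finset.sum_congr rfl fun r _ => ?_
          rw [Finset.sum_smul]
          refine Finset.sum_congr rfl fun S _ => ?_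
          split_ifs <;> simp
      _ = 0 := by
          rw [Finset.sum_comm]
          refine Finset.sum_eq_zero fun S _ => ?_
          rw [← Finset.smul_sum, h1, smul_zero]
  -- A surjective r is a permutation, so by symmetry all surviving terms are the same multiple of M
  -- f.
  have h3 : ∀ r : Fin n → Fin n, (∑ S : Finset (Fin n),
      (if Finset.univ.image r ⊆ S then (-1 : ℤ) ^ S.card else 0)) • M (f ∘ r) =
      if Function.Surjective r then (-1 : ℤ) ^ n • M f else 0 := by
    intro r
    split_ifs with hr
    · have hu : Finset.univ.image r = Finset.univ := Finset.image_univ_of_surjective hr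
      rw [hu, Finset.sum_eq_single Finset.univ]
      · rw [if_pos subset_rfl, Finset.card_univ, Fintype.card_fin]
        congr 1
        exact hsymm (Equiv.ofBijective r (Finite.surjective_iff_bijective.1 hr)) f
      · intro S _ hS
        rw [if_neg]
        intro h
        exact hS (Finset.eq_univ_iff_forall.2 fun x => h (Finset.mem_univ x))
      · simp
    · rw [sum_neg_one_pow_card_superset, zero_smul]
      intro h
      refine hr fun x => ?_
      have := h ▸ Finset.mem_univ x
      simpa using this
  simp_rw [h3] at h2
  rw [← Finset.sum_filter, Finset.sum_const] at h2
  have h4 : (Finset.univ.filter fun r : Fin n → Fin n => Function.Surjective r).card ≠ 0 := by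
    rw [Finset.card_ne_zero]
    exact ⟨id, by simp [Function.surjective_id]⟩
  have h5 : (((Finset.univ.filter fun r : Fin n → Fin n => Function.Surjective r).card : 𝕜) *
      (-1) ^ n) • M f = 0 := by
    rw [mul_smul, Nat.cast_smul_eq_nsmul, ← h2]
    congr 1
    rcases neg_one_pow_eq_or ℤ n with h | h <;> rcases Nat.even_or_odd n with hn | hn <;>
      simp [hn.neg_one_pow]
  refine (smul_eq_zero.1 h5).resolve_left ?_
  exact mul_ne_zero (by exact_mod_cast h4) (by simp)

variable {𝕜 : Type*} [RCLike 𝕜] {V : Type*} [AddCommGroup V] [Module 𝕜 V] {R : ℝ}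
  {W : Type*} [AddCommGroup W] [Module 𝕜 W]

lemma symmetrizer_tprod {n : ℕ} (f : Fin n → V) :
    symmetrizer 𝕜 V n (PiTensorProduct.tprod 𝕜 f) =
      (n.factorial : 𝕜)⁻¹ • ∑ σ : Equiv.Perm (Fin n), PiTensorProduct.tprod 𝕜 (f ∘ σ) := by
  simp only [symmetrizer, LinearMap.smul_apply, LinearMap.sum_apply, LinearEquiv.coe_coe,
    PiTensorProduct.reindex_tprod]
  congr 1
  -- Reindexing by σ precomposes with σ⁻¹, hence the substitution σ ↦ σ⁻¹.
  exact Fintype.sum_equiv (Equiv.inv (Equiv.Perm (Fin n))) _ _ fun σ => rfl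

lemma symmetrizer_tprod_comp {n : ℕ} (f : Fin n → V) (σ : Equiv.Perm (Fin n)) :
    symmetrizer 𝕜 V n (PiTensorProduct.tprod 𝕜 (f ∘ σ)) =
      symmetrizer 𝕜 V n (PiTensorProduct.tprod 𝕜 f) := by
  rw [symmetrizer_tprod, symmetrizer_tprod]
  congr 1
  exact Fintype.sum_equiv (Equiv.mulLeft σ) _ _ fun τ => rfl

lemma symmetrizer_idem {n : ℕ} (t : ⨂[𝕜]^n V) :
    symmetrizer 𝕜 V n (symmetrizer 𝕜 V n t) = symmetrizer 𝕜 V n t := by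
  induction t using PiTensorProduct.induction_on with
  | smul_tprod r f =>
    rw [map_smul, map_smul]
    congr 1
    conv_lhs => rw [symmetrizer_tprod]
    rw [map_smul, map_sum]
    simp_rw [symmetrizer_tprod_comp]
    rw [Finset.sum_const, Finset.card_univ, Fintype.card_perm, Fintype.card_fin,
      ← Nat.cast_smul_eq_nsmul 𝕜, smul_smul, inv_mul_cancel₀, one_smul]
    exact_mod_cast n.factorial_ne_zero
  | add x y hx hy => rw [map_add, map_add, hx, hy]

lemma coe_toSymPow {n : ℕ} (t : ⨂[𝕜]^n V) :
    ((toSymPow 𝕜 V n t : SymPow 𝕜 V n) : ⨂[𝕜]^n V) = symmetrizer 𝕜 V n t := rfl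

lemma symmetrizer_coe {n : ℕ} (x : SymPow 𝕜 V n) : symmetrizer 𝕜 V n (x : ⨂[𝕜]^n V) = x := by
  obtain ⟨_, t, rfl⟩ := x
  exact symmetrizer_idem t

lemma toSymPow_coe {n : ℕ} (x : SymPow 𝕜 V n) : toSymPow 𝕜 V n (x : ⨂[𝕜]^n V) = x :=
  Subtype.ext (symmetrizer_coe x)

lemma symDesc_symOf (f : ∀ n, SymPow 𝕜 V n →ₗ[𝕜] W) (n : ℕ) (x : SymPow 𝕜 V n) :
    symDesc f (symOf 𝕜 V R n x) = f n x := by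
  change DirectSum.toModule 𝕜 ℕ W f (DirectSum.lof 𝕜 ℕ (fun n => SymPow 𝕜 V n) n x) = f n x
  exact DirectSum.toModule_lof (M := fun n => SymPow 𝕜 V n) (φ := f) 𝕜 n x

lemma symmetrize_lof (n : ℕ) (t : ⨂[𝕜]^n V) :
    symmetrize 𝕜 V R (DirectSum.lof 𝕜 ℕ (fun n => ⨂[𝕜]^n V) n t) =
      symOf 𝕜 V R n (toSymPow 𝕜 V n t) := by
  rw [symmetrize, DirectSum.toModule_lof, LinearMap.comp_apply]

lemma symIncl_symOf (n : ℕ) (x : SymPow 𝕜 V n) :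
    symIncl 𝕜 V R (symOf 𝕜 V R n x) = DirectSum.lof 𝕜 ℕ (fun n => ⨂[𝕜]^n V) n x :=
  symDesc_symOf _ _ _

lemma symProd_apply {n : ℕ} (f : Fin n → V) :
    symProd 𝕜 V R n f = symOf 𝕜 V R n (toSymPow 𝕜 V n (PiTensorProduct.tprod 𝕜 f)) :=
  symmetrize_lof n _

lemma symLinear_ext {f g : SymR 𝕜 V R →ₗ[𝕜] W}
    (h : ∀ n, ∀ x : SymPow 𝕜 V n, f (symOf 𝕜 V R n x) = g (symOf 𝕜 V R n x)) : f = g :=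
  DirectSum.linearMap_ext 𝕜 fun n => LinearMap.ext (h n)

lemma symProd_comp {n : ℕ} (f : Fin n → V) (σ : Equiv.Perm (Fin n)) :
    symProd 𝕜 V R n (f ∘ σ) = symProd 𝕜 V R n f := by
  rw [symProd_apply, symProd_apply]
  congr 1
  exact Subtype.ext (symmetrizer_tprod_comp f σ)

lemma symLinear_ext_symProd {f g : SymR 𝕜 V R →ₗ[𝕜] W}
    (h : ∀ n v, f (symProd 𝕜 V R n v) = g (symProd 𝕜 V R n v)) : f = g := by
  refine symLinear_ext fun n x => ?_
  rw [← toSymPow_coe x]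
  generalize (x : ⨂[𝕜]^n V) = t
  induction t using PiTensorProduct.induction_on with
  | smul_tprod r v =>
    simp only [map_smul]
    rw [← symProd_apply, h]
  | add x y hx hy => simp only [map_add, hx, hy]

variable (𝕜 R) in
/-- The power `vⁿ` in the symmetric algebra. -/
def symPow (n : ℕ) (v : V) : SymR 𝕜 V R := symProd 𝕜 V R n fun _ => v

/-- Polarization. Nearly all identities below are proved through this lemma, or its divided-power
form, with a single vector v. -/
lemma symLinear_ext_symPow {f g : SymR 𝕜 V R →ₗ[𝕜] W}
    (h : ∀ n v, f (symPow 𝕜 R n v) = g (symPow 𝕜 R n v)) : f = g := by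
  refine symLinear_ext_symProd fun n v => ?_
  rw [← sub_eq_zero]
  refine multilinear_eq_zero_of_diag ((f - g).compMultilinearMap (symProd 𝕜 V R n))
    (fun σ w => ?_) (fun w => ?_) v
  · simp only [LinearMap.compMultilinearMap_apply, symProd_comp]
  · simpa [symPow, sub_eq_zero] using h n w

lemma symOne_eq (v : V) : symOne 𝕜 V R = symPow 𝕜 R 0 v :=
  congrArg (symProd 𝕜 V R 0) (Subsingleton.elim _ _)

/-- The linear map on the symmetric algebra given on symmetric tensors by multilinear maps. -/
def symLift (Φ : ∀ n, MultilinearMap 𝕜 (fun _ : Fin n => V) W) : SymR 𝕜 V R →ₗ[𝕜] W :=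
  symDesc fun n => PiTensorProduct.lift (Φ n) ∘ₗ (SymPow 𝕜 V n).subtype

lemma symLift_symProd (Φ : ∀ n, MultilinearMap 𝕜 (fun _ : Fin n => V) W) {n : ℕ} (f : Fin n → V) :
    symLift Φ (symProd 𝕜 V R n f) =
      (n.factorial : 𝕜)⁻¹ • ∑ σ : Equiv.Perm (Fin n), Φ n (f ∘ σ) := by
  rw [symProd_apply, symLift, symDesc_symOf, LinearMap.comp_apply, Submodule.subtype_apply,
    coe_toSymPow, symmetrizer_tprod, map_smul, map_sum]
  simp

lemma symLift_of_symmetric (Φ : ∀ n, MultilinearMap 𝕜 (fun _ : Fin n => V) W) {n : ℕ}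
    (f : Fin n → V) (h : ∀ σ : Equiv.Perm (Fin n), Φ n (f ∘ σ) = Φ n f) :
    symLift Φ (symProd 𝕜 V R n f) = Φ n f := by
  rw [symLift_symProd]
  simp_rw [h]
  rw [Finset.sum_const, Finset.card_univ, Fintype.card_perm, Fintype.card_fin,
    ← Nat.cast_smul_eq_nsmul 𝕜, smul_smul, inv_mul_cancel₀, one_smul]
  exact_mod_cast n.factorial_ne_zero

lemma symLift_symPow (Φ : ∀ n, MultilinearMap 𝕜 (fun _ : Fin n => V) W) (n : ℕ) (v : V) :
    symLift Φ (symPow 𝕜 R n v) = Φ n fun _ => v :=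
  symLift_of_symmetric Φ _ fun _ => rfl

/-- Each position is the preimage of 0 under exactly a! permutations. -/
lemma sum_perm_symm_zero {M : Type*} [AddCommMonoid M] (a : ℕ) (g : Fin (a + 1) → M) :
    ∑ σ : Equiv.Perm (Fin (a + 1)), g (σ⁻¹ 0) = a.factorial • ∑ i, g i := by
  rw [← Fintype.sum_equiv (Equiv.inv (Equiv.Perm (Fin (a + 1)))) (fun σ => g (σ 0))
    (fun σ => g (σ⁻¹ 0)) (fun σ => by simp)]
  rw [← Fintype.sum_equiv (Equiv.Perm.decomposeFin (n := a)).symm (fun p => g p.1)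
    (fun σ => g (σ 0)) (fun p => by simp [Equiv.Perm.decomposeFin_symm_apply_zero p.1 p.2])]
  rw [Fintype.sum_prod_type]
  simp [Fintype.card_perm, Finset.smul_sum]

/-- A rearrangement of u, v, …, v depends only on the position of u, so the average over
permutations becomes an average over positions. -/
lemma symLift_cons_const (Φ : ∀ n, MultilinearMap 𝕜 (fun _ : Fin n => V) W) (a : ℕ) (u v : V) :
    symLift Φ (symProd 𝕜 V R (a + 1) (Fin.cons u fun _ => v)) =
      ((a + 1 : ℕ) : 𝕜)⁻¹ • ∑ i, Φ (a + 1) (Function.update (fun _ => v) i u) := by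
  rw [symLift_symProd]
  have : ∀ σ : Equiv.Perm (Fin (a + 1)),
      ((Fin.cons u fun _ => v : Fin (a + 1) → V) ∘ σ) =
        Function.update (fun _ => v) (σ⁻¹ 0) u := by
    intro σ
    ext i
    by_cases hi : σ i = 0
    · have : i = σ⁻¹ 0 := by simp [← hi]
      subst this
      simp
    · have : i ≠ σ⁻¹ 0 := by
        rintro rfl
        simp at hi
      rw [Function.update_of_ne this, Function.comp_apply]
      obtain ⟨j, hj⟩ := Fin.exists_succ_eq.2 hi
      rw [← hj, Fin.cons_succ]
  simp_rw [this]
  rw [sum_perm_symm_zero a fun i => Φ (a + 1) (Function.update (fun _ => v) i u),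
    ← Nat.cast_smul_eq_nsmul 𝕜, smul_smul, Nat.factorial_succ]
  congr 1
  have : (a.factorial : 𝕜) ≠ 0 := by exact_mod_cast a.factorial_ne_zero
  push_cast
  field_simp

end SymBasics

/-! ### Bernoulli identities -/

section Bernoulli

/-- The Taylor coefficients `Bₙ / n!` of `t / (eᵗ - 1)`. -/
def bern (𝕜 : Type*) [RCLike 𝕜] (n : ℕ) : 𝕜 := ((bernoulli n / n.factorial : ℚ) : 𝕜)

open PowerSeries in
-- The divided difference of F(t) = ∑ cₙ tⁿ at s and y, with its denominator cleared.
-- Coefficientwise it is (s - y) ∑ s^p y^q = s^(n+1) - y^(n+1).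
lemma powerSeries_mk_geom {A : Type*} [CommRing A] (c : ℕ → A) (s y : A) :
    C (s - y) * X * PowerSeries.mk (fun n =>
      c (n + 1) * ∑ pq ∈ antidiagonal n, s ^ pq.1 * y ^ pq.2) =
      rescale s (PowerSeries.mk c) - rescale y (PowerSeries.mk c) := by
  ext n
  rw [mul_assoc, coeff_C_mul]
  cases n with
  | zero =>
    rw [map_sub, coeff_rescale, coeff_rescale]
    simp
  | succ n =>
    rw [coeff_succ_X_mul, coeff_mk, map_sub, coeff_rescale, coeff_rescale, coeff_mk, ← sub_mul,
      mul_left_comm, mul_comm _ (c (n + 1))]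
    congr 1
    rw [Finset.Nat.sum_antidiagonal_eq_sum_range_succ (fun p q => s ^ p * y ^ q),
      mul_comm, ← (Commute.all s y).geom_sum₂_mul]
    simp

variable {𝕜 : Type*} [RCLike 𝕜]

lemma bernoulliPowerSeries_mvPolynomial :
    bernoulliPowerSeries (MvPolynomial (Fin 2) 𝕜) =
      PowerSeries.mk fun n => MvPolynomial.C (bern 𝕜 n) := by
  ext1 n
  rw [bernoulliPowerSeries, PowerSeries.coeff_mk, PowerSeries.coeff_mk]
  rw [IsScalarTower.algebraMap_apply ℚ 𝕜 (MvPolynomial (Fin 2) 𝕜)]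
  simp [bern]

open PowerSeries in
lemma rescale_bernoulli {A : Type*} [CommRing A] [Algebra ℚ A] (x : A) :
    rescale x (bernoulliPowerSeries A) * (rescale x (exp A) - 1) = C x * X := by
  have := congrArg (rescale x) (bernoulliPowerSeries_mul_exp_sub_one A)
  rw [map_mul, map_sub, map_one, rescale_X] at this
  exact this

open PowerSeries in
lemma rescale_exp_sub_one_ne_zero {A : Type*} [CommRing A] [Algebra ℚ A] {x : A} (hx : x ≠ 0) :
    rescale x (exp A) - 1 ≠ 0 := by
  intro h
  have := rescale_bernoulli x
  rw [h, mul_zero] at this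
  have := congrArg (coeff 1) this
  rw [coeff_C_mul, coeff_one_X] at this
  simp at this
  exact hx this.symm

open PowerSeries in
-- The functional equation of f(t) = t/(e^t - 1): G and H are divided differences of f. After
-- multiplication by (e^x - 1)(e^y - 1) it follows from e^(x+y) = e^x e^y. It is responsible for the
-- commutation relation of left multiplications.
lemma powerSeries_bernoulli_mul {A : Type*} [CommRing A] [IsDomain A] [Algebra ℚ A]
    {x y : A} (hx : x ≠ 0) (hy : y ≠ 0) (G H : PowerSeries A)
    (hG : C x * X * G = rescale (x + y) (bernoulliPowerSeries A) -
      rescale y (bernoulliPowerSeries A))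
    (hH : C y * X * H = rescale (x + y) (bernoulliPowerSeries A) -
      rescale x (bernoulliPowerSeries A)) :
    rescale x (bernoulliPowerSeries A) * G + rescale y (bernoulliPowerSeries A) * H =
      -rescale (x + y) (bernoulliPowerSeries A) := by
  have hfx := rescale_bernoulli x
  have hfy := rescale_bernoulli y
  have hfs := rescale_bernoulli (x + y)
  rw [← exp_mul_exp_eq_exp_add x y, map_add, add_mul] at hfs
  have hEx := rescale_exp_sub_one_ne_zero hx
  have hEy := rescale_exp_sub_one_ne_zero hy
  set fx := rescale x (bernoulliPowerSeries A)
  set fy := rescale y (bernoulliPowerSeries A)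
  set fs := rescale (x + y) (bernoulliPowerSeries A)
  set Ex := rescale x (exp A)
  set Ey := rescale y (exp A)
  refine mul_left_cancel₀ (mul_ne_zero hEx hEy) ?_
  linear_combination (Ey - 1) * G * hfx + (Ex - 1) * H * hfy + (Ey - 1) * hG + (Ex - 1) * hH
    - hfy - hfx + hfs

open PowerSeries in
-- Since e^l - e^r = e^r (e^(l-r) - 1), the factor f(l - r) inverts the divided difference of exp up
-- to e^r.
lemma powerSeries_bernoulli_exp {A : Type*} [CommRing A] [IsDomain A] [Algebra ℚ A]
    {l r : A} (hd : l - r ≠ 0) (G : PowerSeries A)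
    (hG : C (l - r) * X * G = rescale l (exp A) - rescale r (exp A)) :
    rescale (l - r) (bernoulliPowerSeries A) * G = rescale r (exp A) := by
  have hf := rescale_bernoulli (l - r)
  have hE := rescale_exp_sub_one_ne_zero hd
  have h := exp_mul_exp_eq_exp_add r (l - r)
  rw [add_sub_cancel] at h
  refine mul_left_cancel₀ hE ?_
  linear_combination G * hf + hG - h

open scoped IsMulCommutative in
-- Two commuting elements generate a commutative subalgebra. Identities proved in the polynomial
-- ring, a domain in which cancellation is allowed, can therefore be evaluated at commuting
-- operators.
lemma exists_mvPolynomial_aeval {E : Type*} [Ring E] [Algebra 𝕜 E] {X Y : E} (h : Commute X Y) :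
    ∃ φ : MvPolynomial (Fin 2) 𝕜 →ₐ[𝕜] E,
      φ (MvPolynomial.X 0) = X ∧ φ (MvPolynomial.X 1) = Y := by
  have hc : ∀ a ∈ ({X, Y} : Set E), ∀ b ∈ ({X, Y} : Set E), a * b = b * a := by
    rintro a (rfl | rfl) b (rfl | rfl)
    · rfl
    · exact h
    · exact h.symm
    · rfl
  have := Algebra.isMulCommutative_adjoin 𝕜 hc
  let x : Algebra.adjoin 𝕜 ({X, Y} : Set E) := ⟨X, Algebra.subset_adjoin (by simp)⟩
  let y : Algebra.adjoin 𝕜 ({X, Y} : Set E) := ⟨Y, Algebra.subset_adjoin (by simp)⟩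
  let ψ : MvPolynomial (Fin 2) 𝕜 →ₐ[𝕜] Algebra.adjoin 𝕜 ({X, Y} : Set E) :=
    MvPolynomial.aeval ![x, y]
  refine ⟨(Algebra.adjoin 𝕜 ({X, Y} : Set E)).val.comp ψ, ?_, ?_⟩
  · simp [ψ, x]
  · simp [ψ, y]

open PowerSeries in
-- The coefficient of tⁿ in `powerSeries_bernoulli_mul`, evaluated at X and Y.
lemma bern_commute {E : Type*} [Ring E] [Algebra 𝕜 E] {X Y : E} (h : Commute X Y) (n : ℕ) :
    ∑ jk ∈ antidiagonal n, (bern 𝕜 jk.1 * bern 𝕜 (jk.2 + 1)) •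
      (X ^ jk.1 * ∑ pq ∈ antidiagonal jk.2, (X + Y) ^ pq.1 * Y ^ pq.2 +
        Y ^ jk.1 * ∑ pq ∈ antidiagonal jk.2, (X + Y) ^ pq.1 * X ^ pq.2) =
      -(bern 𝕜 n • (X + Y) ^ n) := by
  obtain ⟨φ, rfl, rfl⟩ := exists_mvPolynomial_aeval (𝕜 := 𝕜) h
  set x : MvPolynomial (Fin 2) 𝕜 := MvPolynomial.X 0
  set y : MvPolynomial (Fin 2) 𝕜 := MvPolynomial.X 1
  have key := powerSeries_bernoulli_mul (x := x) (y := y) (MvPolynomial.X_ne_zero 0)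
    (MvPolynomial.X_ne_zero 1) _ _
    (by
      have := powerSeries_mk_geom (fun n => MvPolynomial.C (bern 𝕜 n)) (x + y) y
      rwa [add_sub_cancel_right, ← bernoulliPowerSeries_mvPolynomial] at this)
    (by
      have := powerSeries_mk_geom (fun n => MvPolynomial.C (bern 𝕜 n)) (x + y) x
      rwa [add_sub_cancel_left, ← bernoulliPowerSeries_mvPolynomial] at this)
  have := congrArg φ (congrArg (coeff n) key)
  rw [bernoulliPowerSeries_mvPolynomial] at this
  simp only [map_add, map_neg, coeff_mul, coeff_rescale, coeff_mk, map_sum, map_mul,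
    map_pow] at this
  simp only [← MvPolynomial.algebraMap_eq, AlgHom.commutes] at this
  rw [← Finset.sum_add_distrib] at this
  have e : ∀ (c : 𝕜) (Z : E), Z * algebraMap 𝕜 E c = c • Z := fun c Z => by
    rw [← Algebra.commutes, Algebra.smul_def]
  rw [e] at this
  rw [← this]
  refine Finset.sum_congr rfl fun jk _ => ?_
  simp only [e, Algebra.smul_mul_assoc, ← Algebra.smul_def, Algebra.mul_smul_comm, smul_smul,
    smul_add]
  rw [mul_comm (bern 𝕜 jk.1)]

open PowerSeries in
-- The coefficient of tⁿ in `powerSeries_bernoulli_exp`, evaluated at l and r.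
lemma bern_exp_commute {E : Type*} [Ring E] [Algebra 𝕜 E] {l r : E} (h : Commute l r) (n : ℕ) :
    ∑ ja ∈ antidiagonal n, (bern 𝕜 ja.1 * ((ja.2 + 1).factorial : 𝕜)⁻¹) •
      ((l - r) ^ ja.1 * ∑ pq ∈ antidiagonal ja.2, l ^ pq.1 * r ^ pq.2) =
      (n.factorial : 𝕜)⁻¹ • r ^ n := by
  obtain ⟨φ, rfl, rfl⟩ := exists_mvPolynomial_aeval (𝕜 := 𝕜) h
  set x : MvPolynomial (Fin 2) 𝕜 := MvPolynomial.X 0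
  set y : MvPolynomial (Fin 2) 𝕜 := MvPolynomial.X 1
  have hexp : exp (MvPolynomial (Fin 2) 𝕜) =
      PowerSeries.mk fun n => MvPolynomial.C ((n.factorial : 𝕜)⁻¹) := by
    ext1 n
    rw [coeff_exp, coeff_mk, IsScalarTower.algebraMap_apply ℚ 𝕜 (MvPolynomial (Fin 2) 𝕜)]
    simp
  have key := powerSeries_bernoulli_exp (l := x) (r := y)
    (sub_ne_zero.2 fun e => by
      have := MvPolynomial.X_injective e
      simp at this) _
    (by
      have := powerSeries_mk_geom (fun n => MvPolynomial.C ((n.factorial : 𝕜)⁻¹)) x y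
      rwa [← hexp] at this)
  have := congrArg φ (congrArg (coeff n) key)
  rw [bernoulliPowerSeries_mvPolynomial, hexp] at this
  simp only [map_sub, coeff_mul, coeff_rescale, coeff_mk, map_sum, map_mul,
    map_pow] at this
  simp only [← MvPolynomial.algebraMap_eq, AlgHom.commutes] at this
  have e : ∀ (c : 𝕜) (Z : E), Z * algebraMap 𝕜 E c = c • Z := fun c Z => by
    rw [← Algebra.commutes, Algebra.smul_def]
  rw [e] at this
  rw [← this]
  refine Finset.sum_congr rfl fun jk _ => ?_
  simp only [e, Algebra.smul_mul_assoc, ← Algebra.smul_def, Algebra.mul_smul_comm, smul_smul]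
  rw [mul_comm (bern 𝕜 jk.1)]

end Bernoulli

/-! ### Multiplication and contraction operators -/

section Operators

variable {𝕜 : Type*} [RCLike 𝕜] {V : Type*} [AddCommGroup V] [Module 𝕜 V] {R : ℝ}

variable (𝕜 V R) in
/-- Multiplication by a vector in the symmetric algebra. -/
def mulVec : V →ₗ[𝕜] SymR 𝕜 V R →ₗ[𝕜] SymR 𝕜 V R where
  toFun u := symLift fun n => (symProd 𝕜 V R (n + 1)).curryLeft u
  map_add' u w := symLinear_ext_symPow fun n v => by
    simp only [LinearMap.add_apply, symLift_symPow, map_add, _root_.add_apply]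
  map_smul' c u := symLinear_ext_symPow fun n v => by
    simp only [LinearMap.smul_apply, symLift_symPow, map_smul, _root_.smul_apply,
      RingHom.id_apply]

lemma mulVec_symProd (u : V) {n : ℕ} (f : Fin n → V) :
    mulVec 𝕜 V R u (symProd 𝕜 V R n f) = symProd 𝕜 V R (n + 1) (Fin.cons u f) := by
  refine symLift_of_symmetric _ _ fun σ => ?_
  simp only [MultilinearMap.curryLeft_apply]
  -- This permutation of n + 1 letters fixes 0 and acts as σ on the others.
  rw [← symProd_comp (Fin.cons u f) (Equiv.Perm.decomposeFin.symm (0, σ))]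
  congr 1
  ext i
  refine Fin.cases ?_ (fun j => ?_) i
  · simp
  · simp

lemma mulVec_symPow (v : V) (n : ℕ) :
    mulVec 𝕜 V R v (symPow 𝕜 R n v) = symPow 𝕜 R (n + 1) v := by
  rw [symPow, mulVec_symProd, symPow]
  congr 1
  ext i
  refine Fin.cases ?_ (fun j => ?_) i <;> simp

lemma mulVec_comm (u w : V) (x : SymR 𝕜 V R) :
    mulVec 𝕜 V R u (mulVec 𝕜 V R w x) = mulVec 𝕜 V R w (mulVec 𝕜 V R u x) := by
  suffices h : mulVec 𝕜 V R u ∘ₗ mulVec 𝕜 V R w = mulVec 𝕜 V R w ∘ₗ mulVec 𝕜 V R u from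
    LinearMap.congr_fun h x
  refine symLinear_ext_symProd fun n f => ?_
  simp only [LinearMap.comp_apply, mulVec_symProd]
  rw [← symProd_comp _ (Equiv.swap 0 1)]
  congr 1
  ext i
  refine Fin.cases ?_ (fun i => Fin.cases ?_ (fun j => ?_) i) i
  · simp
  · simp
  · have h0 : (j.succ.succ : Fin (n + 2)) ≠ 0 := Fin.succ_ne_zero _
    have h1 : (j.succ.succ : Fin (n + 2)) ≠ 1 := by
      rw [← Fin.succ_zero_eq_one]
      exact fun h => Fin.succ_ne_zero _ (Fin.succ_injective _ h)
    rw [Function.comp_apply, Equiv.swap_apply_of_ne_of_ne h0 h1]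
    simp

variable (𝕜 R) in
/-- The divided power `vⁿ / n!`. -/
def divPow (n : ℕ) (v : V) : SymR 𝕜 V R := (n.factorial : 𝕜)⁻¹ • symPow 𝕜 R n v

lemma factorial_smul_divPow (n : ℕ) (v : V) :
    (n.factorial : 𝕜) • divPow 𝕜 R n v = symPow 𝕜 R n v := by
  rw [divPow, smul_smul, mul_inv_cancel₀, one_smul]
  exact_mod_cast n.factorial_ne_zero

lemma symLinear_ext_divPow {W : Type*} [AddCommGroup W] [Module 𝕜 W] {f g : SymR 𝕜 V R →ₗ[𝕜] W}
    (h : ∀ n v, f (divPow 𝕜 R n v) = g (divPow 𝕜 R n v)) : f = g := by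
  refine symLinear_ext_symPow fun n v => ?_
  rw [← factorial_smul_divPow, map_smul, map_smul, h]

variable (𝕜 V R) in
/-- The multilinear map `(v₀, …, vₙ) ↦ v₀ ⊗ v₁ ⋯ vₙ`. -/
def splitHead (n : ℕ) : MultilinearMap 𝕜 (fun _ : Fin (n + 1) => V) (V ⊗[𝕜] SymR 𝕜 V R) :=
  LinearMap.uncurryLeft
    { toFun := fun v => (TensorProduct.mk 𝕜 V (SymR 𝕜 V R) v).compMultilinearMap (symProd 𝕜 V R n)
      map_add' := fun u v => by ext; simp
      map_smul' := fun c v => by ext; simp }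

lemma splitHead_apply (n : ℕ) (f : Fin (n + 1) → V) :
    splitHead 𝕜 V R n f = f 0 ⊗ₜ symProd 𝕜 V R n (Fin.tail f) := rfl

variable (𝕜 V R) in
/-- The contraction `v₁ ⋯ vₙ ↦ ∑ᵢ vᵢ ⊗ v₁ ⋯ v̂ᵢ ⋯ vₙ`. -/
def contraction : SymR 𝕜 V R →ₗ[𝕜] V ⊗[𝕜] SymR 𝕜 V R :=
  symLift fun n => match n with
    | 0 => 0
    -- The lift averages over the position of the head; the factor n + 1 turns the mean into the sum
    -- over all factors.
    | n + 1 => ((n + 1 : ℕ) : 𝕜) • splitHead 𝕜 V R n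

lemma inv_factorial_succ_mul (n : ℕ) :
    ((n + 1).factorial : 𝕜)⁻¹ * ((n + 1 : ℕ) : 𝕜) = (n.factorial : 𝕜)⁻¹ := by
  have h1 : (n.factorial : 𝕜) ≠ 0 := by exact_mod_cast n.factorial_ne_zero
  have h2 : ((n + 1 : ℕ) : 𝕜) ≠ 0 := by exact_mod_cast n.succ_ne_zero
  rw [Nat.factorial_succ, Nat.cast_mul, mul_inv, mul_comm, ← mul_assoc, mul_inv_cancel₀ h2,
    one_mul]

lemma contraction_divPow_succ (n : ℕ) (v : V) :
    contraction 𝕜 V R (divPow 𝕜 R (n + 1) v) = v ⊗ₜ divPow 𝕜 R n v := by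
  rw [divPow, map_smul, contraction, symLift_symPow, _root_.smul_apply, smul_smul,
    inv_factorial_succ_mul, splitHead_apply, divPow, TensorProduct.tmul_smul]
  rfl

lemma symProd_update_const (a : ℕ) (i : Fin (a + 1)) (u v : V) :
    symProd 𝕜 V R (a + 1) (Function.update (fun _ => v) i u) =
      mulVec 𝕜 V R u (symPow 𝕜 R a v) := by
  rw [symPow, mulVec_symProd, ← symProd_comp (Fin.cons u fun _ => v) (Equiv.swap 0 i)]
  congr 1
  ext j
  by_cases hj : j = i
  · subst hj
    simp
  · rw [Function.update_of_ne hj, Function.comp_apply]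
    have : Equiv.swap 0 i j ≠ 0 := by
      intro h
      rw [Equiv.swap_apply_eq_iff, Equiv.swap_apply_left] at h
      exact hj h
    obtain ⟨k, hk⟩ := Fin.exists_succ_eq.2 this
    rw [← hk, Fin.cons_succ]

lemma contraction_mulVec_symPow (a : ℕ) (u v : V) :
    contraction 𝕜 V R (mulVec 𝕜 V R u (symPow 𝕜 R a v)) =
      ∑ i : Fin (a + 1), (Function.update (fun _ => v) i u : Fin (a + 1) → V) 0 ⊗ₜ[𝕜]
        symProd 𝕜 V R a (Fin.tail (Function.update (fun _ => v) i u)) := by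
  rw [symPow, mulVec_symProd, contraction, symLift_cons_const]
  simp only [_root_.smul_apply, splitHead_apply]
  rw [← Finset.smul_sum, smul_smul, inv_mul_cancel₀, one_smul]
  exact_mod_cast a.succ_ne_zero

lemma contraction_mulVec_divPow_zero (u v : V) :
    contraction 𝕜 V R (mulVec 𝕜 V R u (divPow 𝕜 R 0 v)) = u ⊗ₜ divPow 𝕜 R 0 v := by
  rw [divPow, map_smul, map_smul, contraction_mulVec_symPow, TensorProduct.tmul_smul]
  congr 1

/-- The Leibniz rule: either u is taken out, or one of the factors v. -/
lemma contraction_mulVec_divPow_succ (a : ℕ) (u v : V) :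
    contraction 𝕜 V R (mulVec 𝕜 V R u (divPow 𝕜 R (a + 1) v)) =
      u ⊗ₜ divPow 𝕜 R (a + 1) v + v ⊗ₜ mulVec 𝕜 V R u (divPow 𝕜 R a v) := by
  rw [divPow, map_smul, map_smul, contraction_mulVec_symPow, Fin.sum_univ_succ, smul_add,
    TensorProduct.tmul_smul]
  congr 1
  · have : ∀ i : Fin (a + 1), (Function.update (fun _ => v) i.succ u : Fin (a + 2) → V) 0 ⊗ₜ[𝕜]
        symProd 𝕜 V R (a + 1) (Fin.tail (Function.update (fun _ => v) i.succ u)) =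
        v ⊗ₜ mulVec 𝕜 V R u (symPow 𝕜 R a v) := by
      intro i
      rw [Function.update_of_ne (Fin.succ_ne_zero i).symm, Fin.tail_update_succ,
        ← symProd_update_const a i]
      rfl
    simp_rw [this]
    rw [Finset.sum_const, Finset.card_univ, Fintype.card_fin, ← Nat.cast_smul_eq_nsmul 𝕜,
      smul_smul, inv_factorial_succ_mul, divPow, map_smul, TensorProduct.tmul_smul]

end Operators

/-! ### The operators of left multiplication -/

section LeftMul

variable {𝕜 : Type*} [RCLike 𝕜] {𝔤 : Type*} [LieRing 𝔤] [LieAlgebra 𝕜 𝔤] {R : ℝ}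

variable (𝕜 𝔤) in
/-- The bilinear map `(u, v) ↦ [v, u]`. -/
def bracketLeft : 𝔤 →ₗ[𝕜] 𝔤 →ₗ[𝕜] 𝔤 :=
  LinearMap.mk₂ 𝕜 (fun u v => ⁅v, u⁆) (by simp) (by simp) (by simp) (by simp)

variable (𝕜 𝔤 R) in
/-- The operator `u ⊗ v₁ ⋯ vₙ ↦ ∑ᵢ [vᵢ, u] ⊗ v₁ ⋯ v̂ᵢ ⋯ vₙ`. -/
def bracketContr : 𝔤 ⊗[𝕜] SymR 𝕜 𝔤 R →ₗ[𝕜] 𝔤 ⊗[𝕜] SymR 𝕜 𝔤 R :=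
  TensorProduct.lift (LinearMap.lcomp 𝕜 (𝔤 ⊗[𝕜] SymR 𝕜 𝔤 R) (contraction 𝕜 𝔤 R) ∘ₗ
    LinearMap.rTensorHom (SymR 𝕜 𝔤 R) ∘ₗ bracketLeft 𝕜 𝔤)

lemma bracketContr_tmul (u : 𝔤) (x : SymR 𝕜 𝔤 R) :
    bracketContr 𝕜 𝔤 R (u ⊗ₜ x) = (bracketLeft 𝕜 𝔤 u).rTensor (SymR 𝕜 𝔤 R)
      (contraction 𝕜 𝔤 R x) := rfl

lemma bracketContr_divPow_succ (n : ℕ) (u v : 𝔤) :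
    bracketContr 𝕜 𝔤 R (u ⊗ₜ divPow 𝕜 R (n + 1) v) = ⁅v, u⁆ ⊗ₜ divPow 𝕜 R n v := by
  rw [bracketContr_tmul, contraction_divPow_succ]
  rfl

lemma bracketContr_mulVec_divPow_zero (ξ u v : 𝔤) :
    bracketContr 𝕜 𝔤 R (ξ ⊗ₜ mulVec 𝕜 𝔤 R u (divPow 𝕜 R 0 v)) = ⁅u, ξ⁆ ⊗ₜ divPow 𝕜 R 0 v := by
  rw [bracketContr_tmul, contraction_mulVec_divPow_zero]
  rfl

lemma bracketContr_mulVec_divPow_succ (n : ℕ) (ξ u v : 𝔤) :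
    bracketContr 𝕜 𝔤 R (ξ ⊗ₜ mulVec 𝕜 𝔤 R u (divPow 𝕜 R (n + 1) v)) =
      ⁅u, ξ⁆ ⊗ₜ divPow 𝕜 R (n + 1) v + ⁅v, ξ⁆ ⊗ₜ mulVec 𝕜 𝔤 R u (divPow 𝕜 R n v) := by
  rw [bracketContr_tmul, contraction_mulVec_divPow_succ, map_add]
  rfl

/-- On divided powers no multiplicities appear: each contraction lowers the index by one and applies
ad v once. -/
lemma bracketContr_pow_divPow (j i : ℕ) (ξ v : 𝔤) :
    (bracketContr 𝕜 𝔤 R ^ j) (ξ ⊗ₜ divPow 𝕜 R (j + i) v) =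
      ((LieAlgebra.ad 𝕜 𝔤 v) ^ j) ξ ⊗ₜ divPow 𝕜 R i v := by
  induction j generalizing i with
  | zero => simp
  | succ j ih =>
    rw [pow_succ', Module.End.mul_apply, show j + 1 + i = j + (i + 1) by omega, ih,
      bracketContr_divPow_succ, pow_succ', Module.End.mul_apply, LieAlgebra.ad_apply]

/-- Either u is never contracted, or it is contracted at exactly one of the n steps, with pq.2
contractions by v before it and pq.1 after it. -/
lemma bracketContr_pow_succ_mulVec_divPow_add (n i : ℕ) (ξ u v : 𝔤) :
    (bracketContr 𝕜 𝔤 R ^ n) (ξ ⊗ₜ mulVec 𝕜 𝔤 R u (divPow 𝕜 R (n + i) v)) =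
      ((LieAlgebra.ad 𝕜 𝔤 v) ^ n) ξ ⊗ₜ mulVec 𝕜 𝔤 R u (divPow 𝕜 R i v) +
      match n with
      | 0 => 0
      | n + 1 => (∑ pq ∈ antidiagonal n, ((LieAlgebra.ad 𝕜 𝔤 v) ^ pq.1)
          ⁅u, ((LieAlgebra.ad 𝕜 𝔤 v) ^ pq.2) ξ⁆) ⊗ₜ divPow 𝕜 R (i + 1) v := by
  induction n generalizing i with
  | zero => simp
  | succ n ih =>
    rw [pow_succ', Module.End.mul_apply, show n + 1 + i = n + (i + 1) by omega, ih, map_add,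
      bracketContr_mulVec_divPow_succ, pow_succ', Module.End.mul_apply, LieAlgebra.ad_apply,
      add_comm (_ ⊗ₜ[𝕜] _) (_ ⊗ₜ[𝕜] _), add_assoc]
    congr 1
    cases n with
    | zero => simp
    | succ n =>
      dsimp only
      rw [bracketContr_divPow_succ, ← TensorProduct.add_tmul]
      congr 1
      rw [Finset.Nat.sum_antidiagonal_succ, lie_sum]
      congr 1
      refine Finset.sum_congr rfl fun pq _ => ?_
      rw [pow_succ', Module.End.mul_apply, LieAlgebra.ad_apply]

/-- The part of `bracketContr ^ (n + 1)` in which the bracket with the distinguished factor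
occurs. -/
lemma bracketContr_pow_succ_mulVec_divPow (n i : ℕ) (ξ u v : 𝔤) :
    (bracketContr 𝕜 𝔤 R ^ (n + 1)) (ξ ⊗ₜ mulVec 𝕜 𝔤 R u (divPow 𝕜 R (n + i) v)) =
      (match i with
      | 0 => 0
      | i + 1 => ((LieAlgebra.ad 𝕜 𝔤 v) ^ (n + 1)) ξ ⊗ₜ mulVec 𝕜 𝔤 R u (divPow 𝕜 R i v)) +
      (∑ pq ∈ antidiagonal n, ((LieAlgebra.ad 𝕜 𝔤 v) ^ pq.1)
          ⁅u, ((LieAlgebra.ad 𝕜 𝔤 v) ^ pq.2) ξ⁆) ⊗ₜ divPow 𝕜 R i v := by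
  cases i with
  | succ i =>
    rw [show n + (i + 1) = n + 1 + i by omega, bracketContr_pow_succ_mulVec_divPow_add]
  -- The total degree is n + 1 here, so n + 1 contractions use up u as well and the term in which u
  -- survives is absent.
  | zero =>
    rw [pow_succ', Module.End.mul_apply, bracketContr_pow_succ_mulVec_divPow_add, map_add,
      bracketContr_mulVec_divPow_zero, zero_add]
    cases n with
    | zero => simp
    | succ n =>
      dsimp only
      rw [bracketContr_divPow_succ, ← TensorProduct.add_tmul]
      congr 1
      rw [Finset.Nat.sum_antidiagonal_succ, lie_sum]
      congr 1
      refine Finset.sum_congr rfl fun pq _ => ?_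
      rw [pow_succ', Module.End.mul_apply, LieAlgebra.ad_apply]

variable (𝕜 𝔤 R) in
/-- The operators `v₁ ⋯ vₙ ↦ ∑ v_{i₁} ⋯ v̂ ⋯ v_{iₙ₋ⱼ} · [v, [v, …, [v, ξ]]]`, with `j` of the
factors contracted with `ξ`. -/
def mulContr (j : ℕ) : 𝔤 →ₗ[𝕜] SymR 𝕜 𝔤 R →ₗ[𝕜] SymR 𝕜 𝔤 R :=
  (TensorProduct.mk 𝕜 𝔤 (SymR 𝕜 𝔤 R)).compr₂
    (TensorProduct.lift (mulVec 𝕜 𝔤 R) ∘ₗ bracketContr 𝕜 𝔤 R ^ j)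

lemma mulContr_apply (j : ℕ) (ξ : 𝔤) (x : SymR 𝕜 𝔤 R) :
    mulContr 𝕜 𝔤 R j ξ x =
      TensorProduct.lift (mulVec 𝕜 𝔤 R) ((bracketContr 𝕜 𝔤 R ^ j) (ξ ⊗ₜ x)) := rfl

variable (𝕜 𝔤 R) in
/-- The operator of left multiplication by a vector for the star product `⋆_z`. -/
def leftMul (z : 𝕜) : 𝔤 →ₗ[𝕜] SymR 𝕜 𝔤 R →ₗ[𝕜] SymR 𝕜 𝔤 R :=
  -- In degree m at most m factors can be contracted, so the Bernoulli series may stop at j = m.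
  (symDesc fun m => (∑ j ∈ Finset.range (m + 1),
    (z ^ j * bern 𝕜 j) • (mulContr 𝕜 𝔤 R j).flip) ∘ₗ symOf 𝕜 𝔤 R m).flip

lemma leftMul_symOf (z : 𝕜) (ξ : 𝔤) (m : ℕ) (x : SymPow 𝕜 𝔤 m) :
    leftMul 𝕜 𝔤 R z ξ (symOf 𝕜 𝔤 R m x) = ∑ j ∈ Finset.range (m + 1),
      (z ^ j * bern 𝕜 j) • mulContr 𝕜 𝔤 R j ξ (symOf 𝕜 𝔤 R m x) := by
  rw [leftMul, LinearMap.flip_apply, symDesc_symOf]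
  simp [LinearMap.sum_apply]

lemma divPow_eq_symOf {V : Type*} [AddCommGroup V] [Module 𝕜 V] (m : ℕ) (v : V) :
    ∃ x : SymPow 𝕜 V m, divPow 𝕜 R m v = symOf 𝕜 V R m x :=
  ⟨(m.factorial : 𝕜)⁻¹ • toSymPow 𝕜 V m (PiTensorProduct.tprod 𝕜 fun _ => v), by
    rw [map_smul, ← symProd_apply]; rfl⟩

lemma mulVec_divPow_eq_symOf {V : Type*} [AddCommGroup V] [Module 𝕜 V] (m : ℕ) (u v : V) :
    ∃ x : SymPow 𝕜 V (m + 1), mulVec 𝕜 V R u (divPow 𝕜 R m v) = symOf 𝕜 V R (m + 1) x :=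
  ⟨(m.factorial : 𝕜)⁻¹ • toSymPow 𝕜 V (m + 1) (PiTensorProduct.tprod 𝕜 (Fin.cons u fun _ => v)), by
    rw [map_smul, ← symProd_apply, divPow, map_smul, symPow, mulVec_symProd]⟩

/-- The degree-m part of ξ ⋆_z e^v = (f(z ad_v) ξ) · e^v. -/
lemma leftMul_divPow (z : 𝕜) (ξ v : 𝔤) (m : ℕ) :
    leftMul 𝕜 𝔤 R z ξ (divPow 𝕜 R m v) = ∑ ji ∈ antidiagonal m, (z ^ ji.1 * bern 𝕜 ji.1) •
      mulVec 𝕜 𝔤 R (((LieAlgebra.ad 𝕜 𝔤 v) ^ ji.1) ξ) (divPow 𝕜 R ji.2 v) := by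
  obtain ⟨x, hx⟩ := divPow_eq_symOf (𝕜 := 𝕜) (R := R) m v
  rw [hx, leftMul_symOf, ← hx, Finset.Nat.sum_antidiagonal_eq_sum_range_succ_mk]
  refine Finset.sum_congr rfl fun j hj => ?_
  have hj : j ≤ m := by simpa [Nat.lt_succ_iff] using hj
  obtain ⟨i, rfl⟩ := Nat.exists_eq_add_of_le hj
  rw [mulContr_apply, bracketContr_pow_divPow, TensorProduct.lift.tmul, Nat.add_sub_cancel_left]

/-- The derivative of `leftMul_divPow` in the direction u: the second sum collects the terms in
which u enters one of the brackets. This is what is needed to compose two left multiplications. -/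
lemma leftMul_mulVec_divPow (z : 𝕜) (ξ u v : 𝔤) (a : ℕ) :
    leftMul 𝕜 𝔤 R z ξ (mulVec 𝕜 𝔤 R u (divPow 𝕜 R a v)) =
      (∑ ji ∈ antidiagonal a, (z ^ ji.1 * bern 𝕜 ji.1) •
        mulVec 𝕜 𝔤 R (((LieAlgebra.ad 𝕜 𝔤 v) ^ ji.1) ξ)
          (mulVec 𝕜 𝔤 R u (divPow 𝕜 R ji.2 v))) +
      ∑ ni ∈ antidiagonal a, (z ^ (ni.1 + 1) * bern 𝕜 (ni.1 + 1)) •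
        mulVec 𝕜 𝔤 R (∑ pq ∈ antidiagonal ni.1, ((LieAlgebra.ad 𝕜 𝔤 v) ^ pq.1)
          ⁅u, ((LieAlgebra.ad 𝕜 𝔤 v) ^ pq.2) ξ⁆) (divPow 𝕜 R ni.2 v) := by
  obtain ⟨x, hx⟩ := mulVec_divPow_eq_symOf (𝕜 := 𝕜) (R := R) a u v
  rw [hx, leftMul_symOf, ← hx, Finset.sum_range_succ']
  have h1 : ∑ n ∈ Finset.range (a + 1), (z ^ (n + 1) * bern 𝕜 (n + 1)) •
      mulContr 𝕜 𝔤 R (n + 1) ξ (mulVec 𝕜 𝔤 R u (divPow 𝕜 R a v)) =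
      ∑ ni ∈ antidiagonal a, (z ^ (ni.1 + 1) * bern 𝕜 (ni.1 + 1)) •
      mulContr 𝕜 𝔤 R (ni.1 + 1) ξ (mulVec 𝕜 𝔤 R u (divPow 𝕜 R (ni.1 + ni.2) v)) := by
    rw [Finset.Nat.sum_antidiagonal_eq_sum_range_succ_mk]
    refine Finset.sum_congr rfl fun j hj => ?_
    have hj : j ≤ a := by simpa [Nat.lt_succ_iff] using hj
    rw [Nat.add_sub_cancel' hj]
  rw [h1]
  simp_rw [mulContr_apply, bracketContr_pow_succ_mulVec_divPow, map_add, smul_add,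
    TensorProduct.lift.tmul]
  rw [Finset.sum_add_distrib, add_right_comm]
  congr 1
  cases a with
  | zero => simp
  | succ a =>
    -- The i = 0 term on the left vanishes and the j = 0 term on the right is the uncontracted one;
    -- the others agree after the shift j = n + 1.
    rw [Finset.Nat.sum_antidiagonal_succ', Finset.Nat.sum_antidiagonal_succ]
    dsimp only
    simp only [map_zero, smul_zero, zero_add, TensorProduct.lift.tmul, pow_zero,
      Module.End.one_apply]
    rw [add_comm]

end LeftMul

/-! ### Commutators of left multiplications. -/

section LeftMul

lemma sum_antidiagonal_assoc {M : Type*} [AddCommMonoid M] (m : ℕ) (F : ℕ → ℕ → ℕ → M) :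
    ∑ ja ∈ antidiagonal m, ∑ ki ∈ antidiagonal ja.2, F ja.1 ki.1 ki.2 =
      ∑ ni ∈ antidiagonal m, ∑ jk ∈ antidiagonal ni.1, F jk.1 jk.2 ni.2 := by
  rw [Finset.sum_sigma', Finset.sum_sigma']
  refine Finset.sum_bij' (fun x _ => ⟨(x.1.1 + x.2.1, x.2.2), (x.1.1, x.2.1)⟩)
    (fun x _ => ⟨(x.2.1, x.2.2 + x.1.2), (x.2.2, x.1.2)⟩) ?_ ?_ ?_ ?_ ?_
  · rintro ⟨⟨j, a⟩, ⟨k, i⟩⟩ h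
    simp only [Finset.mem_sigma, Finset.HasAntidiagonal.mem_antidiagonal] at h ⊢
    exact ⟨by omega, trivial⟩
  · rintro ⟨⟨j, a⟩, ⟨k, i⟩⟩ h
    simp only [Finset.mem_sigma, Finset.HasAntidiagonal.mem_antidiagonal] at h ⊢
    exact ⟨by omega, trivial⟩
  · rintro ⟨⟨j, a⟩, ⟨k, i⟩⟩ h
    simp only [Finset.mem_sigma, Finset.HasAntidiagonal.mem_antidiagonal] at h
    obtain ⟨h1, rfl⟩ := h
    rfl
  · rintro ⟨⟨j, a⟩, ⟨k, i⟩⟩ h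
    simp only [Finset.mem_sigma, Finset.HasAntidiagonal.mem_antidiagonal] at h
    obtain ⟨h1, rfl⟩ := h
    rfl
  · rintro ⟨⟨j, a⟩, ⟨k, i⟩⟩ h
    rfl

lemma sum_antidiagonal_left_comm {M : Type*} [AddCommMonoid M] (m : ℕ) (F : ℕ → ℕ → ℕ → M) :
    ∑ ja ∈ antidiagonal m, ∑ ki ∈ antidiagonal ja.2, F ja.1 ki.1 ki.2 =
      ∑ ja ∈ antidiagonal m, ∑ ki ∈ antidiagonal ja.2, F ki.1 ja.1 ki.2 := by
  rw [sum_antidiagonal_assoc, sum_antidiagonal_assoc m fun j k i => F k j i]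
  refine Finset.sum_congr rfl fun ni _ => ?_
  exact (Finset.Nat.sum_antidiagonal_swap (n := ni.1) (f := fun jk => F jk.1 jk.2 ni.2)).symm

variable {𝕜 : Type*} [RCLike 𝕜] {𝔤 : Type*} [LieRing 𝔤] [LieAlgebra 𝕜 𝔤] {R : ℝ}

/-- The vector-valued coefficient appearing in the commutator of two left multiplications. -/
def commCoeff (𝕜 : Type*) [RCLike 𝕜] {𝔤 : Type*} [LieRing 𝔤] [LieAlgebra 𝕜 𝔤]
    (v : 𝔤) (n : ℕ) (u w : 𝔤) : 𝔤 :=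
  ∑ jk ∈ antidiagonal n, (bern 𝕜 jk.1 * bern 𝕜 (jk.2 + 1)) •
    ∑ pq ∈ antidiagonal jk.2, ((LieAlgebra.ad 𝕜 𝔤 v) ^ pq.1)
      ⁅((LieAlgebra.ad 𝕜 𝔤 v) ^ jk.1) u, ((LieAlgebra.ad 𝕜 𝔤 v) ^ pq.2) w⁆

/-- On 𝔤 ⊗ 𝔤 the operators X = ad v ⊗ 1 and Y = 1 ⊗ ad v commute, and by the Jacobi identity the
bracket intertwines X + Y with ad v. The claim is the image of `bern_commute` under the bracket. -/
lemma commCoeff_sub_swap (v : 𝔤) (n : ℕ) (u w : 𝔤) :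
    commCoeff 𝕜 v n u w - commCoeff 𝕜 v n w u =
      -(bern 𝕜 n • ((LieAlgebra.ad 𝕜 𝔤 v) ^ n) ⁅u, w⁆) := by
  let D := LieAlgebra.ad 𝕜 𝔤 v
  let X : Module.End 𝕜 (𝔤 ⊗[𝕜] 𝔤) := LinearMap.rTensor 𝔤 D
  let Y : Module.End 𝕜 (𝔤 ⊗[𝕜] 𝔤) := LinearMap.lTensor 𝔤 D
  let br : 𝔤 ⊗[𝕜] 𝔤 →ₗ[𝕜] 𝔤 := TensorProduct.lift (bracketLeft 𝕜 𝔤).flip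
  have hbr : ∀ a b, br (a ⊗ₜ b) = ⁅a, b⁆ := fun a b => rfl
  have hXY : Commute X Y := by
    refine TensorProduct.ext' fun a b => ?_
    simp [X, Y, Module.End.mul_apply]
  have hX : ∀ j a b, (X ^ j) (a ⊗ₜ b) = (D ^ j) a ⊗ₜ b := by
    intro j a b
    induction j with
    | zero => rfl
    | succ j ih => rw [pow_succ', Module.End.mul_apply, ih, pow_succ', Module.End.mul_apply]; rfl
  have hY : ∀ j a b, (Y ^ j) (a ⊗ₜ b) = a ⊗ₜ (D ^ j) b := by
    intro j a b
    induction j with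
    | zero => rfl
    | succ j ih => rw [pow_succ', Module.End.mul_apply, ih, pow_succ', Module.End.mul_apply]; rfl
  have hb1 : ∀ t, br ((X + Y) t) = D (br t) := by
    intro t
    suffices h : br ∘ₗ (X + Y) = D ∘ₗ br from LinearMap.congr_fun h t
    refine TensorProduct.ext' fun a b => ?_
    simp only [LinearMap.comp_apply, LinearMap.add_apply, map_add]
    change ⁅D a, b⁆ + ⁅a, D b⁆ = D ⁅a, b⁆
    simp only [D, LieAlgebra.ad_apply, leibniz_lie v a b]
  have hbn : ∀ n t, br (((X + Y) ^ n) t) = (D ^ n) (br t) := by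
    intro n t
    induction n with
    | zero => rfl
    | succ n ih =>
      rw [pow_succ', Module.End.mul_apply, hb1, ih, pow_succ', Module.End.mul_apply]
  have key := congrArg (fun T : Module.End 𝕜 (𝔤 ⊗[𝕜] 𝔤) => br (T (u ⊗ₜ w)))
    (bern_commute (𝕜 := 𝕜) hXY n)
  simp only [LinearMap.neg_apply, LinearMap.smul_apply, map_neg, map_smul, hbn, hbr] at key
  rw [← key, commCoeff, commCoeff, ← Finset.sum_sub_distrib, LinearMap.sum_apply, map_sum]
  refine Finset.sum_congr rfl fun jk _ => ?_
  rw [← smul_sub, LinearMap.smul_apply, map_smul]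
  congr 1
  rw [LinearMap.add_apply, map_add, Finset.mul_sum, Finset.mul_sum, LinearMap.sum_apply,
    LinearMap.sum_apply, map_sum, map_sum, sub_eq_add_neg, ← Finset.sum_neg_distrib]
  congr 1
  · refine Finset.sum_congr rfl fun pq _ => ?_
    -- Moving (X + Y)^p to the outside lets it become (ad v)^p after the bracket is taken.
    have c : Commute (X ^ jk.1) ((X + Y) ^ pq.1) :=
      (((Commute.refl X).add_right hXY).pow_pow _ _)
    rw [← mul_assoc, c.eq, mul_assoc, Module.End.mul_apply, hbn, Module.End.mul_apply, hY, hX, hbr]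
  · refine Finset.sum_congr rfl fun pq _ => ?_
    have c : Commute (Y ^ jk.1) ((X + Y) ^ pq.1) :=
      ((hXY.symm.add_right (Commute.refl Y)).pow_pow _ _)
    rw [← mul_assoc, c.eq, mul_assoc, Module.End.mul_apply, hbn, Module.End.mul_apply, hX, hY, hbr,
      ← lie_skew, map_neg, neg_neg]

/-- The first sum collects the terms in which ξ and η do not meet in a bracket. It is symmetric in ξ
and η, so only `commCoeff` contributes to the commutator. -/
lemma leftMul_leftMul_divPow (z : 𝕜) (ξ η v : 𝔤) (m : ℕ) :
    leftMul 𝕜 𝔤 R z ξ (leftMul 𝕜 𝔤 R z η (divPow 𝕜 R m v)) =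
      (∑ ja ∈ antidiagonal m, ∑ ki ∈ antidiagonal ja.2,
        (z ^ (ja.1 + ki.1) * (bern 𝕜 ja.1 * bern 𝕜 ki.1)) •
        mulVec 𝕜 𝔤 R (((LieAlgebra.ad 𝕜 𝔤 v) ^ ki.1) ξ)
          (mulVec 𝕜 𝔤 R (((LieAlgebra.ad 𝕜 𝔤 v) ^ ja.1) η) (divPow 𝕜 R ki.2 v))) +
      z • ∑ ni ∈ antidiagonal m, z ^ ni.1 • mulVec 𝕜 𝔤 R (commCoeff 𝕜 v ni.1 η ξ)
        (divPow 𝕜 R ni.2 v) := by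
  rw [leftMul_divPow, map_sum]
  simp_rw [map_smul, leftMul_mulVec_divPow, smul_add]
  rw [Finset.sum_add_distrib]
  congr 1
  · refine Finset.sum_congr rfl fun ja _ => ?_
    rw [Finset.smul_sum]
    refine Finset.sum_congr rfl fun ki _ => ?_
    rw [smul_smul]
    congr 1
    ring
  · simp_rw [Finset.smul_sum]
    rw [sum_antidiagonal_assoc m fun j k i => (z ^ j * bern 𝕜 j) • (z ^ (k + 1) * bern 𝕜 (k + 1)) •
      mulVec 𝕜 𝔤 R (∑ pq ∈ antidiagonal k, ((LieAlgebra.ad 𝕜 𝔤 v) ^ pq.1)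
        ⁅((LieAlgebra.ad 𝕜 𝔤 v) ^ j) η, ((LieAlgebra.ad 𝕜 𝔤 v) ^ pq.2) ξ⁆) (divPow 𝕜 R i v)]
    refine Finset.sum_congr rfl fun ni _ => ?_
    rw [commCoeff, map_sum, LinearMap.sum_apply, Finset.smul_sum, Finset.smul_sum]
    refine Finset.sum_congr rfl fun jk hjk => ?_
    rw [Finset.HasAntidiagonal.mem_antidiagonal] at hjk
    rw [map_smul, LinearMap.smul_apply, smul_smul, smul_smul, smul_smul, ← hjk]
    congr 1
    ring

/-- The operators of left multiplication represent the Lie algebra with bracket `z [·, ·]`. -/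
theorem leftMul_commutator (z : 𝕜) (ξ η : 𝔤) (x : SymR 𝕜 𝔤 R) :
    leftMul 𝕜 𝔤 R z ξ (leftMul 𝕜 𝔤 R z η x) - leftMul 𝕜 𝔤 R z η (leftMul 𝕜 𝔤 R z ξ x) =
      z • leftMul 𝕜 𝔤 R z ⁅ξ, η⁆ x := by
  suffices h : leftMul 𝕜 𝔤 R z ξ ∘ₗ leftMul 𝕜 𝔤 R z η - leftMul 𝕜 𝔤 R z η ∘ₗ leftMul 𝕜 𝔤 R z ξ =
      z • leftMul 𝕜 𝔤 R z ⁅ξ, η⁆ from LinearMap.congr_fun h x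
  refine symLinear_ext_divPow fun m v => ?_
  simp only [LinearMap.sub_apply, LinearMap.comp_apply, LinearMap.smul_apply]
  rw [leftMul_leftMul_divPow, leftMul_leftMul_divPow]
  rw [sum_antidiagonal_left_comm m fun j k i => (z ^ (j + k) * (bern 𝕜 j * bern 𝕜 k)) •
        mulVec 𝕜 𝔤 R (((LieAlgebra.ad 𝕜 𝔤 v) ^ k) ξ)
          (mulVec 𝕜 𝔤 R (((LieAlgebra.ad 𝕜 𝔤 v) ^ j) η) (divPow 𝕜 R i v))]
  have : ∀ a b c d : SymR 𝕜 𝔤 R, a = c → (a + b) - (c + d) = b - d := by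
    rintro a b _ d rfl
    abel
  rw [this, ← smul_sub, ← Finset.sum_sub_distrib, leftMul_divPow]
  · congr 1
    refine Finset.sum_congr rfl fun ni _ => ?_
    rw [← smul_sub, ← LinearMap.sub_apply, ← map_sub, commCoeff_sub_swap, ← lie_skew, map_neg ((LieAlgebra.ad 𝕜 𝔤 v) ^ ni.1),
      smul_neg, neg_neg, map_smul, LinearMap.smul_apply, smul_smul]
  · refine Finset.sum_congr rfl fun ja _ => Finset.sum_congr rfl fun ki _ => ?_
    rw [mulVec_comm, add_comm ki.1, mul_comm (bern 𝕜 ki.1)]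

end LeftMul

/-! ### Symmetrized evaluation -/

section Eval

variable {𝕜 : Type*} [RCLike 𝕜] {V : Type*} [AddCommGroup V] [Module 𝕜 V] {R : ℝ}
  {A : Type*} [Ring A] [Algebra 𝕜 A]

variable (R) in
/-- The linear map `Sym(V) → A`, `v₁ ⋯ vₙ ↦ (1/n!) ∑_σ λ(v_{σ(1)}) ⋯ λ(v_{σ(n)})`. -/
def symEval (l : V →ₗ[𝕜] A) : SymR 𝕜 V R →ₗ[𝕜] A :=
  symLift fun n => (MultilinearMap.mkPiAlgebraFin 𝕜 n A).compLinearMap fun _ => l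

lemma symEval_symPow (l : V →ₗ[𝕜] A) (n : ℕ) (v : V) : symEval R l (symPow 𝕜 R n v) = l v ^ n := by
  rw [symEval, symLift_symPow]
  simp

lemma symEval_divPow (l : V →ₗ[𝕜] A) (n : ℕ) (v : V) :
    symEval R l (divPow 𝕜 R n v) = (n.factorial : 𝕜)⁻¹ • l v ^ n := by
  rw [divPow, map_smul, symEval_symPow]

lemma prod_ofFn_update {M : Type*} [Monoid M] (a : ℕ) (i : Fin (a + 1)) (x y : M) :
    (List.ofFn (Function.update (fun _ => y) i x : Fin (a + 1) → M)).prod =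
      y ^ (i : ℕ) * x * y ^ (a - i) := by
  induction a with
  | zero =>
    obtain rfl : i = 0 := Fin.fin_one_eq_zero i
    simp
  | succ a ih =>
    rw [List.ofFn_succ, List.prod_cons]
    refine Fin.cases ?_ (fun j => ?_) i
    · simp [pow_succ']
    · rw [Function.update_of_ne (Fin.succ_ne_zero j).symm]
      have : (fun k : Fin (a + 1) => (Function.update (fun _ => y) j.succ x :
          Fin (a + 2) → M) k.succ) = Function.update (fun _ => y) j x :=
        Fin.tail_update_succ (α := fun _ => M) _ _ _
      rw [this, ih, Fin.val_succ, pow_succ']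
      simp only [mul_assoc, Nat.add_sub_add_right]

/-- The degree-(a+1) part of the derivative of exp at l v in the direction l u, that is, of (e^X -
e^Y)/(X - Y) applied to l u, with X and Y left and right multiplication by l v. -/
lemma symEval_mulVec_divPow (l : V →ₗ[𝕜] A) (a : ℕ) (u v : V) :
    symEval R l (mulVec 𝕜 V R u (divPow 𝕜 R a v)) =
      ((a + 1).factorial : 𝕜)⁻¹ • ∑ pq ∈ antidiagonal a, l v ^ pq.1 * l u * l v ^ pq.2 := by
  rw [divPow, map_smul, map_smul, symPow, mulVec_symProd, symEval, symLift_cons_const, smul_smul]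
  congr 1
  · rw [Nat.factorial_succ, Nat.cast_mul, mul_inv, mul_comm]
  · rw [Finset.Nat.sum_antidiagonal_eq_sum_range_succ_mk,
      ← Fin.sum_univ_eq_sum_range (fun i => l v ^ i * l u * l v ^ (a - i))]
    refine Finset.sum_congr rfl fun i _ => ?_
    rw [← prod_ofFn_update]
    simp only [MultilinearMap.compLinearMap_apply, MultilinearMap.mkPiAlgebraFin_apply]
    congr 2
    ext j
    by_cases h : j = i
    · subst h; simp
    · simp [Function.update_of_ne h]

/-- A linear map `λ` with `[λ ξ, λ η] = z λ [ξ, η]` intertwines left multiplication with `⋆_z`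
and the product. -/
theorem mul_symEval {𝔤 : Type*} [LieRing 𝔤] [LieAlgebra 𝕜 𝔤] (z : 𝕜) (l : 𝔤 →ₗ[𝕜] A)
    (hl : ∀ ξ η, l ξ * l η - l η * l ξ = z • l ⁅ξ, η⁆) (ξ : 𝔤) (x : SymR 𝕜 𝔤 R) :
    l ξ * symEval R l x = symEval R l (leftMul 𝕜 𝔤 R z ξ x) := by
  suffices h : LinearMap.mulLeft 𝕜 (l ξ) ∘ₗ symEval R l = symEval R l ∘ₗ leftMul 𝕜 𝔤 R z ξ from
    LinearMap.congr_fun h x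
  refine symLinear_ext_divPow fun m v => ?_
  simp only [LinearMap.comp_apply, LinearMap.mulLeft_apply]
  rw [leftMul_divPow, map_sum, symEval_divPow]
  let X : Module.End 𝕜 A := LinearMap.mulLeft 𝕜 (l v)
  let Y : Module.End 𝕜 A := LinearMap.mulRight 𝕜 (l v)
  have hXY : Commute X Y := by
    ext a
    simp [X, Y, mul_assoc]
  -- The hypothesis on l says that z l([v, η]) = (X - Y)(l η).
  have hpow : ∀ j, z ^ j • l (((LieAlgebra.ad 𝕜 𝔤 v) ^ j) ξ) = ((X - Y) ^ j) (l ξ) := by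
    intro j
    induction j with
    | zero => simp
    | succ j ih =>
      rw [pow_succ' (LieAlgebra.ad 𝕜 𝔤 v), Module.End.mul_apply, LieAlgebra.ad_apply, pow_succ z,
        mul_smul, ← hl,
        pow_succ' (X - Y), Module.End.mul_apply, ← ih, map_smul]
      rfl
  have hX : ∀ p a, (X ^ p) a = l v ^ p * a := fun p a => by
    rw [LinearMap.pow_mulLeft, LinearMap.mulLeft_apply]
  have hY : ∀ p a, (Y ^ p) a = a * l v ^ p := fun p a => by
    rw [LinearMap.pow_mulRight, LinearMap.mulRight_apply]
  -- Here Y^m/m! applied to l ξ is l ξ · (l v)^m/m!, the left-hand side of the goal.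
  have key := congrArg (fun T : Module.End 𝕜 A => T (l ξ)) (bern_exp_commute (𝕜 := 𝕜) hXY m)
  simp only [LinearMap.smul_apply, hY] at key
  rw [mul_smul_comm, ← key, LinearMap.sum_apply]
  refine Finset.sum_congr rfl fun ja _ => ?_
  rw [map_smul, symEval_mulVec_divPow, LinearMap.smul_apply, smul_smul, mul_comm (z ^ ja.1),
    mul_assoc, mul_comm (z ^ ja.1), ← mul_assoc, mul_smul _ (z ^ ja.1)]
  congr 1
  have c : Commute ((X - Y) ^ ja.1) (∑ pq ∈ antidiagonal ja.2, X ^ pq.1 * Y ^ pq.2) := by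
    refine Commute.sum_right _ _ _ fun pq _ => ?_
    have h1 : Commute (X - Y) X := (Commute.refl X).sub_left hXY.symm
    have h2 : Commute (X - Y) Y := hXY.sub_left (Commute.refl Y)
    exact (h1.pow_pow _ _).mul_right (h2.pow_pow _ _)
  rw [c.eq, Module.End.mul_apply, ← hpow, map_smul, LinearMap.sum_apply]
  congr 1
  refine Finset.sum_congr rfl fun pq _ => ?_
  rw [Module.End.mul_apply, hY, hX, mul_assoc]

end Eval

/-! ### The Poincaré–Birkhoff–Witt theorem -/

section PBW

variable {𝕜 : Type*} [RCLike 𝕜] {𝔤 : Type*} [LieRing 𝔤] [LieAlgebra 𝕜 𝔤] {R : ℝ}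

/-- Since [v, v] = 0, only the term j = 0 survives. Hence powers of one vector multiply as
polynomials, for every z. -/
lemma leftMul_symPow (z : 𝕜) (v : 𝔤) (n : ℕ) :
    leftMul 𝕜 𝔤 R z v (symPow 𝕜 R n v) = symPow 𝕜 R (n + 1) v := by
  rw [← factorial_smul_divPow, map_smul, leftMul_divPow, Finset.sum_eq_single (0, n)]
  · simp only [pow_zero, one_mul, Module.End.one_apply]
    rw [show bern 𝕜 0 = 1 by simp [bern], one_smul, ← map_smul, factorial_smul_divPow,
      mulVec_symPow]
  · rintro ⟨j, i⟩ hji hne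
    rw [Finset.HasAntidiagonal.mem_antidiagonal] at hji
    obtain ⟨j, rfl⟩ : ∃ k, j = k + 1 := by
      refine Nat.exists_eq_succ_of_ne_zero fun h => hne ?_
      subst h
      simp only [zero_add] at hji
      rw [hji]
    dsimp only
    rw [pow_succ (LieAlgebra.ad 𝕜 𝔤 v), Module.End.mul_apply, LieAlgebra.ad_apply, lie_self, map_zero, map_zero,
      LinearMap.zero_apply, smul_zero]
  · intro h
    exact absurd (by simp) h

variable (𝕜 𝔤 R) in
/-- The star product `⋆_z`, expressed by the operators of left multiplication. -/
def starOp (z : 𝕜) : SymR 𝕜 𝔤 R →ₗ[𝕜] SymR 𝕜 𝔤 R →ₗ[𝕜] SymR 𝕜 𝔤 R :=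
  symEval (A := Module.End 𝕜 (SymR 𝕜 𝔤 R)) R (leftMul 𝕜 𝔤 R z)

lemma starOp_symPow_zero (z : 𝕜) (v : 𝔤) (y : SymR 𝕜 𝔤 R) :
    starOp 𝕜 𝔤 R z (symPow 𝕜 R 0 v) y = y := by
  rw [starOp, symEval_symPow, pow_zero]
  rfl

lemma starOp_symPow_succ (z : 𝕜) (k : ℕ) (v : 𝔤) (y : SymR 𝕜 𝔤 R) :
    starOp 𝕜 𝔤 R z (symPow 𝕜 R (k + 1) v) y =
      leftMul 𝕜 𝔤 R z v (starOp 𝕜 𝔤 R z (symPow 𝕜 R k v) y) := by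
  rw [starOp, symEval_symPow, symEval_symPow, pow_succ']
  rfl

lemma starOp_symPow_symPow (z : 𝕜) (k l : ℕ) (v : 𝔤) :
    starOp 𝕜 𝔤 R z (symPow 𝕜 R k v) (symPow 𝕜 R l v) = symPow 𝕜 R (k + l) v := by
  induction k with
  | zero => rw [starOp_symPow_zero, zero_add]
  | succ k ih => rw [starOp_symPow_succ, ih, leftMul_symPow, Nat.add_right_comm]

/-- Induction on the power of v, with `mul_symEval` as the inductive step. The lemma is used with l
the operators of left multiplication and with l the inclusion into U(𝔤). -/
lemma symEval_starOp {A : Type*} [Ring A] [Algebra 𝕜 A] (z : 𝕜) (l : 𝔤 →ₗ[𝕜] A)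
    (hl : ∀ ξ η, l ξ * l η - l η * l ξ = z • l ⁅ξ, η⁆) (x y : SymR 𝕜 𝔤 R) :
    symEval R l (starOp 𝕜 𝔤 R z x y) = symEval R l x * symEval R l y := by
  suffices h : (starOp 𝕜 𝔤 R z).compr₂ (symEval R l) =
      (LinearMap.mul 𝕜 A).compl₁₂ (symEval R l) (symEval R l) from
    LinearMap.congr_fun (LinearMap.congr_fun h x) y
  refine symLinear_ext_symPow fun n v => LinearMap.ext fun y => ?_
  simp only [LinearMap.compr₂_apply, LinearMap.compl₁₂_apply, LinearMap.mul_apply']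
  induction n with
  | zero => rw [starOp_symPow_zero, symEval_symPow, pow_zero, one_mul]
  | succ n ih =>
    rw [starOp_symPow_succ, ← mul_symEval z l hl, ih, symEval_symPow, symEval_symPow, pow_succ',
      mul_assoc]

/-- Evaluation at l = `leftMul` is the star product itself, so its multiplicativity is
associativity. -/
lemma starOp_assoc (z : 𝕜) (x y w : SymR 𝕜 𝔤 R) :
    starOp 𝕜 𝔤 R z (starOp 𝕜 𝔤 R z x y) w = starOp 𝕜 𝔤 R z x (starOp 𝕜 𝔤 R z y w) := by
  have := symEval_starOp (R := R) (A := Module.End 𝕜 (SymR 𝕜 𝔤 R)) z (leftMul 𝕜 𝔤 R z)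
    (fun ξ η => LinearMap.ext fun x => leftMul_commutator z ξ η x) x y
  exact LinearMap.congr_fun this w

lemma symOne_starOp (z : 𝕜) (y : SymR 𝕜 𝔤 R) : starOp 𝕜 𝔤 R z (symOne 𝕜 𝔤 R) y = y := by
  rw [symOne_eq 0, starOp_symPow_zero]

lemma starOp_symOne (z : 𝕜) (x : SymR 𝕜 𝔤 R) : starOp 𝕜 𝔤 R z x (symOne 𝕜 𝔤 R) = x := by
  suffices h : (starOp 𝕜 𝔤 R z).flip (symOne 𝕜 𝔤 R) = LinearMap.id from LinearMap.congr_fun h x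
  refine symLinear_ext_symPow fun n v => ?_
  rw [LinearMap.flip_apply, symOne_eq v, starOp_symPow_symPow]
  rfl

variable (𝕜 𝔤) in
/-- The canonical map into the enveloping algebra, as a linear map. -/
def envIncl : 𝔤 →ₗ[𝕜] UniversalEnvelopingAlgebra 𝕜 𝔤 :=
  (UniversalEnvelopingAlgebra.mkAlgHom 𝕜 𝔤).toLinearMap ∘ₗ TensorAlgebra.ι 𝕜

lemma quantization_eq : quantization 𝕜 𝔤 R = symEval R (envIncl 𝕜 𝔤) := rfl

lemma envIncl_commutator (ξ η : 𝔤) :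
    envIncl 𝕜 𝔤 ξ * envIncl 𝕜 𝔤 η - envIncl 𝕜 𝔤 η * envIncl 𝕜 𝔤 ξ =
      (1 : 𝕜) • envIncl 𝕜 𝔤 ⁅ξ, η⁆ := by
  let _ : LieRing (UniversalEnvelopingAlgebra 𝕜 𝔤) := LieRing.ofAssociativeRing
  rw [one_smul]
  exact (LieHom.map_lie (UniversalEnvelopingAlgebra.ι 𝕜) ξ η).symm

lemma mkAlgHom_surjective :
    Function.Surjective (UniversalEnvelopingAlgebra.mkAlgHom 𝕜 𝔤) :=
  fun x => Quotient.inductionOn x fun t => ⟨t, rfl⟩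

lemma quantization_starOp (x y : SymR 𝕜 𝔤 R) :
    quantization 𝕜 𝔤 R (starOp 𝕜 𝔤 R 1 x y) = quantization 𝕜 𝔤 R x * quantization 𝕜 𝔤 R y := by
  rw [quantization_eq, symEval_starOp 1 _ envIncl_commutator]

/-- By `mul_symEval` the range is stable under left multiplication by 𝔤, hence by U(𝔤), and it
contains 1. -/
lemma quantization_surjective : Function.Surjective (quantization 𝕜 𝔤 R) := by
  rw [← LinearMap.range_eq_top, Submodule.eq_top_iff']
  intro u
  obtain ⟨t, rfl⟩ := mkAlgHom_surjective u
  suffices h : ∀ w ∈ LinearMap.range (quantization 𝕜 𝔤 R),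
      UniversalEnvelopingAlgebra.mkAlgHom 𝕜 𝔤 t * w ∈ LinearMap.range (quantization 𝕜 𝔤 R) by
    have h1 : (1 : UniversalEnvelopingAlgebra 𝕜 𝔤) ∈ LinearMap.range (quantization 𝕜 𝔤 R) :=
      ⟨symPow 𝕜 R 0 0, by rw [quantization_eq, symEval_symPow, pow_zero]⟩
    simpa using h 1 h1
  induction t using TensorAlgebra.induction with
  | algebraMap r =>
    intro w hw
    rw [AlgHom.commutes, ← Algebra.smul_def]
    exact Submodule.smul_mem _ _ hw
  | ι ξ =>
    rintro _ ⟨x, rfl⟩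
    exact ⟨_, (mul_symEval 1 _ envIncl_commutator ξ x).symm⟩
  | mul a b ha hb =>
    intro w hw
    rw [map_mul, mul_assoc]
    exact ha _ (hb _ hw)
  | add a b ha hb =>
    intro w hw
    rw [map_add, add_mul]
    exact add_mem (ha _ hw) (hb _ hw)

/-- At z = 1 the operators of left multiplication form a representation of 𝔤, hence of U(𝔤), on Sym.
Acting on the unit is a left inverse, because L_v^n 1 = v^n. -/
lemma quantization_injective : Function.Injective (quantization 𝕜 𝔤 R) := by
  let _ : LieRing (Module.End 𝕜 (SymR 𝕜 𝔤 R)) := LieRing.ofAssociativeRing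
  let ρ : 𝔤 →ₗ⁅𝕜⁆ Module.End 𝕜 (SymR 𝕜 𝔤 R) :=
    { leftMul 𝕜 𝔤 R 1 with
      map_lie' := fun {ξ η} => LinearMap.ext fun x => by
        have := leftMul_commutator (1 : 𝕜) ξ η x
        rw [one_smul] at this
        exact this.symm }
  let Θ : UniversalEnvelopingAlgebra 𝕜 𝔤 →ₗ[𝕜] SymR 𝕜 𝔤 R :=
    LinearMap.applyₗ (symOne 𝕜 𝔤 R) ∘ₗ (UniversalEnvelopingAlgebra.lift 𝕜 ρ).toLinearMap
  have h : Θ ∘ₗ quantization 𝕜 𝔤 R = LinearMap.id := by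
    refine symLinear_ext_symPow fun n v => ?_
    rw [LinearMap.comp_apply, quantization_eq, symEval_symPow]
    change UniversalEnvelopingAlgebra.lift 𝕜 ρ (envIncl 𝕜 𝔤 v ^ n) (symOne 𝕜 𝔤 R) = _
    rw [map_pow]
    have h1 : UniversalEnvelopingAlgebra.lift 𝕜 ρ (envIncl 𝕜 𝔤 v) = leftMul 𝕜 𝔤 R 1 v :=
      UniversalEnvelopingAlgebra.lift_ι_apply 𝕜 ρ v
    rw [h1, symOne_eq v]
    induction n with
    | zero => rfl
    | succ n ih => rw [pow_succ', Module.End.mul_apply, ih]; exact leftMul_symPow _ _ _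
  exact Function.LeftInverse.injective (g := Θ) fun x => LinearMap.congr_fun h x

/-- The Poincaré–Birkhoff–Witt theorem, for the symmetrization map. -/
theorem quantization_bijective : Function.Bijective (quantization 𝕜 𝔤 R) :=
  ⟨quantization_injective, quantization_surjective⟩

lemma dequantization_mul (x y : SymR 𝕜 𝔤 R) :
    dequantization 𝕜 𝔤 R (quantization 𝕜 𝔤 R x * quantization 𝕜 𝔤 R y) = starOp 𝕜 𝔤 R 1 x y := by
  rw [← quantization_starOp, dequantization, dif_pos quantization_bijective]
  exact LinearEquiv.ofBijective_symm_apply_apply _ _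

lemma pulledBackMul_apply (k l : ℕ) (x : SymPow 𝕜 𝔤 k) (y : SymPow 𝕜 𝔤 l) :
    pulledBackMul 𝕜 𝔤 R k l x y = starOp 𝕜 𝔤 R 1 (symOf 𝕜 𝔤 R k x) (symOf 𝕜 𝔤 R l y) := by
  rw [← dequantization_mul]
  rfl

lemma symBilin_symOf {V W : Type*} [AddCommGroup V] [Module 𝕜 V] [AddCommGroup W] [Module 𝕜 W]
    (f : ∀ k l, SymPow 𝕜 V k →ₗ[𝕜] SymPow 𝕜 V l →ₗ[𝕜] W) (k l : ℕ) (x : SymPow 𝕜 V k)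
    (y : SymPow 𝕜 V l) :
    symBilin f (symOf 𝕜 V R k x) (symOf 𝕜 V R l y) = f k l x y := by
  rw [symBilin, symDesc_symOf, LinearMap.flip_apply, symDesc_symOf, LinearMap.flip_apply]

lemma starCoeff_symOf (n k l : ℕ) (x : SymPow 𝕜 𝔤 k) (y : SymPow 𝕜 𝔤 l) :
    starCoeff 𝕜 𝔤 R n (symOf 𝕜 𝔤 R k x) (symOf 𝕜 𝔤 R l y) =
      if n ≤ k + l then symProj 𝕜 𝔤 R (k + l - n)
        (starOp 𝕜 𝔤 R 1 (symOf 𝕜 𝔤 R k x) (symOf 𝕜 𝔤 R l y)) else 0 := by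
  rw [starCoeff, symBilin_symOf]
  split_ifs
  · rw [LinearMap.compr₂_apply, pulledBackMul_apply]
  · rfl

lemma guttStar_symOf (z : 𝕜) (k l : ℕ) (x : SymPow 𝕜 𝔤 k) (y : SymPow 𝕜 𝔤 l) :
    guttStar 𝕜 𝔤 R z (symOf 𝕜 𝔤 R k x) (symOf 𝕜 𝔤 R l y) =
      ∑ n ∈ Finset.range (k + l + 1), z ^ n • symProj 𝕜 𝔤 R (k + l - n)
        (starOp 𝕜 𝔤 R 1 (symOf 𝕜 𝔤 R k x) (symOf 𝕜 𝔤 R l y)) := by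
  rw [guttStar, symBilin_symOf]
  simp only [LinearMap.sum_apply, LinearMap.smul_apply, LinearMap.compr₂_apply,
    pulledBackMul_apply]

end PBW

/-! ### Homogeneity -/

section Homogeneous

variable {𝕜 : Type*} [RCLike 𝕜] {V : Type*} [AddCommGroup V] [Module 𝕜 V] {R : ℝ}

variable (𝕜 V R) in
/-- The homogeneous part of degree `n` of the symmetric algebra. -/
def homPart (n : ℕ) : Submodule 𝕜 (SymR 𝕜 V R) := LinearMap.range (symOf 𝕜 V R n)

lemma symProd_mem_homPart {n : ℕ} (f : Fin n → V) : symProd 𝕜 V R n f ∈ homPart 𝕜 V R n :=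
  ⟨_, (symProd_apply f).symm⟩

lemma homPart_eq_span (n : ℕ) :
    homPart 𝕜 V R n = Submodule.span 𝕜 (Set.range (symProd 𝕜 V R n)) := by
  refine le_antisymm ?_ (Submodule.span_le.2 ?_)
  · rintro _ ⟨x, rfl⟩
    rw [← toSymPow_coe x]
    generalize (x : ⨂[𝕜]^n V) = t
    induction t using PiTensorProduct.induction_on with
    | smul_tprod r v =>
      rw [map_smul, map_smul, ← symProd_apply]
      exact Submodule.smul_mem _ _ (Submodule.subset_span ⟨v, rfl⟩)
    | add x y hx hy =>
      rw [map_add, map_add]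
      exact add_mem hx hy
  · rintro _ ⟨f, rfl⟩
    exact symProd_mem_homPart f

lemma homPart_eq_span_symPow (n : ℕ) :
    homPart 𝕜 V R n = Submodule.span 𝕜 (Set.range (symPow 𝕜 R n)) := by
  refine le_antisymm ?_ (Submodule.span_le.2 ?_)
  · rw [homPart_eq_span, Submodule.span_le]
    rintro _ ⟨f, rfl⟩
    rw [SetLike.mem_coe, ← Submodule.Quotient.mk_eq_zero]
    refine multilinear_eq_zero_of_diag
      ((Submodule.mkQ (Submodule.span 𝕜 (Set.range (symPow 𝕜 R n)))).compMultilinearMap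
        (symProd 𝕜 V R n)) (fun σ f => ?_) (fun v => ?_) f
    · simp only [LinearMap.compMultilinearMap_apply, symProd_comp]
    · rw [LinearMap.compMultilinearMap_apply, Submodule.mkQ_apply, Submodule.Quotient.mk_eq_zero]
      exact Submodule.subset_span ⟨v, rfl⟩
  · rintro _ ⟨v, rfl⟩
    exact symProd_mem_homPart _

lemma map_mem_of_homPart {W : Type*} [AddCommGroup W] [Module 𝕜 W] {n : ℕ}
    (f : SymR 𝕜 V R →ₗ[𝕜] W) (S : Submodule 𝕜 W) (h : ∀ v, f (symProd 𝕜 V R n v) ∈ S)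
    {x : SymR 𝕜 V R} (hx : x ∈ homPart 𝕜 V R n) : f x ∈ S := by
  rw [homPart_eq_span] at hx
  have : Submodule.span 𝕜 (Set.range (symProd 𝕜 V R n)) ≤ S.comap f := by
    rw [Submodule.span_le]
    rintro _ ⟨v, rfl⟩
    exact h v
  exact this hx

/-- Polarization inside one fixed degree, for identities whose form depends on the degree. -/
lemma eq_of_homPart {W : Type*} [AddCommGroup W] [Module 𝕜 W] {n : ℕ}
    {f g : SymR 𝕜 V R →ₗ[𝕜] W} (h : ∀ v, f (symPow 𝕜 R n v) = g (symPow 𝕜 R n v))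
    {x : SymR 𝕜 V R} (hx : x ∈ homPart 𝕜 V R n) : f x = g x := by
  rw [homPart_eq_span_symPow] at hx
  have : Submodule.span 𝕜 (Set.range (symPow 𝕜 R n)) ≤ LinearMap.eqLocus f g := by
    rw [Submodule.span_le]
    rintro _ ⟨v, rfl⟩
    exact h v
  exact this hx

lemma symProj_of_mem {m : ℕ} {x : SymR 𝕜 V R} (hx : x ∈ homPart 𝕜 V R m) (n : ℕ) :
    symProj 𝕜 V R n x = if n = m then x else 0 := by
  obtain ⟨y, rfl⟩ := hx
  rw [symProj, LinearMap.comp_apply]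
  by_cases h : n = m
  · subst h
    rw [if_pos rfl]
    congr 1
    exact DirectSum.component.lof_self (M := fun n => SymPow 𝕜 V n) 𝕜 n y
  · rw [if_neg h]
    have : symComponent 𝕜 V R n (symOf 𝕜 V R m y) = 0 := by
      exact DFinsupp.single_eq_of_ne h
    rw [this, map_zero]

lemma mulVec_mem (u : V) {m : ℕ} {x : SymR 𝕜 V R} (hx : x ∈ homPart 𝕜 V R m) :
    mulVec 𝕜 V R u x ∈ homPart 𝕜 V R (m + 1) :=
  map_mem_of_homPart _ _ (fun f => by
    rw [mulVec_symProd]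
    exact symProd_mem_homPart _) hx

variable (𝕜 V R) in
/-- The part `V ⊗ Symᵐ(V)` of `V ⊗ Sym(V)`. -/
def homTensor (m : ℕ) : Submodule 𝕜 (V ⊗[𝕜] SymR 𝕜 V R) :=
  Submodule.span 𝕜 {t | ∃ u, ∃ x ∈ homPart 𝕜 V R m, t = u ⊗ₜ x}

lemma contraction_symProd_succ {n : ℕ} (f : Fin (n + 1) → V) :
    contraction 𝕜 V R (symProd 𝕜 V R (n + 1) f) = (n.factorial : 𝕜)⁻¹ •
      ∑ σ : Equiv.Perm (Fin (n + 1)), splitHead 𝕜 V R n (f ∘ σ) := by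
  rw [contraction, symLift_symProd]
  simp only [_root_.smul_apply]
  rw [← Finset.smul_sum, smul_smul, inv_factorial_succ_mul]

lemma contraction_mem {m : ℕ} {x : SymR 𝕜 V R} (hx : x ∈ homPart 𝕜 V R (m + 1)) :
    contraction 𝕜 V R x ∈ homTensor 𝕜 V R m := by
  refine map_mem_of_homPart _ _ (fun f => ?_) hx
  rw [contraction_symProd_succ]
  exact Submodule.smul_mem _ _ (Submodule.sum_mem _ fun σ _ =>
    Submodule.subset_span ⟨_, _, symProd_mem_homPart _, rfl⟩)

lemma lift_mulVec_mem {m : ℕ} {t : V ⊗[𝕜] SymR 𝕜 V R} (ht : t ∈ homTensor 𝕜 V R m) :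
    TensorProduct.lift (mulVec 𝕜 V R) t ∈ homPart 𝕜 V R (m + 1) := by
  have : homTensor 𝕜 V R m ≤ (homPart 𝕜 V R (m + 1)).comap
      (TensorProduct.lift (mulVec 𝕜 V R)) := by
    rw [homTensor, Submodule.span_le]
    rintro _ ⟨u, x, hx, rfl⟩
    exact mulVec_mem u hx
  exact this ht

end Homogeneous

/-! ### Recovering the parameter z from the degree. -/

section Homogenization

variable {𝕜 : Type*} [RCLike 𝕜] {𝔤 : Type*} [LieRing 𝔤] [LieAlgebra 𝕜 𝔤] {R : ℝ}

lemma bracketContr_mem {m : ℕ} {t : 𝔤 ⊗[𝕜] SymR 𝕜 𝔤 R} (ht : t ∈ homTensor 𝕜 𝔤 R (m + 1)) :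
    bracketContr 𝕜 𝔤 R t ∈ homTensor 𝕜 𝔤 R m := by
  have : homTensor 𝕜 𝔤 R (m + 1) ≤ (homTensor 𝕜 𝔤 R m).comap (bracketContr 𝕜 𝔤 R) := by
    rw [homTensor, Submodule.span_le]
    rintro _ ⟨u, x, hx, rfl⟩
    rw [SetLike.mem_coe, Submodule.mem_comap, bracketContr_tmul]
    have h : homTensor 𝕜 𝔤 R m ≤ (homTensor 𝕜 𝔤 R m).comap
        ((bracketLeft 𝕜 𝔤 u).rTensor (SymR 𝕜 𝔤 R)) := by
      nth_rewrite 1 [homTensor]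
      rw [Submodule.span_le]
      rintro _ ⟨w, y, hy, rfl⟩
      exact Submodule.subset_span ⟨_, y, hy, rfl⟩
    exact h (contraction_mem hx)
  exact this ht

lemma bracketContr_pow_mem (j : ℕ) {i : ℕ} {t : 𝔤 ⊗[𝕜] SymR 𝕜 𝔤 R}
    (ht : t ∈ homTensor 𝕜 𝔤 R (j + i)) :
    (bracketContr 𝕜 𝔤 R ^ j) t ∈ homTensor 𝕜 𝔤 R i := by
  induction j generalizing t with
  | zero => simpa using ht
  | succ j ih =>
    rw [pow_succ, Module.End.mul_apply]
    rw [show j + 1 + i = j + i + 1 by omega] at ht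
    exact ih (bracketContr_mem ht)

lemma mulContr_mem (j : ℕ) {i : ℕ} (ξ : 𝔤) {x : SymR 𝕜 𝔤 R} (hx : x ∈ homPart 𝕜 𝔤 R (j + i)) :
    mulContr 𝕜 𝔤 R j ξ x ∈ homPart 𝕜 𝔤 R (i + 1) :=
  lift_mulVec_mem (bracketContr_pow_mem j (Submodule.subset_span ⟨ξ, x, hx, rfl⟩))

lemma leftMul_of_mem (z : 𝕜) (ξ : 𝔤) {m : ℕ} {x : SymR 𝕜 𝔤 R} (hx : x ∈ homPart 𝕜 𝔤 R m) :
    leftMul 𝕜 𝔤 R z ξ x = ∑ ji ∈ antidiagonal m,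
      (z ^ ji.1 * bern 𝕜 ji.1) • mulContr 𝕜 𝔤 R ji.1 ξ x := by
  obtain ⟨y, rfl⟩ := hx
  rw [leftMul_symOf, Finset.Nat.sum_antidiagonal_eq_sum_range_succ_mk]

variable (𝕜 𝔤 R) in
/-- The sum of the homogeneous parts of degree at most `N`. -/
def degLE (N : ℕ) : Submodule 𝕜 (SymR 𝕜 𝔤 R) :=
  Submodule.span 𝕜 {x | ∃ m ≤ N, x ∈ homPart 𝕜 𝔤 R m}

variable (𝕜 𝔤 R) in
/-- Multiplication by `z ^ (N - m)` in degree `m ≤ N`. -/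
def homogenize (z : 𝕜) (N : ℕ) : SymR 𝕜 𝔤 R →ₗ[𝕜] SymR 𝕜 𝔤 R :=
  ∑ n ∈ Finset.range (N + 1), z ^ n • symProj 𝕜 𝔤 R (N - n)

lemma homogenize_of_mem (z : 𝕜) {N m : ℕ} (hm : m ≤ N) {x : SymR 𝕜 𝔤 R}
    (hx : x ∈ homPart 𝕜 𝔤 R m) : homogenize 𝕜 𝔤 R z N x = z ^ (N - m) • x := by
  rw [homogenize, LinearMap.sum_apply, Finset.sum_eq_single (N - m)]
  · rw [LinearMap.smul_apply, symProj_of_mem hx, if_pos (by omega)]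
  · intro n hn hne
    have : n ≤ N := by simpa [Nat.lt_succ_iff] using hn
    rw [LinearMap.smul_apply, symProj_of_mem hx, if_neg (by omega), smul_zero]
  · intro h
    exact absurd (Finset.mem_range.2 (by omega)) h

/-- Contracting j factors carries z^j and produces degree m + 1 - j, so the power of z counts the
missing degree. -/
lemma leftMul_homogenize (z : 𝕜) (ξ : 𝔤) {N : ℕ} {x : SymR 𝕜 𝔤 R} (hx : x ∈ degLE 𝕜 𝔤 R N) :
    leftMul 𝕜 𝔤 R 1 ξ x ∈ degLE 𝕜 𝔤 R (N + 1) ∧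
    homogenize 𝕜 𝔤 R z (N + 1) (leftMul 𝕜 𝔤 R 1 ξ x) =
      leftMul 𝕜 𝔤 R z ξ (homogenize 𝕜 𝔤 R z N x) := by
  have : degLE 𝕜 𝔤 R N ≤ (degLE 𝕜 𝔤 R (N + 1)).comap (leftMul 𝕜 𝔤 R 1 ξ) ⊓
      LinearMap.eqLocus (homogenize 𝕜 𝔤 R z (N + 1) ∘ₗ leftMul 𝕜 𝔤 R 1 ξ)
        (leftMul 𝕜 𝔤 R z ξ ∘ₗ homogenize 𝕜 𝔤 R z N) := by
    rw [degLE, Submodule.span_le]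
    rintro x ⟨m, hm, hx⟩
    have hj : ∀ ji ∈ antidiagonal m, mulContr 𝕜 𝔤 R ji.1 ξ x ∈ homPart 𝕜 𝔤 R (ji.2 + 1) := by
      rintro ⟨j, i⟩ h
      rw [Finset.HasAntidiagonal.mem_antidiagonal] at h
      subst h
      exact mulContr_mem j ξ hx
    refine ⟨?_, ?_⟩
    · rw [SetLike.mem_coe, Submodule.mem_comap, leftMul_of_mem _ _ hx]
      refine Submodule.sum_mem _ fun ji h => Submodule.smul_mem _ _ (Submodule.subset_span ?_)
      have h' := Finset.HasAntidiagonal.mem_antidiagonal.1 h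
      exact ⟨ji.2 + 1, by omega, hj _ h⟩
    · rw [SetLike.mem_coe, LinearMap.mem_eqLocus, LinearMap.comp_apply, LinearMap.comp_apply,
        homogenize_of_mem z hm hx, map_smul, leftMul_of_mem _ _ hx, leftMul_of_mem _ _ hx, map_sum,
        Finset.smul_sum]
      refine Finset.sum_congr rfl fun ji h => ?_
      have h' := Finset.HasAntidiagonal.mem_antidiagonal.1 h
      rw [map_smul, homogenize_of_mem z (by omega) (hj _ h), smul_smul, smul_smul, one_pow, one_mul,
        show N + 1 - (ji.2 + 1) = N - m + ji.1 by omega, pow_add]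
      congr 1
      ring
  exact this hx

/-- The definition of ⋆_z inserts z^n in degree k + l - n of the product at z = 1. Applying
`leftMul_homogenize` k times identifies this with left multiplications at parameter z. -/
lemma homogenize_starOp (z : 𝕜) {k l : ℕ} {x y : SymR 𝕜 𝔤 R} (hx : x ∈ homPart 𝕜 𝔤 R k)
    (hy : y ∈ homPart 𝕜 𝔤 R l) :
    homogenize 𝕜 𝔤 R z (k + l) (starOp 𝕜 𝔤 R 1 x y) = starOp 𝕜 𝔤 R z x y := by
  suffices h : ∀ v, homogenize 𝕜 𝔤 R z (k + l) (starOp 𝕜 𝔤 R 1 (symPow 𝕜 R k v) y) =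
      starOp 𝕜 𝔤 R z (symPow 𝕜 R k v) y from
    eq_of_homPart (f := homogenize 𝕜 𝔤 R z (k + l) ∘ₗ (starOp 𝕜 𝔤 R 1).flip y)
      (g := (starOp 𝕜 𝔤 R z).flip y) h hx
  intro v
  suffices h : starOp 𝕜 𝔤 R 1 (symPow 𝕜 R k v) y ∈ degLE 𝕜 𝔤 R (k + l) ∧
      homogenize 𝕜 𝔤 R z (k + l) (starOp 𝕜 𝔤 R 1 (symPow 𝕜 R k v) y) =
      starOp 𝕜 𝔤 R z (symPow 𝕜 R k v) y from h.2
  clear hx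
  induction k with
  | zero =>
    rw [starOp_symPow_zero, starOp_symPow_zero, zero_add, homogenize_of_mem z le_rfl hy,
      Nat.sub_self, pow_zero, one_smul]
    exact ⟨Submodule.subset_span ⟨l, le_rfl, hy⟩, rfl⟩
  | succ k ih =>
    rw [starOp_symPow_succ, starOp_symPow_succ, ← ih.2, Nat.add_right_comm]
    exact leftMul_homogenize z v ih.1

lemma symBilin_ext {V W : Type*} [AddCommGroup V] [Module 𝕜 V] [AddCommGroup W] [Module 𝕜 W]
    {f g : SymR 𝕜 V R →ₗ[𝕜] SymR 𝕜 V R →ₗ[𝕜] W}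
    (h : ∀ k l (x : SymPow 𝕜 V k) (y : SymPow 𝕜 V l),
      f (symOf 𝕜 V R k x) (symOf 𝕜 V R l y) = g (symOf 𝕜 V R k x) (symOf 𝕜 V R l y)) : f = g :=
  symLinear_ext fun k x => symLinear_ext fun l y => h k l x y

/-- The Gutt star product in terms of left multiplication operators. -/
theorem guttStar_eq (z : 𝕜) : guttStar 𝕜 𝔤 R z = starOp 𝕜 𝔤 R z := by
  refine symBilin_ext fun k l x y => ?_
  rw [guttStar_symOf, ← homogenize_starOp z (⟨x, rfl⟩ : _ ∈ homPart 𝕜 𝔤 R k)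
    (⟨y, rfl⟩ : _ ∈ homPart 𝕜 𝔤 R l), homogenize, LinearMap.sum_apply]
  rfl

lemma guttStar_symOf_eq_sum (z : 𝕜) (k l : ℕ) (x : SymPow 𝕜 𝔤 k) (y : SymPow 𝕜 𝔤 l) :
    guttStar 𝕜 𝔤 R z (symOf 𝕜 𝔤 R k x) (symOf 𝕜 𝔤 R l y) =
      ∑ n ∈ Finset.range (k + l + 1),
        z ^ n • starCoeff 𝕜 𝔤 R n (symOf 𝕜 𝔤 R k x) (symOf 𝕜 𝔤 R l y) := by
  rw [guttStar_symOf]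
  refine Finset.sum_congr rfl fun n hn => ?_
  rw [starCoeff_symOf, if_pos (by simpa [Nat.lt_succ_iff] using hn)]

end Homogenization

/-! ### Hopf algebra identities -/

section Coalgebra

variable {𝕜 : Type*} [RCLike 𝕜] {V : Type*} [AddCommGroup V] [Module 𝕜 V] {R : ℝ}

lemma coproduct_symPow (n : ℕ) (v : V) :
    coproduct 𝕜 V R (symPow 𝕜 R n v) = ∑ ij ∈ antidiagonal n,
      n.choose ij.1 • (symPow 𝕜 R ij.1 v ⊗ₜ[𝕜] symPow 𝕜 R ij.2 v) := by
  have h : coproduct 𝕜 V R (symPow 𝕜 R n v) = shuffle 𝕜 V R n fun _ => v :=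
    symLift_symPow (shuffle 𝕜 V R) n v
  rw [h, shuffle, _root_.sum_apply]
  have : ∀ I : Finset (Fin n), (MultilinearMap.domCoprod (symProd 𝕜 V R I.card)
      (symProd 𝕜 V R Iᶜ.card)).domDomCongr (finSumEquivOfFinset (s := I) rfl rfl) (fun _ => v) =
      symPow 𝕜 R I.card v ⊗ₜ[𝕜] symPow 𝕜 R (n - I.card) v := by
    intro I
    have hI : Iᶜ.card = n - I.card := by rw [Finset.card_compl, Fintype.card_fin]
    rw [← hI]
    rfl
  simp_rw [this]
  have := Finset.sum_powerset_apply_card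
    (fun m => symPow 𝕜 R m v ⊗ₜ[𝕜] symPow 𝕜 R (n - m) v) (x := (Finset.univ : Finset (Fin n)))
  rw [Finset.powerset_univ, Finset.card_univ, Fintype.card_fin] at this
  rw [this, Finset.Nat.sum_antidiagonal_eq_sum_range_succ_mk]

/-- The binomial coefficients disappear: the formal series e^v is group-like. -/
lemma coproduct_divPow (n : ℕ) (v : V) :
    coproduct 𝕜 V R (divPow 𝕜 R n v) = ∑ ij ∈ antidiagonal n,
      divPow 𝕜 R ij.1 v ⊗ₜ[𝕜] divPow 𝕜 R ij.2 v := by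
  rw [divPow, map_smul, coproduct_symPow, Finset.smul_sum]
  refine Finset.sum_congr rfl fun ij h => ?_
  rw [Finset.HasAntidiagonal.mem_antidiagonal] at h
  rw [divPow, divPow, TensorProduct.smul_tmul_smul, ← Nat.cast_smul_eq_nsmul 𝕜, smul_smul]
  congr 1
  subst h
  have h1 : (ij.1.factorial : 𝕜) ≠ 0 := by exact_mod_cast ij.1.factorial_ne_zero
  have h2 : (ij.2.factorial : 𝕜) ≠ 0 := by exact_mod_cast ij.2.factorial_ne_zero
  have h3 : ((ij.1 + ij.2).factorial : 𝕜) ≠ 0 := by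
    exact_mod_cast (ij.1 + ij.2).factorial_ne_zero
  have h4 : (((ij.1 + ij.2).choose ij.1 * ij.1.factorial * ij.2.factorial : ℕ) : 𝕜) =
      (ij.1 + ij.2).factorial := by
    rw [Nat.choose_symm_add, Nat.add_choose_mul_factorial_mul_factorial]
  have h5 : ((ij.1 + ij.2).choose ij.1 : 𝕜) ≠ 0 := by
    exact_mod_cast (Nat.choose_pos (Nat.le_add_right _ _)).ne'
  push_cast at h4
  rw [← h4]
  field_simp

lemma counit_symPow_zero (v : V) : counit 𝕜 V R (symPow 𝕜 R 0 v) = 1 := by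
  have h1 : (toSymPow 𝕜 V 0 (PiTensorProduct.tprod 𝕜 fun _ => v) : ⨂[𝕜]^0 V) =
      PiTensorProduct.tprod 𝕜 fun _ => v := by
    rw [coe_toSymPow, symmetrizer_tprod]
    simp
  have h2 : symComponent 𝕜 V R 0 (symPow 𝕜 R 0 v) =
      toSymPow 𝕜 V 0 (PiTensorProduct.tprod 𝕜 fun _ => v) := by
    rw [symPow, symProd_apply]
    exact DirectSum.component.lof_self (M := fun n => SymPow 𝕜 V n) 𝕜 0 _
  rw [counit, LinearMap.comp_apply, LinearMap.comp_apply, h2, Submodule.subtype_apply, h1,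
    LinearEquiv.coe_coe, PiTensorProduct.isEmptyEquiv_apply_tprod]

lemma counit_of_mem {m : ℕ} {x : SymR 𝕜 V R} (hx : x ∈ homPart 𝕜 V R (m + 1)) :
    counit 𝕜 V R x = 0 := by
  obtain ⟨y, rfl⟩ := hx
  have : symComponent 𝕜 V R 0 (symOf 𝕜 V R (m + 1) y) = 0 :=
    DFinsupp.single_eq_of_ne (β := fun n => SymPow 𝕜 V n) (b := y) (Nat.succ_ne_zero m).symm
  rw [counit, LinearMap.comp_apply, LinearMap.comp_apply, this, map_zero, map_zero]

lemma counit_symPow_succ (n : ℕ) (v : V) : counit 𝕜 V R (symPow 𝕜 R (n + 1) v) = 0 :=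
  counit_of_mem (symProd_mem_homPart _)

lemma counit_symOne : counit 𝕜 V R (symOne 𝕜 V R) = 1 := by
  rw [symOne_eq 0, counit_symPow_zero]

lemma antipode_symPow (n : ℕ) (v : V) :
    antipode 𝕜 V R (symPow 𝕜 R n v) = (-1 : 𝕜) ^ n • symPow 𝕜 R n v := by
  rw [symPow, symProd_apply, antipode, symDesc_symOf, LinearMap.smul_apply]

lemma coproduct_symOne : coproduct 𝕜 V R (symOne 𝕜 V R) = symOne 𝕜 V R ⊗ₜ symOne 𝕜 V R := by
  rw [symOne_eq 0, coproduct_symPow]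
  simp

lemma coproduct_coassoc (x : SymR 𝕜 V R) :
    TensorProduct.assoc 𝕜 _ _ _ ((coproduct 𝕜 V R).rTensor _ (coproduct 𝕜 V R x)) =
      (coproduct 𝕜 V R).lTensor _ (coproduct 𝕜 V R x) := by
  suffices h : (TensorProduct.assoc 𝕜 _ _ _).toLinearMap ∘ₗ (coproduct 𝕜 V R).rTensor _ ∘ₗ
      coproduct 𝕜 V R = (coproduct 𝕜 V R).lTensor _ ∘ₗ coproduct 𝕜 V R from
    LinearMap.congr_fun h x
  refine symLinear_ext_divPow fun n v => ?_
  simp only [LinearMap.comp_apply, LinearEquiv.coe_coe]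
  simp only [coproduct_divPow, map_sum, LinearMap.rTensor_tmul, LinearMap.lTensor_tmul,
    TensorProduct.sum_tmul, TensorProduct.tmul_sum, TensorProduct.assoc_tmul]
  exact (sum_antidiagonal_assoc n fun i j k =>
    divPow 𝕜 R i v ⊗ₜ[𝕜] (divPow 𝕜 R j v ⊗ₜ[𝕜] divPow 𝕜 R k v)).symm

lemma counit_divPow (n : ℕ) (v : V) :
    counit 𝕜 V R (divPow 𝕜 R n v) = if n = 0 then 1 else 0 := by
  rw [divPow, map_smul]
  cases n with
  | zero => rw [counit_symPow_zero]; simp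
  | succ n => rw [counit_symPow_succ]; simp

lemma coproduct_counit_left (x : SymR 𝕜 V R) :
    TensorProduct.lift (LinearMap.lsmul 𝕜 (SymR 𝕜 V R) ∘ₗ counit 𝕜 V R) (coproduct 𝕜 V R x) =
      x := by
  suffices h : TensorProduct.lift (LinearMap.lsmul 𝕜 (SymR 𝕜 V R) ∘ₗ counit 𝕜 V R) ∘ₗ
      coproduct 𝕜 V R = LinearMap.id from LinearMap.congr_fun h x
  refine symLinear_ext_divPow fun n v => ?_
  rw [LinearMap.comp_apply, coproduct_divPow, map_sum, Finset.sum_eq_single (0, n)]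
  · simp [counit_divPow]
  · rintro ⟨i, j⟩ h hne
    rw [Finset.HasAntidiagonal.mem_antidiagonal] at h
    have : i ≠ 0 := fun e => hne (by simp_all)
    simp [counit_divPow, this]
  · intro h
    exact absurd (by simp) h

lemma coproduct_counit_right (x : SymR 𝕜 V R) :
    TensorProduct.lift (LinearMap.lsmul 𝕜 (SymR 𝕜 V R) ∘ₗ counit 𝕜 V R).flip
      (coproduct 𝕜 V R x) = x := by
  suffices h : TensorProduct.lift (LinearMap.lsmul 𝕜 (SymR 𝕜 V R) ∘ₗ counit 𝕜 V R).flip ∘ₗ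
      coproduct 𝕜 V R = LinearMap.id from LinearMap.congr_fun h x
  refine symLinear_ext_divPow fun n v => ?_
  rw [LinearMap.comp_apply, coproduct_divPow, map_sum, Finset.sum_eq_single (n, 0)]
  · simp [counit_divPow]
  · rintro ⟨i, j⟩ h hne
    rw [Finset.HasAntidiagonal.mem_antidiagonal] at h
    have : j ≠ 0 := fun e => hne (by simp_all)
    simp [counit_divPow, this]
  · intro h
    exact absurd (by simp) h

end Coalgebra

/-! ### Compatibility of the star product with coproduct, counit and antipode. -/

section Bialgebra

variable {𝕜 : Type*} [RCLike 𝕜] {𝔤 : Type*} [LieRing 𝔤] [LieAlgebra 𝕜 𝔤] {R : ℝ}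

/-- Every term of a left multiplication has a vector as a factor, hence positive degree. -/
lemma counit_leftMul (z : 𝕜) (ξ : 𝔤) (x : SymR 𝕜 𝔤 R) :
    counit 𝕜 𝔤 R (leftMul 𝕜 𝔤 R z ξ x) = 0 := by
  suffices h : counit 𝕜 𝔤 R ∘ₗ leftMul 𝕜 𝔤 R z ξ = 0 from LinearMap.congr_fun h x
  refine symLinear_ext_divPow fun m v => ?_
  rw [LinearMap.comp_apply, leftMul_divPow, map_sum]
  refine Finset.sum_eq_zero fun ji _ => ?_
  obtain ⟨y, hy⟩ := mulVec_divPow_eq_symOf (𝕜 := 𝕜) (R := R) ji.2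
    (((LieAlgebra.ad 𝕜 𝔤 v) ^ ji.1) ξ) v
  rw [map_smul, hy, counit_of_mem ⟨y, rfl⟩, smul_zero]

lemma counit_starOp (z : 𝕜) (x y : SymR 𝕜 𝔤 R) :
    counit 𝕜 𝔤 R (starOp 𝕜 𝔤 R z x y) = counit 𝕜 𝔤 R x * counit 𝕜 𝔤 R y := by
  suffices h : (starOp 𝕜 𝔤 R z).compr₂ (counit 𝕜 𝔤 R) =
      (LinearMap.mul 𝕜 𝕜).compl₁₂ (counit 𝕜 𝔤 R) (counit 𝕜 𝔤 R) from
    LinearMap.congr_fun (LinearMap.congr_fun h x) y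
  refine symLinear_ext_symPow fun n v => LinearMap.ext fun y => ?_
  simp only [LinearMap.compr₂_apply, LinearMap.compl₁₂_apply, LinearMap.mul_apply']
  cases n with
  | zero => rw [starOp_symPow_zero, counit_symPow_zero, one_mul]
  | succ n => rw [starOp_symPow_succ, counit_leftMul, counit_symPow_succ, zero_mul]

variable (𝕜 𝔤 R) in
/-- The operators `ξ ⊗ 1 + 1 ⊗ ξ` on the tensor square. -/
def leftMulTensor (z : 𝕜) : 𝔤 →ₗ[𝕜] Module.End 𝕜 (SymR 𝕜 𝔤 R ⊗[𝕜] SymR 𝕜 𝔤 R) :=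
  (LinearMap.rTensorHom (SymR 𝕜 𝔤 R) ∘ₗ leftMul 𝕜 𝔤 R z) +
    (LinearMap.lTensorHom (SymR 𝕜 𝔤 R) ∘ₗ leftMul 𝕜 𝔤 R z)

lemma leftMulTensor_tmul (z : 𝕜) (ξ : 𝔤) (x y : SymR 𝕜 𝔤 R) :
    leftMulTensor 𝕜 𝔤 R z ξ (x ⊗ₜ y) =
      leftMul 𝕜 𝔤 R z ξ x ⊗ₜ y + x ⊗ₜ leftMul 𝕜 𝔤 R z ξ y := rfl

lemma leftMulTensor_commutator (z : 𝕜) (ξ η : 𝔤) :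
    leftMulTensor 𝕜 𝔤 R z ξ * leftMulTensor 𝕜 𝔤 R z η -
      leftMulTensor 𝕜 𝔤 R z η * leftMulTensor 𝕜 𝔤 R z ξ =
      z • leftMulTensor 𝕜 𝔤 R z ⁅ξ, η⁆ := by
  refine TensorProduct.ext' fun x y => ?_
  simp only [LinearMap.sub_apply, Module.End.mul_apply, LinearMap.smul_apply,
    leftMulTensor_tmul, map_add, smul_add]
  rw [TensorProduct.smul_tmul', ← TensorProduct.tmul_smul, ← leftMul_commutator,
    ← leftMul_commutator, TensorProduct.sub_tmul, TensorProduct.tmul_sub]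
  abel

/-- Binomial expansion of (L_v ⊗ 1 + 1 ⊗ L_v)^n on 1 ⊗ 1. By `leftMul_symPow` the result does not
depend on z. -/
lemma leftMulTensor_pow_one (z : 𝕜) (n : ℕ) (v : 𝔤) :
    (leftMulTensor 𝕜 𝔤 R z v ^ n) (symOne 𝕜 𝔤 R ⊗ₜ symOne 𝕜 𝔤 R) =
      (n.factorial : 𝕜) • coproduct 𝕜 𝔤 R (divPow 𝕜 R n v) := by
  rw [← map_smul, factorial_smul_divPow]
  induction n with
  | zero =>
    rw [pow_zero, ← symOne_eq v, coproduct_symOne]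
    rfl
  | succ n ih =>
    rw [pow_succ', Module.End.mul_apply, ih, coproduct_symPow, coproduct_symPow, map_sum,
      Finset.sum_antidiagonal_choose_succ_nsmul
        (fun i j => symPow 𝕜 R i v ⊗ₜ[𝕜] symPow 𝕜 R j v) n, ← Finset.sum_add_distrib]
    refine Finset.sum_congr rfl fun ij h => ?_
    rw [Finset.HasAntidiagonal.mem_antidiagonal] at h
    rw [map_nsmul, leftMulTensor_tmul, leftMul_symPow, leftMul_symPow, smul_add, add_comm,
      ← h, ← Nat.choose_symm_add]

/-- Δ is the orbit map of 1 ⊗ 1 under the representation L_ξ ⊗ 1 + 1 ⊗ L_ξ. This is why the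
undeformed coproduct is compatible with every ⋆_z. -/
lemma coproduct_eq_symEval (z : 𝕜) (x : SymR 𝕜 𝔤 R) :
    coproduct 𝕜 𝔤 R x =
      symEval R (leftMulTensor 𝕜 𝔤 R z) x (symOne 𝕜 𝔤 R ⊗ₜ symOne 𝕜 𝔤 R) := by
  suffices h : coproduct 𝕜 𝔤 R = LinearMap.applyₗ (symOne 𝕜 𝔤 R ⊗ₜ symOne 𝕜 𝔤 R) ∘ₗ
      symEval R (leftMulTensor 𝕜 𝔤 R z) from LinearMap.congr_fun h x
  refine symLinear_ext_divPow fun n v => ?_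
  rw [LinearMap.comp_apply, symEval_divPow, map_smul]
  change _ = (n.factorial : 𝕜)⁻¹ •
    (leftMulTensor 𝕜 𝔤 R z v ^ n) (symOne 𝕜 𝔤 R ⊗ₜ symOne 𝕜 𝔤 R)
  rw [leftMulTensor_pow_one, smul_smul, inv_mul_cancel₀, one_smul]
  exact_mod_cast n.factorial_ne_zero

lemma coproduct_leftMul (z : 𝕜) (ξ : 𝔤) (x : SymR 𝕜 𝔤 R) :
    coproduct 𝕜 𝔤 R (leftMul 𝕜 𝔤 R z ξ x) = leftMulTensor 𝕜 𝔤 R z ξ (coproduct 𝕜 𝔤 R x) := by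
  have h := LinearMap.congr_fun
    (mul_symEval z (leftMulTensor 𝕜 𝔤 R z) (leftMulTensor_commutator z) ξ x)
    (symOne 𝕜 𝔤 R ⊗ₜ symOne 𝕜 𝔤 R)
  rw [Module.End.mul_apply] at h
  exact (coproduct_eq_symEval z _).trans
    (h.symm.trans (congrArg _ (coproduct_eq_symEval z x).symm))

/-- The binomial theorem for the commuting operators L_v ⊗ 1 and 1 ⊗ L_v. -/
lemma map₂_starOp_symPow_coproduct (z : 𝕜) (n : ℕ) (v : 𝔤) (t : SymR 𝕜 𝔤 R ⊗[𝕜] SymR 𝕜 𝔤 R) :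
    TensorProduct.map₂ (starOp 𝕜 𝔤 R z) (starOp 𝕜 𝔤 R z) (coproduct 𝕜 𝔤 R (symPow 𝕜 R n v)) t =
      (leftMulTensor 𝕜 𝔤 R z v ^ n) t := by
  let X : Module.End 𝕜 (SymR 𝕜 𝔤 R ⊗[𝕜] SymR 𝕜 𝔤 R) :=
    (leftMul 𝕜 𝔤 R z v).rTensor (SymR 𝕜 𝔤 R)
  let Y : Module.End 𝕜 (SymR 𝕜 𝔤 R ⊗[𝕜] SymR 𝕜 𝔤 R) :=
    (leftMul 𝕜 𝔤 R z v).lTensor (SymR 𝕜 𝔤 R)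
  have hXY : Commute X Y := TensorProduct.ext' fun x y => rfl
  have hadd : leftMulTensor 𝕜 𝔤 R z v = X + Y := rfl
  rw [hadd, hXY.add_pow', coproduct_symPow, map_sum, LinearMap.sum_apply, LinearMap.sum_apply]
  refine Finset.sum_congr rfl fun ij _ => ?_
  rw [map_nsmul, LinearMap.smul_apply, LinearMap.smul_apply]
  congr 1
  induction t using TensorProduct.induction_on with
  | zero => rw [map_zero, map_zero]
  | add a b ha hb => rw [map_add, map_add, ha, hb]
  | tmul a b =>
    rw [TensorProduct.map₂_apply_tmul, TensorProduct.map_tmul, Module.End.mul_apply,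
      LinearMap.lTensor_pow, LinearMap.lTensor_tmul, LinearMap.rTensor_pow, LinearMap.rTensor_tmul,
      starOp, symEval_symPow, symEval_symPow]

lemma coproduct_starOp (z : 𝕜) (x y : SymR 𝕜 𝔤 R) :
    coproduct 𝕜 𝔤 R (starOp 𝕜 𝔤 R z x y) =
      TensorProduct.map₂ (starOp 𝕜 𝔤 R z) (starOp 𝕜 𝔤 R z) (coproduct 𝕜 𝔤 R x)
        (coproduct 𝕜 𝔤 R y) := by
  suffices h : (starOp 𝕜 𝔤 R z).compr₂ (coproduct 𝕜 𝔤 R) =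
      (TensorProduct.map₂ (starOp 𝕜 𝔤 R z) (starOp 𝕜 𝔤 R z)).compl₁₂ (coproduct 𝕜 𝔤 R)
        (coproduct 𝕜 𝔤 R) from LinearMap.congr_fun (LinearMap.congr_fun h x) y
  refine symLinear_ext_symPow fun n v => LinearMap.ext fun y => ?_
  rw [LinearMap.compr₂_apply, LinearMap.compl₁₂_apply, map₂_starOp_symPow_coproduct]
  induction n with
  | zero => rw [starOp_symPow_zero]; rfl
  | succ n ih =>
    rw [starOp_symPow_succ, coproduct_leftMul, ih, pow_succ', Module.End.mul_apply]

lemma sum_antidiagonal_antipode (n : ℕ) :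
    ∑ ij ∈ antidiagonal n, (-1 : 𝕜) ^ ij.1 * ((ij.1.factorial : 𝕜)⁻¹ * (ij.2.factorial : 𝕜)⁻¹) =
      if n = 0 then 1 else 0 := by
  have h := (Commute.all (-1 : 𝕜) 1).add_pow' n
  have h3 : (n.factorial : 𝕜) ≠ 0 := by exact_mod_cast n.factorial_ne_zero
  -- The sum is (-1 + 1)^n / n!.
  have : ∑ ij ∈ antidiagonal n, (-1 : 𝕜) ^ ij.1 *
      ((ij.1.factorial : 𝕜)⁻¹ * (ij.2.factorial : 𝕜)⁻¹) =
      (n.factorial : 𝕜)⁻¹ * (-1 + 1) ^ n := by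
    rw [h, Finset.mul_sum]
    refine Finset.sum_congr rfl fun ij hij => ?_
    rw [Finset.HasAntidiagonal.mem_antidiagonal] at hij
    subst hij
    have h1 : (ij.1.factorial : 𝕜) ≠ 0 := by exact_mod_cast ij.1.factorial_ne_zero
    have h2 : (ij.2.factorial : 𝕜) ≠ 0 := by exact_mod_cast ij.2.factorial_ne_zero
    have h4 : (((ij.1 + ij.2).choose ij.1 * ij.1.factorial * ij.2.factorial : ℕ) : 𝕜) =
        (ij.1 + ij.2).factorial := by
      rw [Nat.choose_symm_add, Nat.add_choose_mul_factorial_mul_factorial]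
    push_cast at h4
    rw [nsmul_eq_mul, one_pow, mul_one]
    field_simp
    rw [← h4]
    ring
  rw [this]
  cases n with
  | zero => simp
  | succ n => simp

/-- The coproduct of v^n involves only powers of v, and these star-multiply as polynomials, so the
convolution reduces to the undeformed alternating sum. -/
lemma antipode_left (z : 𝕜) (x : SymR 𝕜 𝔤 R) :
    TensorProduct.lift (starOp 𝕜 𝔤 R z)
      ((antipode 𝕜 𝔤 R).rTensor _ (coproduct 𝕜 𝔤 R x)) = counit 𝕜 𝔤 R x • symOne 𝕜 𝔤 R := by
  suffices h : TensorProduct.lift (starOp 𝕜 𝔤 R z) ∘ₗ (antipode 𝕜 𝔤 R).rTensor _ ∘ₗ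
      coproduct 𝕜 𝔤 R = (counit 𝕜 𝔤 R).smulRight (symOne 𝕜 𝔤 R) from LinearMap.congr_fun h x
  refine symLinear_ext_divPow fun n v => ?_
  simp only [LinearMap.comp_apply, coproduct_divPow, map_sum, LinearMap.rTensor_tmul,
    TensorProduct.lift.tmul, LinearMap.smulRight_apply, counit_divPow]
  have : ∀ ij ∈ antidiagonal n, starOp 𝕜 𝔤 R z (antipode 𝕜 𝔤 R (divPow 𝕜 R ij.1 v))
      (divPow 𝕜 R ij.2 v) = ((-1 : 𝕜) ^ ij.1 * ((ij.1.factorial : 𝕜)⁻¹ *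
        (ij.2.factorial : 𝕜)⁻¹)) • symPow 𝕜 R n v := by
    intro ij hij
    rw [Finset.HasAntidiagonal.mem_antidiagonal] at hij
    rw [divPow, divPow, map_smul, map_smul, map_smul, antipode_symPow, map_smul,
      LinearMap.smul_apply, LinearMap.smul_apply, starOp_symPow_symPow, hij, smul_smul, smul_smul]
    congr 1
    ring
  rw [Finset.sum_congr rfl this, ← Finset.sum_smul, sum_antidiagonal_antipode]
  split_ifs with h
  · subst h
    rw [symOne_eq v]
  · rw [zero_smul, zero_smul]

lemma antipode_right (z : 𝕜) (x : SymR 𝕜 𝔤 R) :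
    TensorProduct.lift (starOp 𝕜 𝔤 R z)
      ((antipode 𝕜 𝔤 R).lTensor _ (coproduct 𝕜 𝔤 R x)) = counit 𝕜 𝔤 R x • symOne 𝕜 𝔤 R := by
  suffices h : TensorProduct.lift (starOp 𝕜 𝔤 R z) ∘ₗ (antipode 𝕜 𝔤 R).lTensor _ ∘ₗ
      coproduct 𝕜 𝔤 R = (counit 𝕜 𝔤 R).smulRight (symOne 𝕜 𝔤 R) from LinearMap.congr_fun h x
  refine symLinear_ext_divPow fun n v => ?_
  simp only [LinearMap.comp_apply, coproduct_divPow, map_sum, LinearMap.lTensor_tmul,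
    TensorProduct.lift.tmul, LinearMap.smulRight_apply, counit_divPow]
  rw [← Finset.Nat.sum_antidiagonal_swap]
  have : ∀ ij ∈ antidiagonal n, starOp 𝕜 𝔤 R z (divPow 𝕜 R ij.swap.1 v)
      (antipode 𝕜 𝔤 R (divPow 𝕜 R ij.swap.2 v)) = ((-1 : 𝕜) ^ ij.1 * ((ij.1.factorial : 𝕜)⁻¹ *
        (ij.2.factorial : 𝕜)⁻¹)) • symPow 𝕜 R n v := by
    intro ij hij
    rw [Finset.HasAntidiagonal.mem_antidiagonal] at hij
    rw [divPow, divPow, map_smul, map_smul, map_smul, antipode_symPow, map_smul,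
      LinearMap.smul_apply, starOp_symPow_symPow, Prod.fst_swap, Prod.snd_swap, add_comm, hij,
      smul_smul, smul_smul]
    congr 1
    ring
  rw [Finset.sum_congr rfl this, ← Finset.sum_smul, sum_antidiagonal_antipode]
  split_ifs with h
  · subst h
    rw [symOne_eq v]
  · rw [zero_smul, zero_smul]

end Bialgebra

/-! ### The symmetric product and functoriality -/

section SymMul

variable {𝕜 : Type*} [RCLike 𝕜] {𝔤 : Type*} [LieRing 𝔤] [LieAlgebra 𝕜 𝔤] {R : ℝ}

lemma leftMul_zero (ξ : 𝔤) : leftMul 𝕜 𝔤 R 0 ξ = mulVec 𝕜 𝔤 R ξ := by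
  refine symLinear_ext_divPow fun m v => ?_
  rw [leftMul_divPow, Finset.sum_eq_single (0, m)]
  · simp [bern]
  · rintro ⟨j, i⟩ h hne
    rw [Finset.HasAntidiagonal.mem_antidiagonal] at h
    have : j ≠ 0 := fun e => hne (by simp_all)
    simp [this]
  · intro h
    exact absurd (by simp) h

lemma starOp_zero_symPow (k l : ℕ) (v w : 𝔤) :
    starOp 𝕜 𝔤 R 0 (symPow 𝕜 R k v) (symPow 𝕜 R l w) =
      symProd 𝕜 𝔤 R (l + k) fun i => if (i : ℕ) < k then v else w := by
  induction k with
  | zero =>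
    rw [starOp_symPow_zero]
    simp [symPow]
  | succ k ih =>
    rw [starOp_symPow_succ, ih, leftMul_zero, mulVec_symProd]
    change symProd 𝕜 𝔤 R (l + k + 1) _ = symProd 𝕜 𝔤 R (l + k + 1) _
    congr 1
    ext i
    refine Fin.cases ?_ (fun j => ?_) i
    · simp
    · simp

lemma symIncl_symPow {V : Type*} [AddCommGroup V] [Module 𝕜 V] (k : ℕ) (v : V) :
    symIncl 𝕜 V R (symPow 𝕜 R k v) =
      DirectSum.lof 𝕜 ℕ (fun n => ⨂[𝕜]^n V) k (PiTensorProduct.tprod 𝕜 fun _ => v) := by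
  rw [symPow, symProd_apply, symIncl_symOf, coe_toSymPow, symmetrizer_tprod]
  congr 1
  have : ∀ σ : Equiv.Perm (Fin k), ((fun _ => v) ∘ σ : Fin k → V) = fun _ => v := fun _ => rfl
  simp_rw [this]
  rw [Finset.sum_const, Finset.card_univ, Fintype.card_perm, Fintype.card_fin,
    ← Nat.cast_smul_eq_nsmul 𝕜, smul_smul, inv_mul_cancel₀, one_smul]
  exact_mod_cast k.factorial_ne_zero

lemma lof_tprod_mul {𝕜 : Type*} [RCLike 𝕜] {V : Type*} [AddCommGroup V] [Module 𝕜 V] {k l : ℕ} (f : Fin k → V)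
    (g : Fin l → V) :
    (DirectSum.lof 𝕜 ℕ (fun n => ⨂[𝕜]^n V) k (PiTensorProduct.tprod 𝕜 f) *
      DirectSum.lof 𝕜 ℕ (fun n => ⨂[𝕜]^n V) l (PiTensorProduct.tprod 𝕜 g) : TensorAlg 𝕜 V) =
      DirectSum.lof 𝕜 ℕ (fun n => ⨂[𝕜]^n V) (k + l)
        (PiTensorProduct.tprod 𝕜 (Fin.append f g)) := by
  rw [← TensorPower.tprod_mul_tprod]
  exact DirectSum.of_mul_of (A := fun n => ⨂[𝕜]^n V) _ _

lemma symMul_symPow (k l : ℕ) (v w : 𝔤) :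
    symMul (symPow 𝕜 R k v) (symPow 𝕜 R l w) =
      symProd 𝕜 𝔤 R (k + l) fun i => if (i : ℕ) < k then v else w := by
  rw [symMul, symIncl_symPow, symIncl_symPow, lof_tprod_mul, symmetrize_lof, ← symProd_apply]
  congr 1
  ext i
  refine Fin.addCases (fun j => ?_) (fun j => ?_) i
  · simp
  · simp

lemma starOp_zero (x y : SymR 𝕜 𝔤 R) : starOp 𝕜 𝔤 R 0 x y = symMul x y := by
  let B : SymR 𝕜 𝔤 R →ₗ[𝕜] SymR 𝕜 𝔤 R →ₗ[𝕜] SymR 𝕜 𝔤 R :=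
    ((LinearMap.mul 𝕜 (TensorAlg 𝕜 𝔤)).compl₁₂ (symIncl 𝕜 𝔤 R) (symIncl 𝕜 𝔤 R)).compr₂
      (symmetrize 𝕜 𝔤 R)
  suffices h : starOp 𝕜 𝔤 R 0 = B from LinearMap.congr_fun (LinearMap.congr_fun h x) y
  refine symLinear_ext_symPow fun k v => ?_
  refine symLinear_ext_symPow fun l w => ?_
  change _ = symMul (symPow 𝕜 R k v) (symPow 𝕜 R l w)
  rw [starOp_zero_symPow, symMul_symPow, add_comm]

end SymMul

/-! ### The homomorphisms Sym(φ). -/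

section Functoriality

variable {𝕜 : Type*} [RCLike 𝕜] {V W : Type*} [AddCommGroup V] [Module 𝕜 V] [AddCommGroup W]
  [Module 𝕜 W] {R : ℝ}

lemma symMap_symProd (φ : V →ₗ[𝕜] W) {n : ℕ} (f : Fin n → V) :
    symMap R φ (symProd 𝕜 V R n f) = symProd 𝕜 W R n (φ ∘ f) := by
  rw [symProd_apply, symMap, symDesc_symOf]
  simp only [LinearMap.comp_apply, Submodule.subtype_apply, coe_toSymPow]
  rw [symmetrizer_tprod, map_smul, map_sum, map_smul, map_sum, map_smul, map_sum]
  have h0 : ∀ g : Fin n → W, symmetrize 𝕜 W R (DirectSum.lof 𝕜 ℕ (fun n => ⨂[𝕜]^n W) n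
      (PiTensorProduct.tprod 𝕜 g)) = symProd 𝕜 W R n g := fun g => rfl
  simp_rw [PiTensorProduct.map_tprod, h0]
  have : ∀ σ : Equiv.Perm (Fin n), symProd 𝕜 W R n (fun i => φ ((f ∘ σ) i)) =
      symProd 𝕜 W R n (φ ∘ f) := fun σ => symProd_comp (φ ∘ f) σ
  simp_rw [this]
  rw [Finset.sum_const, Finset.card_univ, Fintype.card_perm, Fintype.card_fin,
    ← Nat.cast_smul_eq_nsmul 𝕜, smul_smul, inv_mul_cancel₀, one_smul]
  exact_mod_cast n.factorial_ne_zero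

lemma symMap_symPow (φ : V →ₗ[𝕜] W) (n : ℕ) (v : V) :
    symMap R φ (symPow 𝕜 R n v) = symPow 𝕜 R n (φ v) :=
  symMap_symProd φ _

lemma symMap_divPow (φ : V →ₗ[𝕜] W) (n : ℕ) (v : V) :
    symMap R φ (divPow 𝕜 R n v) = divPow 𝕜 R n (φ v) := by
  rw [divPow, map_smul, symMap_symPow, divPow]

lemma symMap_symOne (φ : V →ₗ[𝕜] W) : symMap R φ (symOne 𝕜 V R) = symOne 𝕜 W R := by
  rw [symOne_eq 0, symMap_symPow, symOne_eq]

lemma symMap_mulVec (φ : V →ₗ[𝕜] W) (u : V) (x : SymR 𝕜 V R) :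
    symMap R φ (mulVec 𝕜 V R u x) = mulVec 𝕜 W R (φ u) (symMap R φ x) := by
  suffices h : symMap R φ ∘ₗ mulVec 𝕜 V R u = mulVec 𝕜 W R (φ u) ∘ₗ symMap R φ from
    LinearMap.congr_fun h x
  refine symLinear_ext_symProd fun n f => ?_
  rw [LinearMap.comp_apply, LinearMap.comp_apply, mulVec_symProd, symMap_symProd, symMap_symProd,
    mulVec_symProd]
  congr 1
  ext i
  refine Fin.cases ?_ (fun j => ?_) i <;> simp

lemma symMap_id : symMap R (LinearMap.id : V →ₗ[𝕜] V) = LinearMap.id :=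
  symLinear_ext_symPow fun n v => by rw [symMap_symPow]; rfl

lemma symMap_comp {X : Type*} [AddCommGroup X] [Module 𝕜 X] (ψ : W →ₗ[𝕜] X) (φ : V →ₗ[𝕜] W) :
    symMap R (ψ ∘ₗ φ) = symMap R ψ ∘ₗ symMap R φ :=
  symLinear_ext_symPow fun n v => by
    rw [LinearMap.comp_apply, symMap_symPow, symMap_symPow, symMap_symPow]; rfl

lemma coproduct_symMap (φ : V →ₗ[𝕜] W) (x : SymR 𝕜 V R) :
    coproduct 𝕜 W R (symMap R φ x) =
      TensorProduct.map (symMap R φ) (symMap R φ) (coproduct 𝕜 V R x) := by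
  suffices h : coproduct 𝕜 W R ∘ₗ symMap R φ =
      TensorProduct.map (symMap R φ) (symMap R φ) ∘ₗ coproduct 𝕜 V R from LinearMap.congr_fun h x
  refine symLinear_ext_divPow fun n v => ?_
  simp only [LinearMap.comp_apply, symMap_divPow, coproduct_divPow, map_sum,
    TensorProduct.map_tmul]

lemma counit_symMap (φ : V →ₗ[𝕜] W) (x : SymR 𝕜 V R) :
    counit 𝕜 W R (symMap R φ x) = counit 𝕜 V R x := by
  suffices h : counit 𝕜 W R ∘ₗ symMap R φ = counit 𝕜 V R from LinearMap.congr_fun h x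
  refine symLinear_ext_divPow fun n v => ?_
  simp only [LinearMap.comp_apply, symMap_divPow, counit_divPow]

lemma antipode_symMap (φ : V →ₗ[𝕜] W) (x : SymR 𝕜 V R) :
    symMap R φ (antipode 𝕜 V R x) = antipode 𝕜 W R (symMap R φ x) := by
  suffices h : symMap R φ ∘ₗ antipode 𝕜 V R = antipode 𝕜 W R ∘ₗ symMap R φ from
    LinearMap.congr_fun h x
  refine symLinear_ext_symPow fun n v => ?_
  simp only [LinearMap.comp_apply, antipode_symPow, symMap_symPow, map_smul]

variable {𝔤 𝔥 : Type*} [LieRing 𝔤] [LieAlgebra 𝕜 𝔤] [LieRing 𝔥] [LieAlgebra 𝕜 𝔥]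

lemma symMap_leftMul (φ : 𝔤 →ₗ⁅𝕜⁆ 𝔥) (z : 𝕜) (ξ : 𝔤) (x : SymR 𝕜 𝔤 R) :
    symMap R φ.toLinearMap (leftMul 𝕜 𝔤 R z ξ x) =
      leftMul 𝕜 𝔥 R z (φ ξ) (symMap R φ.toLinearMap x) := by
  suffices h : symMap R φ.toLinearMap ∘ₗ leftMul 𝕜 𝔤 R z ξ =
      leftMul 𝕜 𝔥 R z (φ ξ) ∘ₗ symMap R φ.toLinearMap from LinearMap.congr_fun h x
  refine symLinear_ext_divPow fun n v => ?_
  rw [LinearMap.comp_apply, LinearMap.comp_apply, leftMul_divPow, symMap_divPow, leftMul_divPow,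
    map_sum]
  refine Finset.sum_congr rfl fun ji _ => ?_
  have : ∀ j, φ.toLinearMap (((LieAlgebra.ad 𝕜 𝔤 v) ^ j) ξ) =
      ((LieAlgebra.ad 𝕜 𝔥 (φ v)) ^ j) (φ ξ) := by
    intro j
    induction j with
    | zero => rfl
    | succ j ih =>
      rw [pow_succ', Module.End.mul_apply, pow_succ', Module.End.mul_apply, ← ih,
        LieAlgebra.ad_apply, LieAlgebra.ad_apply]
      exact φ.map_lie _ _
  rw [map_smul, symMap_mulVec, symMap_divPow, this]
  rfl

lemma symMap_starOp (φ : 𝔤 →ₗ⁅𝕜⁆ 𝔥) (z : 𝕜) (x y : SymR 𝕜 𝔤 R) :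
    symMap R φ.toLinearMap (starOp 𝕜 𝔤 R z x y) =
      starOp 𝕜 𝔥 R z (symMap R φ.toLinearMap x) (symMap R φ.toLinearMap y) := by
  suffices h : (starOp 𝕜 𝔤 R z).compr₂ (symMap R φ.toLinearMap) =
      (starOp 𝕜 𝔥 R z).compl₁₂ (symMap R φ.toLinearMap) (symMap R φ.toLinearMap) from
    LinearMap.congr_fun (LinearMap.congr_fun h x) y
  refine symLinear_ext_symPow fun n v => LinearMap.ext fun y => ?_
  rw [LinearMap.compr₂_apply, LinearMap.compl₁₂_apply, symMap_symPow]
  induction n with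
  | zero => rw [starOp_symPow_zero, starOp_symPow_zero]
  | succ n ih => rw [starOp_symPow_succ, starOp_symPow_succ, symMap_leftMul, ih]; rfl

end Functoriality

/-! ### Universal properties of the projective seminorms -/

lemma seminorm_sum_le {𝕜 E ι : Type*} [RCLike 𝕜] [AddCommGroup E] [Module 𝕜 E]
    (p : Seminorm 𝕜 E) (s : Finset ι) (f : ι → E) : p (∑ i ∈ s, f i) ≤ ∑ i ∈ s, p (f i) :=
  Finset.le_sum_of_subadditive p (map_zero p).le (map_add_le_add p) s f

section InfSeminorm

variable {𝕜 : Type*} [RCLike 𝕜] {A M : Type*} [AddCommGroup M] [Module 𝕜 M]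
  (e : A → M) (w : A → ℝ) (s : 𝕜 → A → A) (he : ∀ c a, e (s c a) = c • e a)
  (hw : ∀ c a, w (s c a) = ‖c‖ * w a) (h0 : ∀ a, 0 ≤ w a)
  (hspan : ∀ x : M, ∃ l : List A, (l.map e).sum = x)

include he hw h0 hspan in
lemma infSeminorm_le (a : A) : infSeminorm e w s he hw h0 hspan (e a) ≤ w a := by
  have hpos : ∀ l : List A, 0 ≤ (l.map w).sum := fun l =>
    List.sum_nonneg (by intro r hr; obtain ⟨a, -, rfl⟩ := List.mem_map.1 hr; exact h0 a)
  have hb : BddBelow (Set.range fun l : {l : List A // (l.map e).sum = e a} => (l.1.map w).sum) :=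
    ⟨0, by rintro _ ⟨l, rfl⟩; exact hpos _⟩
  exact (ciInf_le hb ⟨[a], by simp⟩).trans (by simp)

/-- Maximality of the infimum seminorm: a bound on generators is a bound everywhere. All estimates
on tensors are reduced to elementary tensors in this way. -/
lemma le_mul_infSeminorm (r : Seminorm 𝕜 M) {C : ℝ} (hC : 0 ≤ C) (h : ∀ a, r (e a) ≤ C * w a)
    (x : M) : r x ≤ C * infSeminorm e w s he hw h0 hspan x := by
  have : Nonempty {l : List A // (l.map e).sum = x} := let ⟨l, h⟩ := hspan x; ⟨⟨l, h⟩⟩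
  change r x ≤ C * ⨅ l : {l : List A // (l.map e).sum = x}, (l.1.map w).sum
  rw [Real.mul_iInf_of_nonneg hC]
  refine le_ciInf fun l => ?_
  obtain ⟨l, rfl⟩ := l
  dsimp only
  induction l with
  | nil => simp
  | cons a l ih =>
    rw [List.map_cons, List.sum_cons, List.map_cons, List.sum_cons, mul_add]
    exact (map_add_le_add r _ _).trans (add_le_add (h a) (ih ⟨⟨l, rfl⟩⟩))

end InfSeminorm

section TensorPow

variable {𝕜 : Type*} [RCLike 𝕜] {V : Type*} [AddCommGroup V] [Module 𝕜 V]

lemma tensorPowSeminorm_tprod_le (p : Seminorm 𝕜 V) {n : ℕ} (f : Fin n → V) :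
    tensorPowSeminorm p n (PiTensorProduct.tprod 𝕜 f) ≤ ∏ i, p (f i) := by
  have h := infSeminorm_le (𝕜 := 𝕜) (A := 𝕜 × (Fin n → V))
    (fun a => a.1 • PiTensorProduct.tprod 𝕜 a.2)
    (fun a => ‖a.1‖ * ∏ i, p (a.2 i)) (fun c a => (c * a.1, a.2))
    (fun _ _ => mul_smul _ _ _) (fun c a => by simp [mul_assoc])
    (fun a => mul_nonneg (norm_nonneg _) (Finset.prod_nonneg fun _ _ => apply_nonneg _ _))
    (fun x => by
      induction x using PiTensorProduct.induction_on with
      | smul_tprod r f => exact ⟨[(r, f)], by simp⟩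
      | add x y hx hy =>
        obtain ⟨l, hl⟩ := hx
        obtain ⟨m, hm⟩ := hy
        exact ⟨l ++ m, by rw [List.map_append, List.sum_append, hl, hm]⟩) (1, f)
  simp only [one_smul, norm_one, one_mul] at h
  exact h

lemma le_mul_tensorPowSeminorm (p : Seminorm 𝕜 V) {n : ℕ} (r : Seminorm 𝕜 (⨂[𝕜]^n V)) {C : ℝ}
    (hC : 0 ≤ C) (h : ∀ f : Fin n → V, r (PiTensorProduct.tprod 𝕜 f) ≤ C * ∏ i, p (f i))
    (t : ⨂[𝕜]^n V) : r t ≤ C * tensorPowSeminorm p n t := by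
  refine le_mul_infSeminorm _ _ _ _ _ _ _ r hC (fun a => ?_) t
  rw [map_smul_eq_mul, mul_left_comm]
  exact mul_le_mul_of_nonneg_left (h a.2) (norm_nonneg _)

/-- The symmetrizer is a mean of permutations, none of which changes ∏ p(vᵢ). -/
lemma tensorPowSeminorm_symmetrizer_le (p : Seminorm 𝕜 V) {n : ℕ} (t : ⨂[𝕜]^n V) :
    tensorPowSeminorm p n (symmetrizer 𝕜 V n t) ≤ tensorPowSeminorm p n t := by
  have := le_mul_tensorPowSeminorm p ((tensorPowSeminorm p n).comp (symmetrizer 𝕜 V n))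
    zero_le_one (fun f => by
      rw [one_mul, Seminorm.comp_apply, symmetrizer_tprod, map_smul_eq_mul, norm_inv,
        RCLike.norm_natCast]
      rw [inv_mul_le_iff₀ (by exact_mod_cast n.factorial_pos)]
      refine (seminorm_sum_le (tensorPowSeminorm p n) _ _).trans ?_
      refine (Finset.sum_le_card_nsmul _ _ (∏ i, p (f i)) fun σ _ => ?_).trans (le_of_eq ?_)
      · refine (tensorPowSeminorm_tprod_le p _).trans (le_of_eq ?_)
        exact Equiv.prod_comp σ fun i => p (f i)
      · rw [Finset.card_univ, Fintype.card_perm, Fintype.card_fin, nsmul_eq_mul]) t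
  rwa [one_mul] at this

end TensorPow

section Proj

variable {𝕜 : Type*} [RCLike 𝕜] {E F : Type*} [AddCommGroup E] [Module 𝕜 E] [AddCommGroup F]
  [Module 𝕜 F]

lemma projSeminorm_tmul_le (p : Seminorm 𝕜 E) (q : Seminorm 𝕜 F) (x : E) (y : F) :
    projSeminorm p q (x ⊗ₜ y) ≤ p x * q y :=
  infSeminorm_le (𝕜 := 𝕜) (A := E × F) (fun a => a.1 ⊗ₜ[𝕜] a.2) (fun a => p a.1 * q a.2)
    (fun c a => (c • a.1, a.2)) (fun _ _ => rfl)
    (fun c a => by simp [map_smul_eq_mul, mul_assoc])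
    (fun a => mul_nonneg (apply_nonneg _ _) (apply_nonneg _ _))
    (fun x => by
      induction x using TensorProduct.induction_on with
      | zero => exact ⟨[], rfl⟩
      | tmul x y => exact ⟨[(x, y)], by simp⟩
      | add x y hx hy =>
        obtain ⟨l, hl⟩ := hx
        obtain ⟨m, hm⟩ := hy
        exact ⟨l ++ m, by rw [List.map_append, List.sum_append, hl, hm]⟩) (x, y)

lemma le_mul_projSeminorm (p : Seminorm 𝕜 E) (q : Seminorm 𝕜 F) (r : Seminorm 𝕜 (E ⊗[𝕜] F))
    {C : ℝ} (hC : 0 ≤ C) (h : ∀ x y, r (x ⊗ₜ y) ≤ C * (p x * q y)) (t : E ⊗[𝕜] F) :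
    r t ≤ C * projSeminorm p q t :=
  le_mul_infSeminorm (𝕜 := 𝕜) (A := E × F) (fun a => a.1 ⊗ₜ[𝕜] a.2) (fun a => p a.1 * q a.2)
    (fun c a => (c • a.1, a.2)) (fun _ _ => rfl)
    (fun c a => by simp [map_smul_eq_mul, mul_assoc])
    (fun a => mul_nonneg (apply_nonneg _ _) (apply_nonneg _ _))
    (fun x => by
      induction x using TensorProduct.induction_on with
      | zero => exact ⟨[], rfl⟩
      | tmul x y => exact ⟨[(x, y)], by simp⟩
      | add x y hx hy =>
        obtain ⟨l, hl⟩ := hx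
        obtain ⟨m, hm⟩ := hy
        exact ⟨l ++ m, by rw [List.map_append, List.sum_append, hl, hm]⟩)
    r hC (fun a => h a.1 a.2) t

lemma le_projSeminorm (p : Seminorm 𝕜 E) (q : Seminorm 𝕜 F) (r : Seminorm 𝕜 (E ⊗[𝕜] F))
    (h : ∀ x y, r (x ⊗ₜ y) ≤ p x * q y) (t : E ⊗[𝕜] F) : r t ≤ projSeminorm p q t := by
  have := le_mul_projSeminorm p q r zero_le_one (fun x y => by rw [one_mul]; exact h x y) t
  rwa [one_mul] at this

end Proj

/-! ### Weighted sums of tensor powers -/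

section Weighted

variable {𝕜 : Type*} [RCLike 𝕜] {V : Type*} [AddCommGroup V] [Module 𝕜 V]

lemma summable_weighted (φ : ℕ → ℝ≥0) (p : Seminorm 𝕜 V) (x : TensorAlg 𝕜 V) :
    Summable fun n => (φ n : ℝ) * tensorPowSeminorm p n (x n) := by
  classical
  refine summable_of_ne_finset_zero (s := DFinsupp.support x) fun n hn => ?_
  rw [DFinsupp.notMem_support_iff] at hn
  change (φ n : ℝ) * tensorPowSeminorm p n (x n) = 0
  rw [show x n = 0 from hn, map_zero, mul_zero]

/-- The seminorm `∑ₙ φ(n) pⁿ` on the tensor algebra. -/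
def weightedSeminorm (φ : ℕ → ℝ≥0) (p : Seminorm 𝕜 V) : Seminorm 𝕜 (TensorAlg 𝕜 V) :=
  Seminorm.of (fun x => ∑' n : ℕ, (φ n : ℝ) * tensorPowSeminorm p n (x n))
    (by
      intro x y
      rw [← Summable.tsum_add (summable_weighted φ p x) (summable_weighted φ p y)]
      refine Summable.tsum_le_tsum (fun n => ?_) (summable_weighted φ p (x + y))
        ((summable_weighted φ p x).add (summable_weighted φ p y))
      rw [← mul_add]
      exact mul_le_mul_of_nonneg_left (map_add_le_add _ _ _) (NNReal.coe_nonneg _))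
    (by
      intro c x
      rw [← tsum_mul_left]
      refine tsum_congr fun n => ?_
      rw [show (c • x) n = c • x n from rfl, map_smul_eq_mul]
      ring)

lemma weightedSeminorm_lof (φ : ℕ → ℝ≥0) (p : Seminorm 𝕜 V) (n : ℕ) (t : ⨂[𝕜]^n V) :
    weightedSeminorm φ p (DirectSum.lof 𝕜 ℕ (fun n => ⨂[𝕜]^n V) n t) =
      φ n * tensorPowSeminorm p n t := by
  change ∑' m : ℕ, (φ m : ℝ) * tensorPowSeminorm p m
    (DirectSum.lof 𝕜 ℕ (fun n => ⨂[𝕜]^n V) n t m) = _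
  rw [tsum_eq_single n fun m hm => ?_]
  · congr 2
    exact DirectSum.of_eq_same (β := fun n => ⨂[𝕜]^n V) n t
  · rw [show DirectSum.lof 𝕜 ℕ (fun n => ⨂[𝕜]^n V) n t m = 0 from
      DirectSum.of_eq_of_ne (β := fun n => ⨂[𝕜]^n V) n m t hm, map_zero, mul_zero]

/-- General weights are allowed because intermediate estimates use n!, (n-1)! and `starWeight`
besides n!^R. -/
lemma le_mul_weightedSeminorm (φ : ℕ → ℝ≥0) (p : Seminorm 𝕜 V) (r : Seminorm 𝕜 (TensorAlg 𝕜 V))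
    {C : ℝ} (hC : 0 ≤ C) (h : ∀ n (f : Fin n → V), r (DirectSum.lof 𝕜 ℕ (fun n => ⨂[𝕜]^n V) n
      (PiTensorProduct.tprod 𝕜 f)) ≤ C * (φ n * ∏ i, p (f i))) (x : TensorAlg 𝕜 V) :
    r x ≤ C * weightedSeminorm φ p x := by
  classical
  have h1 : ∀ n (t : ⨂[𝕜]^n V), r (DirectSum.lof 𝕜 ℕ (fun n => ⨂[𝕜]^n V) n t) ≤
      C * (φ n * tensorPowSeminorm p n t) := fun n t => by
    rw [← mul_assoc]
    exact le_mul_tensorPowSeminorm p (r.comp (DirectSum.lof 𝕜 ℕ (fun n => ⨂[𝕜]^n V) n))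
      (mul_nonneg hC (NNReal.coe_nonneg _)) (fun f => by rw [mul_assoc]; exact h n f) t
  have h2 : weightedSeminorm φ p x =
      ∑ n ∈ DFinsupp.support x, (φ n : ℝ) * tensorPowSeminorm p n (x n) := by
    change ∑' n : ℕ, (φ n : ℝ) * tensorPowSeminorm p n (x n) = _
    refine tsum_eq_sum fun n hn => ?_
    rw [DFinsupp.notMem_support_iff] at hn
    rw [show x n = 0 from hn, map_zero, mul_zero]
  have h3 := DirectSum.sum_support_of x
  rw [h2]
  conv_lhs => rw [← h3]
  rw [Finset.mul_sum]
  exact (seminorm_sum_le r _ _).trans (Finset.sum_le_sum fun n _ => h1 n (x n))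

lemma le_weightedSeminorm (φ : ℕ → ℝ≥0) (p : Seminorm 𝕜 V) (r : Seminorm 𝕜 (TensorAlg 𝕜 V))
    (h : ∀ n (f : Fin n → V), r (DirectSum.lof 𝕜 ℕ (fun n => ⨂[𝕜]^n V) n
      (PiTensorProduct.tprod 𝕜 f)) ≤ φ n * ∏ i, p (f i)) (x : TensorAlg 𝕜 V) :
    r x ≤ weightedSeminorm φ p x := by
  have := le_mul_weightedSeminorm φ p r zero_le_one (fun n f => by rw [one_mul]; exact h n f) x
  rwa [one_mul] at this

lemma weightedSeminorm_tprod_le (φ : ℕ → ℝ≥0) (p : Seminorm 𝕜 V) (n : ℕ) (f : Fin n → V) :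
    weightedSeminorm φ p (DirectSum.lof 𝕜 ℕ (fun n => ⨂[𝕜]^n V) n (PiTensorProduct.tprod 𝕜 f)) ≤
      φ n * ∏ i, p (f i) := by
  rw [weightedSeminorm_lof]
  exact mul_le_mul_of_nonneg_left (tensorPowSeminorm_tprod_le p f) (NNReal.coe_nonneg _)

lemma weightedSeminorm_mono {φ ψ : ℕ → ℝ≥0} {p q : Seminorm 𝕜 V} (hφ : φ ≤ ψ) (h : p ≤ q) :
    weightedSeminorm φ p ≤ weightedSeminorm ψ q := fun x =>
  le_weightedSeminorm ψ q _ (fun n f => (weightedSeminorm_tprod_le φ p n f).trans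
    (mul_le_mul (hφ n) (Finset.prod_le_prod (fun _ _ => apply_nonneg _ _) fun i _ => h (f i))
      (Finset.prod_nonneg fun _ _ => apply_nonneg _ _) (NNReal.coe_nonneg _))) x

lemma weightedSeminorm_symmetrize_le (R : ℝ) (φ : ℕ → ℝ≥0) (p : Seminorm 𝕜 V)
    (x : TensorAlg 𝕜 V) :
    weightedSeminorm φ p (symIncl 𝕜 V R (symmetrize 𝕜 V R x)) ≤ weightedSeminorm φ p x := by
  refine le_weightedSeminorm φ p
    ((weightedSeminorm φ p).comp (symIncl 𝕜 V R ∘ₗ symmetrize 𝕜 V R)) (fun n f => ?_) x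
  rw [Seminorm.comp_apply, LinearMap.comp_apply, symmetrize_lof, symIncl_symOf, coe_toSymPow,
    weightedSeminorm_lof]
  exact mul_le_mul_of_nonneg_left ((tensorPowSeminorm_symmetrizer_le p _).trans
    (tensorPowSeminorm_tprod_le p f)) (NNReal.coe_nonneg _)

/-- The restriction of the seminorm `∑ₙ φ(n) pⁿ` to the symmetric tensors. -/
def weightedSym (R : ℝ) (φ : ℕ → ℝ≥0) (p : Seminorm 𝕜 V) : Seminorm 𝕜 (SymR 𝕜 V R) :=
  (weightedSeminorm φ p).comp (symIncl 𝕜 V R)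

lemma symmetrize_symIncl {R : ℝ} (x : SymR 𝕜 V R) :
    symmetrize 𝕜 V R (symIncl 𝕜 V R x) = x := by
  suffices h : symmetrize 𝕜 V R ∘ₗ symIncl 𝕜 V R = LinearMap.id from LinearMap.congr_fun h x
  refine symLinear_ext fun n y => ?_
  rw [LinearMap.comp_apply, symIncl_symOf, symmetrize_lof, toSymPow_coe]
  rfl

lemma weightedSym_symProd_le {R : ℝ} (φ : ℕ → ℝ≥0) (p : Seminorm 𝕜 V) {n : ℕ} (f : Fin n → V) :
    weightedSym R φ p (symProd 𝕜 V R n f) ≤ φ n * ∏ i, p (f i) :=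
  (weightedSeminorm_symmetrize_le R φ p (DirectSum.lof 𝕜 ℕ (fun n => ⨂[𝕜]^n V) n
    (PiTensorProduct.tprod 𝕜 f))).trans (weightedSeminorm_tprod_le φ p n f)

/-- The seminorm of a symmetric tensor is an infimum over decompositions into arbitrary tensors.
Pulling r back along the symmetrization shows that testing on symmetric products is nevertheless
enough. -/
lemma le_mul_weightedSym {R : ℝ} (φ : ℕ → ℝ≥0) (p : Seminorm 𝕜 V) (r : Seminorm 𝕜 (SymR 𝕜 V R))
    {C : ℝ} (hC : 0 ≤ C)
    (h : ∀ n (f : Fin n → V), r (symProd 𝕜 V R n f) ≤ C * (φ n * ∏ i, p (f i)))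
    (x : SymR 𝕜 V R) : r x ≤ C * weightedSym R φ p x := by
  conv_lhs => rw [← symmetrize_symIncl x]
  exact le_mul_weightedSeminorm φ p (r.comp (symmetrize 𝕜 V R)) hC h _

lemma le_weightedSym {R : ℝ} (φ : ℕ → ℝ≥0) (p : Seminorm 𝕜 V) (r : Seminorm 𝕜 (SymR 𝕜 V R))
    (h : ∀ n (f : Fin n → V), r (symProd 𝕜 V R n f) ≤ φ n * ∏ i, p (f i))
    (x : SymR 𝕜 V R) : r x ≤ weightedSym R φ p x := by
  have := le_mul_weightedSym φ p r zero_le_one (fun n f => by rw [one_mul]; exact h n f) x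
  rwa [one_mul] at this

lemma weightedSym_mono {R : ℝ} {φ ψ : ℕ → ℝ≥0} {p q : Seminorm 𝕜 V} (hφ : φ ≤ ψ) (h : p ≤ q) :
    weightedSym R φ p ≤ weightedSym R ψ q := fun _ => weightedSeminorm_mono hφ h _

/-- On a homogeneous element only one weight matters, so weight sequences can be exchanged degree by
degree. -/
lemma weightedSym_smul_weight {R : ℝ} {φ ψ : ℕ → ℝ≥0} (p : Seminorm 𝕜 V) {m : ℕ} {c : ℝ≥0}
    (h : ψ m = c * φ m) {x : SymR 𝕜 V R} (hx : x ∈ homPart 𝕜 V R m) :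
    weightedSym R ψ p x = c * weightedSym R φ p x := by
  obtain ⟨y, rfl⟩ := hx
  rw [weightedSym, weightedSym, Seminorm.comp_apply, Seminorm.comp_apply, symIncl_symOf,
    weightedSeminorm_lof, weightedSeminorm_lof, h, NNReal.coe_mul, mul_assoc]

/-- Bilinear maps on the tensor algebra are estimated on pairs of elementary tensors. -/
lemma bilin_le_weightedSeminorm {W : Type*} [AddCommGroup W] [Module 𝕜 W]
    (B : TensorAlg 𝕜 V →ₗ[𝕜] TensorAlg 𝕜 V →ₗ[𝕜] W) (r : Seminorm 𝕜 W) (φ ψ : ℕ → ℝ≥0)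
    (p q : Seminorm 𝕜 V) {C : ℝ} (hC : 0 ≤ C)
    (h : ∀ k l (f : Fin k → V) (g : Fin l → V),
      r (B (DirectSum.lof 𝕜 ℕ (fun n => ⨂[𝕜]^n V) k (PiTensorProduct.tprod 𝕜 f))
        (DirectSum.lof 𝕜 ℕ (fun n => ⨂[𝕜]^n V) l (PiTensorProduct.tprod 𝕜 g))) ≤
      C * (φ k * ∏ i, p (f i)) * (ψ l * ∏ i, q (g i))) (x y : TensorAlg 𝕜 V) :
    r (B x y) ≤ C * weightedSeminorm φ p x * weightedSeminorm ψ q y := by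
  rw [mul_right_comm]
  refine le_mul_weightedSeminorm φ p (r.comp (B.flip y)) (mul_nonneg hC (apply_nonneg _ _))
    (fun k f => ?_) x
  rw [mul_right_comm]
  exact le_mul_weightedSeminorm ψ q (r.comp (B (DirectSum.lof 𝕜 ℕ (fun n => ⨂[𝕜]^n V) k
    (PiTensorProduct.tprod 𝕜 f)))) (mul_nonneg hC (mul_nonneg (NNReal.coe_nonneg _)
      (Finset.prod_nonneg fun _ _ => apply_nonneg _ _))) (h k · f) y

/-- The weights `n!^R`. -/
def factorialWeight (R : ℝ) (n : ℕ) : ℝ≥0 := (n.factorial : ℝ≥0) ^ R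

lemma tensorSeminormR_eq (R : ℝ) (p : Seminorm 𝕜 V) :
    tensorSeminormR R p = weightedSeminorm (factorialWeight R) p := by
  ext x
  change ∑' n : ℕ, (n.factorial : ℝ) ^ R * _ = ∑' n : ℕ, (factorialWeight R n : ℝ) * _
  simp only [factorialWeight, NNReal.coe_rpow, NNReal.coe_natCast]

lemma symSeminormR_eq (R : ℝ) (p : Seminorm 𝕜 V) :
    symSeminormR R p = weightedSym R (factorialWeight R) p := by
  rw [symSeminormR, tensorSeminormR_eq, weightedSym]

end Weighted

/-! ### Submultiplicative seminorms from asymptotic estimates -/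

section Words

variable {𝕜 : Type*} [RCLike 𝕜] {𝔤 : Type*} [LieRing 𝔤] [LieAlgebra 𝕜 𝔤]

lemma wordWeight_nonneg (q : Seminorm 𝕜 𝔤) (w : FreeMagma 𝔤) : 0 ≤ wordWeight q w := by
  induction w with
  | ih1 x => exact apply_nonneg q x
  | ih2 a b ha hb => exact mul_nonneg ha hb

/-- The largest seminorm `s` with `s (w(x₁, …, xₙ)) ≤ q x₁ ⋯ q xₙ` for all words `w`. -/
def wordSeminorm (q : Seminorm 𝕜 𝔤) : Seminorm 𝕜 𝔤 :=
  infSeminorm (A := 𝕜 × FreeMagma 𝔤) (fun a => a.1 • evalWord a.2)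
    (fun a => ‖a.1‖ * wordWeight q a.2) (fun c a => (c * a.1, a.2))
    (fun _ _ => mul_smul _ _ _) (fun c a => by simp [mul_assoc])
    (fun a => mul_nonneg (norm_nonneg _) (wordWeight_nonneg q _))
    (fun x => ⟨[(1, .of x)], by simp [evalWord]⟩)

lemma wordSeminorm_evalWord_le (q : Seminorm 𝕜 𝔤) (w : FreeMagma 𝔤) :
    wordSeminorm q (evalWord w) ≤ wordWeight q w := by
  have h := infSeminorm_le (𝕜 := 𝕜) (A := 𝕜 × FreeMagma 𝔤) (fun a => a.1 • evalWord a.2)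
    (fun a => ‖a.1‖ * wordWeight q a.2) (fun c a => (c * a.1, a.2))
    (fun _ _ => mul_smul _ _ _) (fun c a => by simp [mul_assoc])
    (fun a => mul_nonneg (norm_nonneg _) (wordWeight_nonneg q _))
    (fun x => ⟨[(1, .of x)], by simp [evalWord]⟩) (1, w)
  simp only [one_smul, norm_one, one_mul] at h
  exact h

lemma le_mul_wordSeminorm (q r : Seminorm 𝕜 𝔤) {C : ℝ} (hC : 0 ≤ C)
    (h : ∀ w, r (evalWord w) ≤ C * wordWeight q w) (x : 𝔤) : r x ≤ C * wordSeminorm q x := by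
  refine le_mul_infSeminorm _ _ _ _ _ _ _ r hC (fun a => ?_) x
  rw [map_smul_eq_mul, mul_left_comm]
  exact mul_le_mul_of_nonneg_left (h a.2) (norm_nonneg _)

lemma wordSeminorm_le (q : Seminorm 𝕜 𝔤) : wordSeminorm q ≤ q :=
  fun x => wordSeminorm_evalWord_le q (.of x)

lemma IsAsymptoticEstimate.le_wordSeminorm {p q : Seminorm 𝕜 𝔤} (h : IsAsymptoticEstimate p q) :
    p ≤ wordSeminorm q := fun x => by
  have := le_mul_wordSeminorm q p zero_le_one (fun w => by rw [one_mul]; exact h w) x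
  rwa [one_mul] at this

/-- The bracket of two words is a word. Maximality extends the bound to arbitrary elements, first in
one slot and then, by skew-symmetry, in the other. Thus an asymptotic estimate becomes a
submultiplicative seminorm between p and q. -/
lemma wordSeminorm_lie_le (q : Seminorm 𝕜 𝔤) (x y : 𝔤) :
    wordSeminorm q ⁅x, y⁆ ≤ wordSeminorm q x * wordSeminorm q y := by
  have h1 : ∀ a : FreeMagma 𝔤, wordSeminorm q ⁅evalWord a, y⁆ ≤
      wordWeight q a * wordSeminorm q y := fun a =>
    le_mul_wordSeminorm q ((wordSeminorm q).comp (LieAlgebra.ad 𝕜 𝔤 (evalWord a)))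
      (wordWeight_nonneg q a) (fun w => wordSeminorm_evalWord_le q (.mul a w)) y
  rw [mul_comm]
  refine le_mul_wordSeminorm q ((wordSeminorm q).comp (LieAlgebra.ad 𝕜 𝔤 y))
    (apply_nonneg _ _) (fun w => ?_) x |>.trans' (le_of_eq ?_)
  · rw [Seminorm.comp_apply, LieAlgebra.ad_apply, ← lie_skew, map_neg_eq_map, mul_comm]
    exact h1 w
  · rw [Seminorm.comp_apply, LieAlgebra.ad_apply, ← lie_skew, map_neg_eq_map]

end Words

/-! ### Estimates for left multiplication -/

section BernoulliBound

/-- Euler's formula for ζ(2k) together with ζ(2k) ≤ ζ(2) = π²/6; cancelling π² ≤ π^(2k) leaves room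
to spare. -/
lemma abs_bernoulli_le {k : ℕ} (hk : k ≠ 0) :
    |(bernoulli (2 * k) : ℝ) / (2 * k).factorial| ≤ (1 / 2) ^ (2 * k) := by
  have hπ : 3 < Real.pi := Real.pi_gt_three
  have h1 := hasSum_zeta_nat hk
  have h2 : (-1 : ℝ) ^ (k + 1) * (2 : ℝ) ^ (2 * k - 1) * Real.pi ^ (2 * k) *
      bernoulli (2 * k) / (2 * k).factorial ≤ Real.pi ^ 2 / 6 :=
    hasSum_le (fun n => by
      rcases Nat.eq_zero_or_pos n with rfl | hn
      -- The term n = 0 of both series is 1/0 = 0.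
      · simp [hk]
      · have : (1 : ℝ) ≤ n := by exact_mod_cast hn
        exact one_div_le_one_div_of_le (by positivity) (pow_le_pow_right₀ this (by omega)))
      h1 hasSum_zeta_two
  have h3 := h1.nonneg fun n => by positivity
  rw [← abs_of_nonneg h3, mul_div_assoc, abs_mul, abs_mul, abs_mul, abs_pow, abs_neg, abs_one,
    one_pow, one_mul, abs_of_pos (by positivity : (0 : ℝ) < 2 ^ (2 * k - 1)),
    abs_of_pos (by positivity : 0 < Real.pi ^ (2 * k))] at h2
  set b := |(bernoulli (2 * k) : ℝ) / (2 * k).factorial|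
  have hb : 0 ≤ b := abs_nonneg _
  have h4 : Real.pi ^ 2 * b ≤ Real.pi ^ (2 * k) * b :=
    mul_le_mul_of_nonneg_right (pow_le_pow_right₀ (by linarith) (by omega)) hb
  have h5 : (2 : ℝ) ^ (2 * k) = 2 ^ (2 * k - 1) * 2 := by
    rw [← pow_succ]
    congr 1
    omega
  rw [one_div, inv_pow, ← one_div, le_div_iff₀ (by positivity), h5]
  have h6 : (2 : ℝ) ^ (2 * k - 1) * (Real.pi ^ 2 * b) ≤ Real.pi ^ 2 / 6 :=
    le_trans (mul_le_mul_of_nonneg_left h4 (by positivity)) (by linarith [h2])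
  have h7 : Real.pi ^ 2 * (b * (2 ^ (2 * k - 1) * 2)) ≤ Real.pi ^ 2 * 1 := by
    have : 0 < Real.pi ^ 2 := by positivity
    linarith
  exact le_of_mul_le_mul_left h7 (by positivity)

lemma norm_bern_le {𝕜 : Type*} [RCLike 𝕜] (n : ℕ) : ‖bern 𝕜 n‖ ≤ (1 / 2) ^ n := by
  have h : ‖bern 𝕜 n‖ = |(bernoulli n : ℝ) / n.factorial| := by
    rw [bern, ← RCLike.ofReal_ratCast, RCLike.norm_ofReal]
    push_cast
    rfl
  rw [h]
  rcases Nat.even_or_odd' n with ⟨k, rfl | rfl⟩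
  · rcases eq_or_ne k 0 with rfl | hk
    · simp
    · exact abs_bernoulli_le hk
  · rcases eq_or_ne k 0 with rfl | hk
    -- B₁ = -1/2 attains the bound; the remaining odd Bernoulli numbers vanish.
    · rw [bernoulli_one]
      norm_num
    · rw [bernoulli_eq_zero_of_odd ⟨k, rfl⟩ (by omega)]
      simp

end BernoulliBound

/-! ### Norms of contractions and of left multiplications. -/

section Contraction

variable {𝕜 : Type*} [RCLike 𝕜] {𝔤 : Type*} [LieRing 𝔤] [LieAlgebra 𝕜 𝔤] {R : ℝ}

/-- The weight n! is chosen for this: contracting degree n + 1 gives n + 1 terms of degree n, and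
(n+1) n! = (n+1)!. Each bracket costs nothing by submultiplicativity. -/
lemma projSeminorm_bracketContr_le (s : Seminorm 𝕜 𝔤) (hs : ∀ x y, s ⁅x, y⁆ ≤ s x * s y)
    (t : 𝔤 ⊗[𝕜] SymR 𝕜 𝔤 R) :
    projSeminorm s (weightedSym R (fun n => n.factorial) s) (bracketContr 𝕜 𝔤 R t) ≤
      projSeminorm s (weightedSym R (fun n => n.factorial) s) t := by
  set N := weightedSym (𝕜 := 𝕜) (V := 𝔤) R (fun n => (n.factorial : ℝ≥0)) s with hN
  refine le_projSeminorm s N ((projSeminorm s N).comp (bracketContr 𝕜 𝔤 R)) (fun ξ x => ?_) t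
  refine le_mul_weightedSym _ s ((projSeminorm s N).comp
    (bracketContr 𝕜 𝔤 R ∘ₗ TensorProduct.mk 𝕜 𝔤 (SymR 𝕜 𝔤 R) ξ)) (apply_nonneg s ξ)
    (fun n f => ?_) x
  rw [Seminorm.comp_apply, LinearMap.comp_apply, TensorProduct.mk_apply, bracketContr_tmul]
  cases n with
  | zero =>
    have : contraction 𝕜 𝔤 R (symProd 𝕜 𝔤 R 0 f) = 0 := by
      rw [contraction, symLift_symProd]
      simp
    rw [this, map_zero, map_zero]
    exact mul_nonneg (apply_nonneg _ _) (mul_nonneg (NNReal.coe_nonneg _)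
      (Finset.prod_nonneg fun _ _ => apply_nonneg _ _))
  | succ n =>
    rw [contraction_symProd_succ, map_smul, map_sum, map_smul_eq_mul, norm_inv,
      RCLike.norm_natCast, inv_mul_le_iff₀ (by exact_mod_cast n.factorial_pos)]
    refine (seminorm_sum_le _ _ _).trans ?_
    have h : ∀ σ : Equiv.Perm (Fin (n + 1)), projSeminorm s N
        ((bracketLeft 𝕜 𝔤 ξ).rTensor (SymR 𝕜 𝔤 R) (splitHead 𝕜 𝔤 R n (f ∘ σ))) ≤
        s ξ * (n.factorial * ∏ i, s (f i)) := by
      intro σ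
      rw [splitHead_apply, LinearMap.rTensor_tmul]
      refine (projSeminorm_tmul_le s N _ _).trans ?_
      have h1 : s (bracketLeft 𝕜 𝔤 ξ ((f ∘ σ) 0)) ≤ s (f (σ 0)) * s ξ := hs _ _
      have h2 : N (symProd 𝕜 𝔤 R n (Fin.tail (f ∘ σ))) ≤
          n.factorial * ∏ i : Fin n, s (f (σ i.succ)) := weightedSym_symProd_le _ _ _
      refine (mul_le_mul h1 h2 (apply_nonneg _ _)
        (mul_nonneg (apply_nonneg _ _) (apply_nonneg _ _))).trans (le_of_eq ?_)
      rw [← Equiv.prod_comp σ fun i => s (f i), Fin.prod_univ_succ]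
      ring
    refine (Finset.sum_le_card_nsmul _ _ _ fun σ _ => h σ).trans (le_of_eq ?_)
    rw [Finset.card_univ, Fintype.card_perm, Fintype.card_fin, nsmul_eq_mul]
    simp only [NNReal.coe_natCast]
    ring

/-- The weight (n-1)! records that the degree has gone up by one without a new factorial. Its
truncated value at n = 0 is irrelevant, because the image has positive degree. -/
lemma weightedSym_lift_mulVec_le {V : Type*} [AddCommGroup V] [Module 𝕜 V] (s : Seminorm 𝕜 V)
    (t : V ⊗[𝕜] SymR 𝕜 V R) :
    weightedSym R (fun n => (n - 1).factorial) s (TensorProduct.lift (mulVec 𝕜 V R) t) ≤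
      projSeminorm s (weightedSym R (fun n => n.factorial) s) t := by
  refine le_projSeminorm s _ ((weightedSym R (fun n => (n - 1).factorial) s).comp
    (TensorProduct.lift (mulVec 𝕜 V R))) (fun ξ x => ?_) t
  refine le_mul_weightedSym _ s ((weightedSym R (fun n => (n - 1).factorial) s).comp
    (mulVec 𝕜 V R ξ)) (apply_nonneg s ξ) (fun n f => ?_) x
  rw [Seminorm.comp_apply, mulVec_symProd]
  refine (weightedSym_symProd_le _ _ _).trans (le_of_eq ?_)
  rw [Fin.prod_univ_succ]
  simp only [Fin.cons_zero, Fin.cons_succ, Nat.add_sub_cancel]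
  ring

lemma weightedSym_mulContr_le (s : Seminorm 𝕜 𝔤) (hs : ∀ x y, s ⁅x, y⁆ ≤ s x * s y) (j : ℕ)
    (ξ : 𝔤) (x : SymR 𝕜 𝔤 R) :
    weightedSym R (fun n => (n - 1).factorial) s (mulContr 𝕜 𝔤 R j ξ x) ≤
      s ξ * weightedSym R (fun n => n.factorial) s x := by
  rw [mulContr_apply]
  refine (weightedSym_lift_mulVec_le s _).trans ?_
  have h : ∀ t : 𝔤 ⊗[𝕜] SymR 𝕜 𝔤 R, projSeminorm s (weightedSym R (fun n => n.factorial) s)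
      ((bracketContr 𝕜 𝔤 R ^ j) t) ≤
        projSeminorm s (weightedSym R (fun n => n.factorial) s) t := by
    intro t
    induction j with
    | zero => rfl
    | succ j ih =>
      rw [pow_succ', Module.End.mul_apply]
      exact (projSeminorm_bracketContr_le s hs _).trans ih
  exact (h _).trans (projSeminorm_tmul_le _ _ _ _)

/-- Since (i+1) binom(i+1+2k, i+1) = (2k+1) binom(i+1+2k, i), this is the hockey-stick identity. -/
lemma sum_mul_choose (k m : ℕ) : ∑ i ∈ Finset.range (m + 1),
    (i + 1) * (i + 1 + 2 * k).choose (i + 1) = (2 * k + 1) * (m + 2 * (k + 1)).choose m := by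
  induction m with
  | zero => simp; ring
  | succ m ih =>
    rw [Finset.sum_range_succ, ih]
    have h := Nat.choose_succ_right_eq (m + 1 + 1 + 2 * k) (m + 1)
    rw [show m + 1 + 1 + 2 * k - (m + 1) = 2 * k + 1 by omega] at h
    rw [show m + 1 + 2 * (k + 1) = m + 1 + 1 + 2 * k + 1 by omega, Nat.choose_succ_succ,
      show m + 2 * (k + 1) = m + 1 + 1 + 2 * k by omega]
    linarith

/-- The weights for the estimate of `k`-fold left multiplications. -/
def starWeight (k m : ℕ) : ℝ≥0 :=
  k.factorial * (m + 2 * k).choose m * (1 / 2) ^ m * m.factorial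

/-- The recursion that dictates the form of `starWeight`. The factor 2^(-j) bounds the Bernoulli
coefficient and i + 1 is (i+1)!/i!. The sum equals 2^(-m-1) k! (2k+1) binom(m+2k+2, m), and (2k+1)/2
≤ k + 1. -/
lemma sum_starWeight_le (k m : ℕ) : ∑ ji ∈ antidiagonal m, (1 / 2 : ℝ) ^ ji.1 *
    (k.factorial * (ji.2 + 1 + 2 * k).choose (ji.2 + 1) * (1 / 2) ^ (ji.2 + 1) * (ji.2 + 1)) ≤
      (k + 1).factorial * (m + 2 * (k + 1)).choose m * (1 / 2) ^ m := by
  have h : ∑ ji ∈ antidiagonal m, (1 / 2 : ℝ) ^ ji.1 *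
      (k.factorial * (ji.2 + 1 + 2 * k).choose (ji.2 + 1) * (1 / 2) ^ (ji.2 + 1) * (ji.2 + 1)) =
      (1 / 2) ^ (m + 1) * k.factorial * ∑ i ∈ Finset.range (m + 1),
        (((i + 1) * (i + 1 + 2 * k).choose (i + 1) : ℕ) : ℝ) := by
    rw [← Finset.Nat.sum_antidiagonal_swap, Finset.Nat.sum_antidiagonal_eq_sum_range_succ_mk,
      Finset.mul_sum]
    refine Finset.sum_congr rfl fun i hi => ?_
    have hi : i ≤ m := by simpa [Nat.lt_succ_iff] using hi
    simp only [Prod.fst_swap, Prod.snd_swap]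
    rw [show m + 1 = (m - i) + (i + 1) by omega, pow_add]
    push_cast
    ring
  rw [h, ← Nat.cast_sum, sum_mul_choose, pow_succ, Nat.factorial_succ]
  push_cast
  have h1 : (0 : ℝ) ≤ (1 / 2) ^ m * k.factorial * (m + 2 * (k + 1)).choose m := by positivity
  nlinarith

lemma weightedSym_leftMul_le (s : Seminorm 𝕜 𝔤) (hs : ∀ x y, s ⁅x, y⁆ ≤ s x * s y) (k : ℕ)
    (ξ : 𝔤) (x : SymR 𝕜 𝔤 R) :
    weightedSym R (starWeight k) s (leftMul 𝕜 𝔤 R 1 ξ x) ≤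
      s ξ * weightedSym R (starWeight (k + 1)) s x := by
  refine le_mul_weightedSym _ s ((weightedSym R (starWeight k) s).comp (leftMul 𝕜 𝔤 R 1 ξ))
    (apply_nonneg s ξ) (fun m f => ?_) x
  rw [Seminorm.comp_apply, leftMul_of_mem 1 ξ (symProd_mem_homPart f)]
  refine (seminorm_sum_le _ _ _).trans ?_
  have h : ∀ ji ∈ antidiagonal m, weightedSym R (starWeight k) s
      (((1 : 𝕜) ^ ji.1 * bern 𝕜 ji.1) • mulContr 𝕜 𝔤 R ji.1 ξ (symProd 𝕜 𝔤 R m f)) ≤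
      ((1 / 2 : ℝ) ^ ji.1 * (k.factorial * (ji.2 + 1 + 2 * k).choose (ji.2 + 1) *
        (1 / 2) ^ (ji.2 + 1) * (ji.2 + 1))) * (s ξ * (m.factorial * ∏ i, s (f i))) := by
    rintro ⟨j, i⟩ h
    rw [Finset.HasAntidiagonal.mem_antidiagonal] at h
    dsimp only at h ⊢
    subst h
    have hmem := mulContr_mem j ξ (symProd_mem_homPart (𝕜 := 𝕜) (R := R) f)
    -- The term lies in degree i + 1, where `starWeight k` is c times i!, because (i+1)! = (i+1) i!.
    rw [one_pow, one_mul, map_smul_eq_mul, weightedSym_smul_weight s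
      (φ := fun n => (n - 1).factorial) (c := k.factorial * (i + 1 + 2 * k).choose (i + 1) *
        (1 / 2) ^ (i + 1) * (i + 1)) ?_ hmem]
    · rw [mul_assoc ((1 / 2 : ℝ) ^ j)]
      refine mul_le_mul (norm_bern_le j) ?_ (mul_nonneg (NNReal.coe_nonneg _) (apply_nonneg _ _))
        (by positivity)
      push_cast
      refine mul_le_mul_of_nonneg_left ?_ (by positivity)
      refine (weightedSym_mulContr_le s hs j ξ _).trans
        (mul_le_mul_of_nonneg_left ?_ (apply_nonneg _ _))
      refine (weightedSym_symProd_le _ _ _).trans (le_of_eq ?_)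
      simp
    · rw [starWeight, Nat.add_sub_cancel, Nat.factorial_succ i]
      push_cast
      ring
  refine (Finset.sum_le_sum h).trans ?_
  rw [← Finset.sum_mul]
  refine (mul_le_mul_of_nonneg_right (sum_starWeight_le k m)
    (mul_nonneg (apply_nonneg _ _) (mul_nonneg (Nat.cast_nonneg _)
      (Finset.prod_nonneg fun _ _ => apply_nonneg _ _)))).trans (le_of_eq ?_)
  rw [starWeight]
  push_cast
  ring

lemma weightedSym_prod_leftMul_le (s : Seminorm 𝕜 𝔤) (hs : ∀ x y, s ⁅x, y⁆ ≤ s x * s y) {k : ℕ}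
    (f : Fin k → 𝔤) (i : ℕ) (y : SymR 𝕜 𝔤 R) :
    weightedSym R (starWeight i) s ((List.ofFn fun j => leftMul 𝕜 𝔤 R 1 (f j)).prod y) ≤
      (∏ j, s (f j)) * weightedSym R (starWeight (i + k)) s y := by
  induction k generalizing i with
  | zero => simp
  | succ k ih =>
    rw [List.ofFn_succ, List.prod_cons, Module.End.mul_apply, Fin.prod_univ_succ, mul_assoc]
    refine (weightedSym_leftMul_le s hs i (f 0) _).trans
      (mul_le_mul_of_nonneg_left ?_ (apply_nonneg _ _))
    rw [show i + (k + 1) = i + 1 + k by omega]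
    exact ih (fun j => f j.succ) (i + 1)

/-- Star multiplication by f₁ ⋯ f_k is a mean of products of k left multiplications, each of which
raises the weight index by one. -/
lemma weightedSym_starOp_symProd_le (s : Seminorm 𝕜 𝔤) (hs : ∀ x y, s ⁅x, y⁆ ≤ s x * s y) {k : ℕ}
    (f : Fin k → 𝔤) (y : SymR 𝕜 𝔤 R) :
    weightedSym R (starWeight 0) s (starOp 𝕜 𝔤 R 1 (symProd 𝕜 𝔤 R k f) y) ≤
      (∏ j, s (f j)) * weightedSym R (starWeight k) s y := by
  have h : starOp 𝕜 𝔤 R 1 (symProd 𝕜 𝔤 R k f) y = (k.factorial : 𝕜)⁻¹ •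
      ∑ σ : Equiv.Perm (Fin k), (List.ofFn fun j => leftMul 𝕜 𝔤 R 1 (f (σ j))).prod y := by
    rw [starOp, symEval, symLift_symProd, LinearMap.smul_apply, LinearMap.sum_apply]
    simp only [MultilinearMap.compLinearMap_apply, MultilinearMap.mkPiAlgebraFin_apply]
    rfl
  rw [h, map_smul_eq_mul, norm_inv, RCLike.norm_natCast,
    inv_mul_le_iff₀ (by exact_mod_cast k.factorial_pos)]
  refine (seminorm_sum_le _ _ _).trans ?_
  refine (Finset.sum_le_card_nsmul _ _ ((∏ j, s (f j)) * weightedSym R (starWeight k) s y)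
    fun σ _ => ?_).trans (le_of_eq ?_)
  · refine (weightedSym_prod_leftMul_le s hs (fun j => f (σ j)) 0 y).trans (le_of_eq ?_)
    rw [zero_add, Equiv.prod_comp σ fun j => s (f j)]
  · rw [Finset.card_univ, Fintype.card_perm, Fintype.card_fin, nsmul_eq_mul]

end Contraction

/-! ### Numerical estimates -/

section Numerics

/-- Compare with one term of ∑_l binom(l+a, l) x^l = (1-x)^(-a-1) at x = 1/4. In the induction
Pascal's rule matches 1/4 + 3/4 = 1. -/
lemma choose_le_four_pow (l a : ℕ) :
    ((l + a).choose l : ℝ) ≤ 4 ^ l * (4 / 3) ^ (a + 1) := by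
  induction l generalizing a with
  | zero =>
    simp only [zero_add, Nat.choose_zero_right, Nat.cast_one, pow_zero, one_mul]
    exact one_le_pow₀ (by norm_num)
  | succ l ihl =>
    induction a with
    | zero =>
      simp only [add_zero, Nat.choose_self, Nat.cast_one, zero_add, pow_one]
      have : (1 : ℝ) ≤ 4 ^ (l + 1) := one_le_pow₀ (by norm_num)
      linarith
    | succ a iha =>
      rw [show l + 1 + (a + 1) = (l + (a + 1)) + 1 by omega, Nat.choose_succ_succ,
        show l + (a + 1) = l + 1 + a by omega, Nat.cast_add]
      have h := ihl (a + 1)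
      rw [show l + (a + 1) = l + 1 + a by omega] at h
      refine (add_le_add h iha).trans (le_of_eq ?_)
      ring

/-- A two-sided bound on D is used because the exponent 1 - r has either sign. -/
lemma rpow_le_rpow_of_abs_le {D P e M : ℝ} (hD : 0 < D) (hP : 1 ≤ P) (h1 : D ≤ P)
    (h2 : D⁻¹ ≤ P) (he : |e| ≤ M) : D ^ e ≤ P ^ M := by
  refine le_trans ?_ (Real.rpow_le_rpow_of_exponent_le hP he)
  rcases le_total 0 e with h | h
  · rw [abs_of_nonneg h]
    exact Real.rpow_le_rpow hD.le h1 h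
  · rw [abs_of_nonpos h, ← neg_neg e, Real.rpow_neg hD.le, ← Real.inv_rpow hD.le, neg_neg]
    exact Real.rpow_le_rpow (inv_nonneg.2 hD.le) h2 (neg_nonneg.2 h)

/-- k! l! ≤ (k+l)! = binom(m+n, m) m! n!, and the binomial coefficient is at most 2^(m+n). -/
lemma factorial_mul_le {k l m n : ℕ} (h : m + n = k + l) :
    (k.factorial : ℝ) * l.factorial ≤ 2 ^ (k + l) * (m.factorial * n.factorial) := by
  have h1 : ((m + n).choose m : ℝ) * m.factorial * n.factorial = (m + n).factorial := by
    have := Nat.choose_mul_factorial_mul_factorial (Nat.le_add_right m n)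
    rw [Nat.add_sub_cancel_left] at this
    exact_mod_cast this
  have h2 : ((k + l).choose k : ℝ) * k.factorial * l.factorial = (k + l).factorial := by
    have := Nat.choose_mul_factorial_mul_factorial (Nat.le_add_right k l)
    rw [Nat.add_sub_cancel_left] at this
    exact_mod_cast this
  have h3 : (1 : ℝ) ≤ (k + l).choose k := by
    exact_mod_cast Nat.choose_pos (Nat.le_add_right k l)
  have h4 : ((m + n).choose m : ℝ) ≤ 2 ^ (m + n) := by
    exact_mod_cast Nat.choose_le_two_pow (m + n) m
  calc (k.factorial : ℝ) * l.factorial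
      ≤ (k + l).choose k * (k.factorial * l.factorial) :=
        le_mul_of_one_le_left (by positivity) h3
    _ = (m + n).choose m * (m.factorial * n.factorial) := by
        rw [← mul_assoc, h2, ← h, ← h1, mul_assoc]
    _ ≤ _ := by
        rw [← h]
        exact mul_le_mul_of_nonneg_right h4 (by positivity)

/-- The source of max(R-2, 0) in the constant: |1-r| ≤ 1 on [0, 2], and |1-r| = r - 1 beyond. -/
lemma abs_one_sub_le {r : ℝ} (hr : 0 ≤ r) : |1 - r| ≤ 1 + max (r - 2) 0 := by
  rw [abs_le]
  constructor
  · linarith [le_max_left (r - 2) 0]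
  · linarith [le_max_right (r - 2) 0]

lemma factorial_rpow_le {r : ℝ} (hr : 0 ≤ r) {k l m n : ℕ} (h : m + n = k + l) :
    (k.factorial : ℝ) ^ (1 - r) * (l.factorial : ℝ) ^ (1 - r) ≤
      (m.factorial : ℝ) ^ (1 - r) * (n.factorial : ℝ) ^ (1 - r) *
        (2 * 2 ^ max (r - 2) 0) ^ (k + l) := by
  have hk : (0 : ℝ) < k.factorial := by exact_mod_cast k.factorial_pos
  have hl : (0 : ℝ) < l.factorial := by exact_mod_cast l.factorial_pos
  have hm : (0 : ℝ) < m.factorial := by exact_mod_cast m.factorial_pos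
  have hn : (0 : ℝ) < n.factorial := by exact_mod_cast n.factorial_pos
  have hD : (0 : ℝ) < k.factorial * l.factorial / (m.factorial * n.factorial) := by positivity
  -- The pairs (k, l) and (m, n) have the same sum, so both D and D⁻¹ are at most 2^(k+l).
  have hle := rpow_le_rpow_of_abs_le (P := 2 ^ (k + l)) hD (one_le_pow₀ (by norm_num))
    (by
      rw [div_le_iff₀ (by positivity)]
      exact factorial_mul_le h)
    (by
      rw [inv_div, div_le_iff₀ (by positivity), ← h]
      exact factorial_mul_le h.symm)
    (abs_one_sub_le hr)
  have h2 : (2 * 2 ^ max (r - 2) 0 : ℝ) ^ (k + l) = (2 ^ (k + l)) ^ (1 + max (r - 2) 0) := by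
    have : (2 * 2 ^ max (r - 2) 0 : ℝ) = 2 ^ (1 + max (r - 2) 0) := by
      rw [Real.rpow_add (by norm_num), Real.rpow_one]
    rw [this, ← Real.rpow_natCast, ← Real.rpow_mul (by norm_num), ← Real.rpow_natCast 2,
      ← Real.rpow_mul (by norm_num), mul_comm]
  rw [h2, ← Real.mul_rpow hk.le hl.le, ← Real.mul_rpow hm.le hn.le]
  rw [Real.div_rpow (by positivity) (by positivity), div_le_iff₀ (by positivity)] at hle
  rw [mul_comm]
  rw [mul_comm] at hle
  linarith

/-- The constants `1` and `1 / (2 · 8ⁿ)` in the estimates of the operators `Cₙ`. -/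
def coeffConst (n : ℕ) : ℝ := if n = 0 then 1 else 1 / (2 * 8 ^ n)

lemma coeffConst_nonneg (n : ℕ) : 0 ≤ coeffConst n := by
  rw [coeffConst]
  split_ifs <;> positivity

lemma coeffConst_le (n : ℕ) : coeffConst n ≤ (1 / 8) ^ n := by
  rw [coeffConst]
  split_ifs with h
  · simp [h]
  · rw [one_div_pow]
    exact one_div_le_one_div_of_le (by positivity) (by
      have : (0 : ℝ) < 8 ^ n := by positivity
      linarith)

/-- The origin of the 16 in the constant. The case m = 0 < n is excluded, which makes room for the
factor 1/2 in front of 8^(-n). -/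
lemma choose_mul_two_pow_le {k l m n : ℕ} (h : m + n = k + l) (hmn : n = 0 ∨ m ≠ 0) :
    (2 : ℝ) ^ m * ((l + 2 * k).choose l * (1 / 2) ^ l) ≤ coeffConst n * 16 ^ (k + l) := by
  -- From 4^l 2^(-l) = 2^l and (4/3)^(2k) = (16/9)^k ≤ 2^k.
  have h1 : ((l + 2 * k).choose l : ℝ) * (1 / 2) ^ l ≤ 4 / 3 * 2 ^ (k + l) := by
    calc ((l + 2 * k).choose l : ℝ) * (1 / 2) ^ l
        ≤ 4 ^ l * (4 / 3) ^ (2 * k + 1) * (1 / 2) ^ l :=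
          mul_le_mul_of_nonneg_right (choose_le_four_pow l (2 * k)) (by positivity)
      _ = 4 / 3 * ((16 / 9) ^ k * 2 ^ l) := by
          rw [pow_succ, pow_mul]
          have : (4 : ℝ) ^ l * (1 / 2) ^ l = 2 ^ l := by rw [← mul_pow]; norm_num
          rw [← this]
          norm_num
          ring
      _ ≤ 4 / 3 * (2 ^ k * 2 ^ l) := by gcongr; norm_num
      _ = _ := by rw [pow_add]
  rcases Nat.eq_zero_or_pos n with rfl | hn
  · rw [coeffConst, if_pos rfl, one_mul]
    -- In degree 0 the factor 4/3 cannot be absorbed, but there the claim is 1 ≤ 1.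
    rcases Nat.eq_zero_or_pos (k + l) with h0 | h0
    · obtain ⟨rfl, rfl⟩ : k = 0 ∧ l = 0 := by omega
      obtain rfl : m = 0 := by omega
      norm_num
    · rw [add_zero] at h
      subst h
      have h2 : (4 : ℝ) ≤ 4 ^ (k + l) := by
        calc (4 : ℝ) = 4 ^ 1 := by norm_num
          _ ≤ _ := pow_le_pow_right₀ (by norm_num) h0
      calc (2 : ℝ) ^ (k + l) * ((l + 2 * k).choose l * (1 / 2) ^ l)
          ≤ 2 ^ (k + l) * (4 / 3 * 2 ^ (k + l)) := by gcongr
        _ = 4 / 3 * (2 ^ (k + l) * 2 ^ (k + l)) := by ring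
        _ = 4 / 3 * 4 ^ (k + l) := by rw [← mul_pow]; norm_num
        _ ≤ 4 ^ (k + l) * 4 ^ (k + l) := by gcongr; linarith
        _ = 16 ^ (k + l) := by rw [← mul_pow]; norm_num
  · rw [coeffConst, if_neg hn.ne', one_div_mul_eq_div, le_div_iff₀ (by positivity)]
    have hm : 1 ≤ m := by omega
    -- Here m ≠ 0 is used: 8/3 ≤ 4 ≤ 4^m.
    have h2 : (4 : ℝ) ≤ 4 ^ m := by
      calc (4 : ℝ) = 4 ^ 1 := by norm_num
        _ ≤ _ := pow_le_pow_right₀ (by norm_num) hm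
    calc (2 : ℝ) ^ m * ((l + 2 * k).choose l * (1 / 2) ^ l) * (2 * 8 ^ n)
        ≤ 2 ^ m * (4 / 3 * 2 ^ (k + l)) * (2 * 8 ^ n) := by gcongr
      _ = 8 / 3 * 2 ^ m * 8 ^ n * 2 ^ (k + l) := by ring
      _ ≤ 4 ^ m * 2 ^ m * 8 ^ n * 2 ^ (k + l) := by gcongr; linarith
      _ = 8 ^ (m + n) * 2 ^ (k + l) := by rw [pow_add (8 : ℝ), ← mul_pow]; norm_num
      _ = 16 ^ (k + l) := by rw [h, ← mul_pow]; norm_num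

lemma estimateConst_coe (r : ℝ) : (estimateConst r : ℝ) = 16 * (2 * 2 ^ max (r - 2) 0) := by
  rw [estimateConst]
  push_cast
  ring

/-- Conversion from the weights w_0 and w_k to n!^r. Writing k! = k!^r k!^(1-r), and likewise for l
and m, leaves the quotient (k! l!/m!)^(1-r), which `factorial_rpow_le` bounds by n!^(1-r) times an
exponential. -/
lemma starWeight_le {r : ℝ} (hr : 0 ≤ r) {k l m n : ℕ} (h : m + n = k + l)
    (hmn : n = 0 ∨ m ≠ 0) :
    (m.factorial : ℝ) ^ r / (m.factorial * (1 / 2) ^ m) * starWeight k l ≤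
      coeffConst n * (n.factorial : ℝ) ^ (1 - r) *
        ((k.factorial : ℝ) ^ r * (estimateConst r : ℝ) ^ k) *
        ((l.factorial : ℝ) ^ r * (estimateConst r : ℝ) ^ l) := by
  have hk : (0 : ℝ) < k.factorial := by exact_mod_cast k.factorial_pos
  have hl : (0 : ℝ) < l.factorial := by exact_mod_cast l.factorial_pos
  have hm : (0 : ℝ) < m.factorial := by exact_mod_cast m.factorial_pos
  have hn : (0 : ℝ) < n.factorial := by exact_mod_cast n.factorial_pos
  have e : ∀ {a : ℝ}, 0 < a → a ^ r * a ^ (1 - r) = a := fun {a} ha => by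
    rw [← Real.rpow_add ha, add_sub_cancel, Real.rpow_one]
  have h1 := factorial_rpow_le hr h
  have h2 := choose_mul_two_pow_le h hmn
  have hsw : (starWeight k l : ℝ) = ((k.factorial : ℝ) ^ r * (k.factorial : ℝ) ^ (1 - r)) *
      (l + 2 * k).choose l * (1 / 2) ^ l *
      ((l.factorial : ℝ) ^ r * (l.factorial : ℝ) ^ (1 - r)) := by
    rw [e hk, e hl]
    simp [starWeight]
  have hem := e hm
  set M := (m.factorial : ℝ) ^ (1 - r) with hM
  have hMpos : 0 < M := Real.rpow_pos_of_pos hm _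
  have h3 : (m.factorial : ℝ) ^ r / (m.factorial * (1 / 2) ^ m) = 2 ^ m / M := by
    rw [div_eq_div_iff (by positivity) hMpos.ne', hem, one_div_pow]
    field_simp
  calc (m.factorial : ℝ) ^ r / (m.factorial * (1 / 2) ^ m) * starWeight k l
      = ((k.factorial : ℝ) ^ r * (l.factorial : ℝ) ^ r) / M *
          (2 ^ m * ((l + 2 * k).choose l * (1 / 2) ^ l)) *
          ((k.factorial : ℝ) ^ (1 - r) * (l.factorial : ℝ) ^ (1 - r)) := by
        rw [h3, hsw]
        ring
    _ ≤ ((k.factorial : ℝ) ^ r * (l.factorial : ℝ) ^ r) / M * (coeffConst n * 16 ^ (k + l)) *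
          (M * (n.factorial : ℝ) ^ (1 - r) * (2 * 2 ^ max (r - 2) 0) ^ (k + l)) := by
        have := coeffConst_nonneg n
        gcongr
    _ = coeffConst n * (n.factorial : ℝ) ^ (1 - r) *
        ((k.factorial : ℝ) ^ r * (l.factorial : ℝ) ^ r) *
          (16 ^ (k + l) * (2 * 2 ^ max (r - 2) 0) ^ (k + l)) := by
        field_simp
    _ = _ := by
        rw [← mul_pow, ← estimateConst_coe, pow_add]
        ring

end Numerics

/-! ### Estimates for the star product -/

section Estimates

variable {𝕜 : Type*} [RCLike 𝕜] {V : Type*} [AddCommGroup V] [Module 𝕜 V] {R : ℝ}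

lemma symProj_mem (m : ℕ) (x : SymR 𝕜 V R) : symProj 𝕜 V R m x ∈ homPart 𝕜 V R m :=
  ⟨_, rfl⟩

lemma weightedSym_symProj_le (φ : ℕ → ℝ≥0) (p : Seminorm 𝕜 V) (m : ℕ) (x : SymR 𝕜 V R) :
    weightedSym R φ p (symProj 𝕜 V R m x) ≤ weightedSym R φ p x := by
  refine le_weightedSym φ p ((weightedSym R φ p).comp (symProj 𝕜 V R m)) (fun n f => ?_) x
  rw [Seminorm.comp_apply, symProj_of_mem (symProd_mem_homPart f)]
  split_ifs with h
  · exact weightedSym_symProd_le φ p f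
  · rw [map_zero]
    exact mul_nonneg (NNReal.coe_nonneg _) (Finset.prod_nonneg fun _ _ => apply_nonneg _ _)

lemma symProj_zero_eq_zero {x : SymR 𝕜 V R} (h : counit 𝕜 V R x = 0) :
    symProj 𝕜 V R 0 x = 0 := by
  rw [counit, LinearMap.comp_apply, LinearMap.comp_apply, LinearEquiv.coe_coe,
    LinearEquiv.map_eq_zero_iff, Submodule.subtype_apply, Submodule.coe_eq_zero] at h
  rw [symProj, LinearMap.comp_apply, h, map_zero]

lemma counit_symProd_of_ne_zero {k : ℕ} (hk : k ≠ 0) (f : Fin k → V) :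
    counit 𝕜 V R (symProd 𝕜 V R k f) = 0 := by
  obtain ⟨k, rfl⟩ := Nat.exists_eq_succ_of_ne_zero hk
  exact counit_of_mem (symProd_mem_homPart f)

lemma prod_smul_seminorm (c : ℝ≥0) (q : Seminorm 𝕜 V) {k : ℕ} (f : Fin k → V) :
    ∏ i, (c • q) (f i) = (c : ℝ) ^ k * ∏ i, q (f i) := by
  simp only [_root_.smul_apply, NNReal.smul_def, smul_eq_mul]
  rw [Finset.prod_mul_distrib, Finset.prod_const, Finset.card_univ, Fintype.card_fin]

lemma factorialWeight_coe (R : ℝ) (n : ℕ) :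
    (factorialWeight R n : ℝ) = (n.factorial : ℝ) ^ R := by
  simp [factorialWeight]

variable {𝔤 : Type*} [LieRing 𝔤] [LieAlgebra 𝕜 𝔤]

lemma starCoeff_symProd (n k l : ℕ) (f : Fin k → 𝔤) (g : Fin l → 𝔤) :
    starCoeff 𝕜 𝔤 R n (symProd 𝕜 𝔤 R k f) (symProd 𝕜 𝔤 R l g) =
      if n ≤ k + l then symProj 𝕜 𝔤 R (k + l - n)
        (starOp 𝕜 𝔤 R 1 (symProd 𝕜 𝔤 R k f) (symProd 𝕜 𝔤 R l g)) else 0 := by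
  rw [symProd_apply, symProd_apply, starCoeff_symOf]

lemma guttStar_symProd (z : 𝕜) (k l : ℕ) (f : Fin k → 𝔤) (g : Fin l → 𝔤) :
    guttStar 𝕜 𝔤 R z (symProd 𝕜 𝔤 R k f) (symProd 𝕜 𝔤 R l g) =
      ∑ n ∈ Finset.range (k + l + 1),
        z ^ n • starCoeff 𝕜 𝔤 R n (symProd 𝕜 𝔤 R k f) (symProd 𝕜 𝔤 R l g) := by
  rw [symProd_apply, symProd_apply, guttStar_symOf_eq_sum]

/-- The main estimate, on symmetric products. It is proved for the submultiplicative s between p and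
q, so that no iterated brackets remain to be estimated. -/
lemma starCoeff_symProd_le (hR : 0 ≤ R) {p q : Seminorm 𝕜 𝔤} (hpq : IsAsymptoticEstimate p q)
    (n k l : ℕ) (f : Fin k → 𝔤) (g : Fin l → 𝔤) :
    symSeminormR R p (starCoeff 𝕜 𝔤 R n (symProd 𝕜 𝔤 R k f) (symProd 𝕜 𝔤 R l g)) ≤
      coeffConst n * (n.factorial : ℝ) ^ (1 - R) *
        (factorialWeight R k * ∏ i, (estimateConst R • q) (f i)) *
        (factorialWeight R l * ∏ i, (estimateConst R • q) (g i)) := by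
  have hpos : 0 ≤ coeffConst n * (n.factorial : ℝ) ^ (1 - R) *
        (factorialWeight R k * ∏ i, (estimateConst R • q) (f i)) *
        (factorialWeight R l * ∏ i, (estimateConst R • q) (g i)) := by
    have h := coeffConst_nonneg n
    have hf : 0 ≤ ∏ i, (estimateConst R • q) (f i) :=
      Finset.prod_nonneg fun _ _ => apply_nonneg _ _
    have hg : 0 ≤ ∏ i, (estimateConst R • q) (g i) :=
      Finset.prod_nonneg fun _ _ => apply_nonneg _ _
    positivity
  rw [starCoeff_symProd]
  split_ifs with hn
  swap
  · rw [map_zero]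
    exact hpos
  obtain ⟨m, hm⟩ := Nat.exists_eq_add_of_le hn
  rw [show k + l - n = m by omega]
  -- In the excluded case m = 0 < n, the degree-0 part of the product is the product of the counits,
  -- which is 0 because k + l > 0.
  by_cases hmn : n = 0 ∨ m ≠ 0
  swap
  · obtain ⟨h1, h2⟩ := not_or.1 hmn
    obtain rfl : m = 0 := not_not.1 h2
    rw [symProj_zero_eq_zero, map_zero]
    · exact hpos
    · rw [counit_starOp]
      rcases Nat.eq_zero_or_pos k with hk | hk
      · rw [counit_symProd_of_ne_zero (k := l) (by omega), mul_zero]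
      · rw [counit_symProd_of_ne_zero hk.ne', zero_mul]
  set s := wordSeminorm q with hs
  set Y := starOp 𝕜 𝔤 R 1 (symProd 𝕜 𝔤 R k f) (symProd 𝕜 𝔤 R l g) with hY
  have hsl := wordSeminorm_lie_le q
  have h1 : weightedSym R (starWeight 0) s (symProj 𝕜 𝔤 R m Y) ≤
      (∏ i, s (f i)) * (starWeight k l * ∏ i, s (g i)) :=
    (weightedSym_symProj_le _ _ _ _).trans
      ((weightedSym_starOp_symProd_le s hsl f _).trans
        (mul_le_mul_of_nonneg_left (weightedSym_symProd_le _ _ _)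
          (Finset.prod_nonneg fun _ _ => apply_nonneg _ _)))
  have hm0 : (m.factorial : ℝ≥0) ≠ 0 := by exact_mod_cast m.factorial_ne_zero
  rw [symSeminormR_eq]
  refine (weightedSym_mono le_rfl hpq.le_wordSeminorm _).trans ?_
  -- The projection lies in the single degree m, where `starWeight 0` is m!/2^m.
  rw [weightedSym_smul_weight s (φ := starWeight 0)
    (c := factorialWeight R m / (m.factorial * (1 / 2) ^ m)) ?_ (symProj_mem m Y)]
  swap
  · have : starWeight 0 m = m.factorial * (1 / 2) ^ m := by
      simp [starWeight, mul_comm]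
    rw [this, div_mul_cancel₀]
    exact mul_ne_zero hm0 (by positivity)
  refine (mul_le_mul_of_nonneg_left h1 (NNReal.coe_nonneg _)).trans ?_
  have h2 := starWeight_le hR (show m + n = k + l by omega) hmn
  rw [prod_smul_seminorm, prod_smul_seminorm]
  push_cast
  rw [factorialWeight_coe, factorialWeight_coe, factorialWeight_coe]
  have hf : ∏ i, s (f i) ≤ ∏ i, q (f i) :=
    Finset.prod_le_prod (fun _ _ => apply_nonneg _ _) fun i _ => wordSeminorm_le q _
  have hg : ∏ i, s (g i) ≤ ∏ i, q (g i) :=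
    Finset.prod_le_prod (fun _ _ => apply_nonneg _ _) fun i _ => wordSeminorm_le q _
  have hf0 : 0 ≤ ∏ i, s (f i) := Finset.prod_nonneg fun _ _ => apply_nonneg _ _
  have hg0 : 0 ≤ ∏ i, s (g i) := Finset.prod_nonneg fun _ _ => apply_nonneg _ _
  calc _ = ((m.factorial : ℝ) ^ R / (m.factorial * (1 / 2) ^ m) * starWeight k l) *
        ((∏ i, s (f i)) * ∏ i, s (g i)) := by ring
    _ ≤ (coeffConst n * (n.factorial : ℝ) ^ (1 - R) *
        ((k.factorial : ℝ) ^ R * (estimateConst R : ℝ) ^ k) *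
        ((l.factorial : ℝ) ^ R * (estimateConst R : ℝ) ^ l)) *
        ((∏ i, q (f i)) * ∏ i, q (g i)) :=
        mul_le_mul h2 (mul_le_mul hf hg hg0 (hf0.trans hf)) (mul_nonneg hf0 hg0)
          ((by positivity : (0 : ℝ) ≤ _).trans h2)
    _ = _ := by ring

/-- Bilinear maps on `Sym(V)` are estimated on pairs of symmetric products. -/
lemma bilin_le_tensorSeminormR {W : Type*} [AddCommGroup W] [Module 𝕜 W]
    (B : SymR 𝕜 V R →ₗ[𝕜] SymR 𝕜 V R →ₗ[𝕜] W) (r : Seminorm 𝕜 W) (q : Seminorm 𝕜 V) {C : ℝ}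
    (hC : 0 ≤ C) (h : ∀ k l (f : Fin k → V) (g : Fin l → V),
      r (B (symProd 𝕜 V R k f) (symProd 𝕜 V R l g)) ≤
      C * (factorialWeight R k * ∏ i, q (f i)) * (factorialWeight R l * ∏ i, q (g i)))
    (x y : TensorAlg 𝕜 V) :
    r (B (symmetrize 𝕜 V R x) (symmetrize 𝕜 V R y)) ≤
      C * tensorSeminormR R q x * tensorSeminormR R q y := by
  rw [tensorSeminormR_eq]
  exact bilin_le_weightedSeminorm (B.compl₁₂ (symmetrize 𝕜 V R) (symmetrize 𝕜 V R)) r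
    (factorialWeight R) (factorialWeight R) q q hC h x y

lemma bilin_le_symSeminormR {W : Type*} [AddCommGroup W] [Module 𝕜 W]
    (B : SymR 𝕜 V R →ₗ[𝕜] SymR 𝕜 V R →ₗ[𝕜] W) (r : Seminorm 𝕜 W) (q : Seminorm 𝕜 V) {C : ℝ}
    (hC : 0 ≤ C) (h : ∀ k l (f : Fin k → V) (g : Fin l → V),
      r (B (symProd 𝕜 V R k f) (symProd 𝕜 V R l g)) ≤
      C * (factorialWeight R k * ∏ i, q (f i)) * (factorialWeight R l * ∏ i, q (g i)))
    (x y : SymR 𝕜 V R) :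
    r (B x y) ≤ C * symSeminormR R q x * symSeminormR R q y := by
  have := bilin_le_tensorSeminormR B r q hC h (symIncl 𝕜 V R x) (symIncl 𝕜 V R y)
  rwa [symmetrize_symIncl, symmetrize_symIncl] at this

lemma starCoeff_le (hR : 0 ≤ R) {p q : Seminorm 𝕜 𝔤} (hpq : IsAsymptoticEstimate p q) (n : ℕ)
    (x y : TensorAlg 𝕜 𝔤) :
    symSeminormR R p (starCoeff 𝕜 𝔤 R n (symmetrize 𝕜 𝔤 R x) (symmetrize 𝕜 𝔤 R y)) ≤
      coeffConst n * (n.factorial : ℝ) ^ (1 - R) *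
        tensorSeminormR R (estimateConst R • q) x * tensorSeminormR R (estimateConst R • q) y :=
  bilin_le_tensorSeminormR (starCoeff 𝕜 𝔤 R n) (symSeminormR R p) (estimateConst R • q)
    (mul_nonneg (coeffConst_nonneg n) (by positivity)) (starCoeff_symProd_le hR hpq n) x y

/-- This is where R ≥ 1 enters: for R < 1 the factor n!^(1-R) would outgrow 8^n. -/
lemma coeffConst_mul_factorial_le (hR : 1 ≤ R) (n : ℕ) :
    coeffConst n * (n.factorial : ℝ) ^ (1 - R) ≤ (1 / 8) ^ n := by
  have h1 : (n.factorial : ℝ) ^ (1 - R) ≤ 1 :=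
    Real.rpow_le_one_of_one_le_of_nonpos (by exact_mod_cast n.factorial_pos) (by linarith)
  exact (mul_le_of_le_one_right (coeffConst_nonneg n) h1).trans (coeffConst_le n)

lemma zpow_starCoeff_symProd_le (hR : 1 ≤ R) {p q : Seminorm 𝕜 𝔤}
    (hpq : IsAsymptoticEstimate p q) (z : 𝕜) (n k l : ℕ) (f : Fin k → 𝔤) (g : Fin l → 𝔤) :
    symSeminormR R p (z ^ n • starCoeff 𝕜 𝔤 R n (symProd 𝕜 𝔤 R k f) (symProd 𝕜 𝔤 R l g)) ≤
      (‖z‖ ^ n * (1 / 8) ^ n) *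
        (factorialWeight R k * ∏ i, (estimateConst R • q) (f i)) *
        (factorialWeight R l * ∏ i, (estimateConst R • q) (g i)) := by
  rw [map_smul_eq_mul, norm_pow]
  refine (mul_le_mul_of_nonneg_left (starCoeff_symProd_le (by linarith) hpq n k l f g)
    (by positivity)).trans ?_
  have hf : 0 ≤ ∏ i, (estimateConst R • q) (f i) := Finset.prod_nonneg fun _ _ => apply_nonneg _ _
  have hg : 0 ≤ ∏ i, (estimateConst R • q) (g i) := Finset.prod_nonneg fun _ _ => apply_nonneg _ _
  have := coeffConst_mul_factorial_le hR n
  calc _ = ‖z‖ ^ n * (coeffConst n * (n.factorial : ℝ) ^ (1 - R)) *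
        (factorialWeight R k * ∏ i, (estimateConst R • q) (f i)) *
        (factorialWeight R l * ∏ i, (estimateConst R • q) (g i)) := by ring
    _ ≤ _ := by gcongr

lemma estimateConst_mul_prod (z : 𝕜) (q : Seminorm 𝕜 V) {k : ℕ} (f : Fin k → V) :
    ∏ i, ((estimateConst R * (‖z‖₊ + 1)) • q) (f i) =
      (‖z‖ + 1) ^ k * ∏ i, (estimateConst R • q) (f i) := by
  rw [prod_smul_seminorm, prod_smul_seminorm]
  push_cast
  rw [mul_pow]
  ring

/-- The factor (|z|+1)^(k+l) is absorbed by rescaling q. The index set F and the constant C are left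
free to cover the whole product, a single term and the tail of the series. -/
lemma sum_zpow_starCoeff_symProd_le (hR : 1 ≤ R) {p q : Seminorm 𝕜 𝔤}
    (hpq : IsAsymptoticEstimate p q) (z : 𝕜) (k l : ℕ) (f : Fin k → 𝔤) (g : Fin l → 𝔤)
    (F : Finset ℕ) {C : ℝ} (hC : ∑ n ∈ F, ‖z‖ ^ n * (1 / 8) ^ n ≤ C * (‖z‖ + 1) ^ (k + l)) :
    symSeminormR R p (∑ n ∈ F,
      z ^ n • starCoeff 𝕜 𝔤 R n (symProd 𝕜 𝔤 R k f) (symProd 𝕜 𝔤 R l g)) ≤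
      C * (factorialWeight R k * ∏ i, ((estimateConst R * (‖z‖₊ + 1)) • q) (f i)) *
        (factorialWeight R l * ∏ i, ((estimateConst R * (‖z‖₊ + 1)) • q) (g i)) := by
  refine (seminorm_sum_le _ _ _).trans
    ((Finset.sum_le_sum fun n _ => zpow_starCoeff_symProd_le hR hpq z n k l f g).trans ?_)
  have hf : 0 ≤ ∏ i, (estimateConst R • q) (f i) := Finset.prod_nonneg fun _ _ => apply_nonneg _ _
  have hg : 0 ≤ ∏ i, (estimateConst R • q) (g i) := Finset.prod_nonneg fun _ _ => apply_nonneg _ _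
  rw [← Finset.sum_mul, ← Finset.sum_mul, estimateConst_mul_prod, estimateConst_mul_prod]
  calc _ ≤ C * (‖z‖ + 1) ^ (k + l) * (factorialWeight R k * ∏ i, (estimateConst R • q) (f i)) *
        (factorialWeight R l * ∏ i, (estimateConst R • q) (g i)) := by gcongr
    _ = _ := by rw [pow_add]; ring

lemma guttStar_symProd_le (hR : 1 ≤ R) {p q : Seminorm 𝕜 𝔤} (hpq : IsAsymptoticEstimate p q)
    (z : 𝕜) (k l : ℕ) (f : Fin k → 𝔤) (g : Fin l → 𝔤) :
    symSeminormR R p (guttStar 𝕜 𝔤 R z (symProd 𝕜 𝔤 R k f) (symProd 𝕜 𝔤 R l g)) ≤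
      1 * (factorialWeight R k * ∏ i, ((estimateConst R * (‖z‖₊ + 1)) • q) (f i)) *
        (factorialWeight R l * ∏ i, ((estimateConst R * (‖z‖₊ + 1)) • q) (g i)) := by
  rw [guttStar_symProd]
  refine sum_zpow_starCoeff_symProd_le hR hpq z k l f g _ ?_
  -- ∑ |z|^n 8^(-n) is dominated termwise by the binomial expansion of (|z|+1)^(k+l).
  rw [one_mul, add_pow]
  refine Finset.sum_le_sum fun n hn => ?_
  have hn : n ≤ k + l := by simpa [Nat.lt_succ_iff] using hn
  rw [one_pow, mul_one]
  refine mul_le_mul_of_nonneg_left ?_ (by positivity)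
  have h1 : (1 : ℝ) ≤ (k + l).choose n := by exact_mod_cast Nat.choose_pos hn
  exact (pow_le_one₀ (by norm_num) (by norm_num)).trans h1

lemma guttStar_le (hR : 1 ≤ R) {p q : Seminorm 𝕜 𝔤} (hpq : IsAsymptoticEstimate p q) (z : 𝕜)
    (x y : TensorAlg 𝕜 𝔤) :
    symSeminormR R p (guttStar 𝕜 𝔤 R z (symmetrize 𝕜 𝔤 R x) (symmetrize 𝕜 𝔤 R y)) ≤
      tensorSeminormR R ((estimateConst R * (‖z‖₊ + 1)) • q) x *
        tensorSeminormR R ((estimateConst R * (‖z‖₊ + 1)) • q) y := by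
  have := bilin_le_tensorSeminormR (guttStar 𝕜 𝔤 R z) (symSeminormR R p)
    ((estimateConst R * (‖z‖₊ + 1)) • q) zero_le_one (guttStar_symProd_le hR hpq z) x y
  rwa [one_mul] at this

lemma sum_norm_pow_le (z : 𝕜) {N : ℕ} (F : Finset ℕ) (hF : ∀ n ∈ F, n ≤ N) :
    ∑ n ∈ F, ‖z‖ ^ n * (1 / 8 : ℝ) ^ n ≤ (∑ n ∈ F, (1 / 8 : ℝ) ^ n) * (‖z‖ + 1) ^ N := by
  rw [Finset.sum_mul]
  refine Finset.sum_le_sum fun n hn => ?_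
  rw [mul_comm]
  refine mul_le_mul_of_nonneg_left ?_ (by positivity)
  have h0 := norm_nonneg z
  exact (pow_le_pow_left₀ h0 (by linarith) n).trans
    (pow_le_pow_right₀ (by linarith) (hF n hn))

lemma zpow_starCoeff_le (hR : 1 ≤ R) {p q : Seminorm 𝕜 𝔤} (hpq : IsAsymptoticEstimate p q)
    (z : 𝕜) (n : ℕ) (x y : SymR 𝕜 𝔤 R) :
    symSeminormR R p (z ^ n • starCoeff 𝕜 𝔤 R n x y) ≤
      (1 / 8) ^ n * symSeminormR R ((estimateConst R * (‖z‖₊ + 1)) • q) x *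
        symSeminormR R ((estimateConst R * (‖z‖₊ + 1)) • q) y := by
  refine bilin_le_symSeminormR (z ^ n • starCoeff 𝕜 𝔤 R n) (symSeminormR R p)
    ((estimateConst R * (‖z‖₊ + 1)) • q) (by positivity) (fun k l f g => ?_) x y
  rw [LinearMap.smul_apply, LinearMap.smul_apply]
  by_cases hn : n ≤ k + l
  · have := sum_zpow_starCoeff_symProd_le hR hpq z k l f g {n} (C := (1 / 8) ^ n) (by
      simpa using sum_norm_pow_le z (N := k + l) {n} (by simpa using hn))
    rwa [Finset.sum_singleton] at this
  · rw [starCoeff_symProd, if_neg hn, smul_zero, map_zero]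
    have hf : 0 ≤ ∏ i, ((estimateConst R * (‖z‖₊ + 1)) • q) (f i) :=
      Finset.prod_nonneg fun _ _ => apply_nonneg _ _
    have hg : 0 ≤ ∏ i, ((estimateConst R * (‖z‖₊ + 1)) • q) (g i) :=
      Finset.prod_nonneg fun _ _ => apply_nonneg _ _
    positivity

/-- A tail bound uniform in the degrees k and l, although for fixed degrees the sum is finite. The
uniformity is what makes the series converge on the completion. -/
lemma guttStar_sub_sum_le (hR : 1 ≤ R) {p q : Seminorm 𝕜 𝔤} (hpq : IsAsymptoticEstimate p q)
    (z : 𝕜) (F : Finset ℕ) (x y : SymR 𝕜 𝔤 R) :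
    symSeminormR R p (guttStar 𝕜 𝔤 R z x y - ∑ n ∈ F, z ^ n • starCoeff 𝕜 𝔤 R n x y) ≤
      (∑' n : {n // n ∉ F}, (1 / 8 : ℝ) ^ (n : ℕ)) *
        symSeminormR R ((estimateConst R * (‖z‖₊ + 1)) • q) x *
        symSeminormR R ((estimateConst R * (‖z‖₊ + 1)) • q) y := by
  have hsum : Summable fun n : ℕ => (1 / 8 : ℝ) ^ n :=
    summable_geometric_of_lt_one (by norm_num) (by norm_num)
  have h := bilin_le_symSeminormR
    (guttStar 𝕜 𝔤 R z - ∑ n ∈ F, z ^ n • starCoeff 𝕜 𝔤 R n) (symSeminormR R p)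
    ((estimateConst R * (‖z‖₊ + 1)) • q) (C := ∑' n : {n // n ∉ F}, (1 / 8 : ℝ) ^ (n : ℕ))
    (tsum_nonneg fun _ => by positivity) (fun k l f g => ?_) x y
  · simpa only [LinearMap.sub_apply, LinearMap.sum_apply, LinearMap.smul_apply] using h
  · simp only [LinearMap.sub_apply, LinearMap.sum_apply, LinearMap.smul_apply]
    -- Terms with n > k + l vanish, so F may be cut down to the range of the finite sum.
    have hF : ∑ n ∈ F, z ^ n • starCoeff 𝕜 𝔤 R n (symProd 𝕜 𝔤 R k f) (symProd 𝕜 𝔤 R l g) =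
        ∑ n ∈ Finset.range (k + l + 1) ∩ F,
          z ^ n • starCoeff 𝕜 𝔤 R n (symProd 𝕜 𝔤 R k f) (symProd 𝕜 𝔤 R l g) := by
      refine (Finset.sum_subset Finset.inter_subset_right fun n hn hn' => ?_).symm
      rw [starCoeff_symProd, if_neg, smul_zero]
      intro hle
      exact hn' (Finset.mem_inter.2 ⟨Finset.mem_range.2 (by omega), hn⟩)
    rw [guttStar_symProd, hF, ← Finset.sum_sdiff_eq_sub Finset.inter_subset_left]
    refine sum_zpow_starCoeff_symProd_le hR hpq z k l f g _ ((sum_norm_pow_le z (N := k + l) _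
      fun n hn => ?_).trans (mul_le_mul_of_nonneg_right ?_ (by positivity)))
    · have := Finset.mem_range.1 (Finset.mem_sdiff.1 hn).1
      omega
    · rw [← Finset.sum_subtype_of_mem (p := fun n => n ∉ F) (fun n : ℕ => (1 / 8 : ℝ) ^ n)
        (fun n hn hF => by
          rw [Finset.mem_sdiff, Finset.mem_inter] at hn
          exact hn.2 ⟨hn.1, hF⟩)]
      exact (hsum.subtype _).sum_le_tsum _ fun _ _ => by positivity

end Estimates

/-! ### Continuous seminorms -/

section ContinuousSeminorm

variable {𝕜 : Type*} [RCLike 𝕜] {E : Type*} [AddCommGroup E] [Module 𝕜 E] [TopologicalSpace E]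

lemma continuous_smul_seminorm {p : Seminorm 𝕜 E} (hp : Continuous p) (c : ℝ≥0) :
    Continuous (c • p : Seminorm 𝕜 E) := by
  have : ((c • p : Seminorm 𝕜 E) : E → ℝ) = fun x => (c : ℝ) * p x := rfl
  rw [this]
  exact continuous_const.mul hp

lemma continuous_sup_seminorm {p q : Seminorm 𝕜 E} (hp : Continuous p) (hq : Continuous q) :
    Continuous (p ⊔ q : Seminorm 𝕜 E) := by
  have : ((p ⊔ q : Seminorm 𝕜 E) : E → ℝ) = fun x => p x ⊔ q x := rfl
  rw [this]
  exact hp.sup hq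

end ContinuousSeminorm

/-! ### Continuity criteria -/

section Criteria

open Filter Topology

variable {𝕜 : Type*} [RCLike 𝕜] {E F G : Type*}
  [AddCommGroup E] [Module 𝕜 E] [TopologicalSpace E] [IsTopologicalAddGroup E]
  [AddCommGroup F] [Module 𝕜 F] [TopologicalSpace F] [IsTopologicalAddGroup F]
  [AddCommGroup G] [Module 𝕜 G] [TopologicalSpace G]

lemma continuousAt_of_bound {ι X : Type*} [TopologicalSpace X]
    {Q : SeminormFamily 𝕜 G ι} (hQ : WithSeminorms Q) {u : X → G} {x₀ : X} (h0 : u x₀ = 0)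
    (hu : ∀ i, ∃ g : X → ℝ, Continuous g ∧ g x₀ = 0 ∧ ∀ x, Q i (u x) ≤ g x) :
    ContinuousAt u x₀ := by
  rw [ContinuousAt, h0, hQ.tendsto_nhds]
  intro i ε hε
  obtain ⟨g, hg, hg0, hle⟩ := hu i
  have : ∀ᶠ x in 𝓝 x₀, g x < ε := hg.continuousAt.eventually_lt continuousAt_const
    (by rw [hg0]; exact hε)
  filter_upwards [this] with x hx
  rw [sub_zero]
  exact (hle x).trans_lt hx

lemma continuous_bilin_of_bound {ι : Type*} {Q : SeminormFamily 𝕜 G ι} (hQ : WithSeminorms Q)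
    (B : E →ₗ[𝕜] F →ₗ[𝕜] G) (h : ∀ i, ∃ p : Seminorm 𝕜 E, ∃ q : Seminorm 𝕜 F,
      Continuous p ∧ Continuous q ∧ ∀ x y, Q i (B x y) ≤ p x * q y) :
    Continuous fun t : E × F => B t.1 t.2 := by
  have := hQ.topologicalAddGroup
  let f : E →+ F →+ G := AddMonoidHom.mk' (fun x => (B x).toAddMonoidHom) (by
    intro x y; ext z; simp)
  refine continuous_of_continuousAt_zero₂ f ?_ ?_ ?_
  · refine continuousAt_of_bound hQ (u := fun t : E × F => B t.1 t.2) (by simp) fun i => ?_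
    obtain ⟨p, q, hp, hq, hpq⟩ := h i
    exact ⟨fun t => p t.1 * q t.2, (hp.comp continuous_fst).mul (hq.comp continuous_snd), by simp,
      fun t => hpq _ _⟩
  · intro x
    refine continuousAt_of_bound hQ (u := fun y : F => B x y) (by simp) fun i => ?_
    obtain ⟨p, q, hp, hq, hpq⟩ := h i
    exact ⟨fun y => p x * q y, continuous_const.mul hq, by simp, fun y => hpq _ _⟩
  · intro y
    refine continuousAt_of_bound hQ (u := fun x : E => B x y) (by simp) fun i => ?_
    obtain ⟨p, q, hp, hq, hpq⟩ := h i
    exact ⟨fun x => p x * q y, hp.mul continuous_const, by simp, fun x => hpq _ _⟩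

/-- Bilinear maps such that every continuous seminorm of the values is bounded by a product of
continuous seminorms of the arguments. -/
def IsBoundedBilin (B : E →ₗ[𝕜] F →ₗ[𝕜] G) : Prop :=
  ∀ r : Seminorm 𝕜 G, Continuous r → ∃ p : Seminorm 𝕜 E, ∃ q : Seminorm 𝕜 F,
    Continuous p ∧ Continuous q ∧ ∀ x y, r (B x y) ≤ p x * q y

/-- Bounds by products of seminorms are used below in place of continuity because they can be
transported directly to completions and projective tensor products. -/
lemma IsBoundedBilin.continuous [PolynormableSpace 𝕜 G] {B : E →ₗ[𝕜] F →ₗ[𝕜] G}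
    (hB : IsBoundedBilin B) : Continuous fun t : E × F => B t.1 t.2 :=
  continuous_bilin_of_bound (PolynormableSpace.withSeminorms 𝕜 G) B fun i => hB i.1 i.2

lemma continuous_of_bound {ι : Type*} {Q : SeminormFamily 𝕜 G ι} (hQ : WithSeminorms Q)
    (f : E →ₗ[𝕜] G)
    (h : ∀ i, ∃ p : Seminorm 𝕜 E, Continuous p ∧ ∀ x, Q i (f x) ≤ p x) : Continuous f :=
  hQ.continuous_of_continuous_comp f fun i => by
    obtain ⟨p, hp, hle⟩ := h i
    exact Seminorm.continuous_of_le hp hle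

/-- Directedness replaces the finite supremum in the usual criterion by a single member of the
family. -/
lemma bound_of_directed {ι : Type*} [Nonempty ι] {P : SeminormFamily 𝕜 E ι}
    (hP : WithSeminorms P) (hdir : ∀ i j, ∃ k, P i ≤ P k ∧ P j ≤ P k) (r : Seminorm 𝕜 E)
    (hr : Continuous r) : ∃ i, ∃ C : ℝ≥0, r ≤ C • P i := by
  classical
  obtain ⟨s, C, -, hC⟩ := Seminorm.bound_of_continuous hP r hr
  suffices h : ∃ i, s.sup P ≤ P i by
    obtain ⟨i, hi⟩ := h
    refine ⟨i, C, hC.trans fun x => ?_⟩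
    exact mul_le_mul_of_nonneg_left (hi x) (NNReal.coe_nonneg C)
  clear hC
  induction s using Finset.induction_on with
  | empty => exact ⟨Classical.arbitrary ι, by rw [Finset.sup_empty]; exact bot_le⟩
  | insert a s _ ih =>
    obtain ⟨i, hi⟩ := ih
    obtain ⟨k, h1, h2⟩ := hdir a i
    exact ⟨k, by
      rw [Finset.sup_insert]
      exact sup_le h1 (hi.trans h2)⟩

end Criteria

/-! ### Completions of locally convex spaces -/

section Completion

open Filter Topology

variable {𝕜 : Type*} [RCLike 𝕜] {E F G : Type*}
  [AddCommGroup E] [Module 𝕜 E] [UniformSpace E] [IsUniformAddGroup E]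
  [UniformContinuousConstSMul 𝕜 E]
  [AddCommGroup F] [Module 𝕜 F] [UniformSpace F] [IsUniformAddGroup F]
  [UniformContinuousConstSMul 𝕜 F]
  [AddCommGroup G] [Module 𝕜 G] [UniformSpace G] [IsUniformAddGroup G]
  [UniformContinuousConstSMul 𝕜 G]

lemma extension_seminorm_coe {p : Seminorm 𝕜 E} (hp : Continuous p) (x : E) :
    Completion.extension p (x : Completion E) = p x :=
  Completion.extension_coe
    (Seminorm.uniformContinuous_of_continuousAt_zero hp.continuousAt) x

/-- The extension of a continuous seminorm to the completion. -/
def hatSeminorm (p : Seminorm 𝕜 E) (hp : Continuous p) : Seminorm 𝕜 (Completion E) :=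
  Seminorm.of (Completion.extension p)
    (fun x y => by
      have hc : Continuous (Completion.extension p) := Completion.continuous_extension
      refine Completion.induction_on₂ x y (isClosed_le (hc.comp continuous_add)
        ((hc.comp continuous_fst).add (hc.comp continuous_snd))) fun a b => ?_
      rw [← Completion.coe_add, extension_seminorm_coe hp, extension_seminorm_coe hp,
        extension_seminorm_coe hp]
      exact map_add_le_add p a b)
    (fun c x => by
      have hc : Continuous (Completion.extension p) := Completion.continuous_extension
      refine Completion.induction_on x (isClosed_eq (hc.comp (continuous_const_smul c))
        (continuous_const.mul hc)) fun a => ?_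
      rw [← Completion.coe_smul, extension_seminorm_coe hp, extension_seminorm_coe hp,
        map_smul_eq_mul])

lemma hatSeminorm_coe (p : Seminorm 𝕜 E) (hp : Continuous p) (x : E) :
    hatSeminorm p hp (x : Completion E) = p x := extension_seminorm_coe hp x

lemma continuous_hatSeminorm (p : Seminorm 𝕜 E) (hp : Continuous p) :
    Continuous (hatSeminorm p hp) := Completion.continuous_extension

lemma continuous_toHat : Continuous (toHat 𝕜 E) := Completion.continuous_coe E

lemma toHat_apply (x : E) : toHat 𝕜 E x = (x : Completion E) := rfl

lemma continuous_comp_toHat {r : Seminorm 𝕜 (Completion E)} (hr : Continuous r) :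
    Continuous (r.comp (toHat 𝕜 E)) := hr.comp continuous_toHat

/-- The completion of a locally convex space is locally convex. -/
lemma polynormableSpace_completion [PolynormableSpace 𝕜 E] :
    PolynormableSpace 𝕜 (Completion E) := by
  let P : SeminormFamily 𝕜 (Completion E) {p : Seminorm 𝕜 E // Continuous p} :=
    fun p => hatSeminorm p.1 p.2
  suffices h : WithSeminorms P from h.toPolynormableSpace
  have : Nonempty {p : Seminorm 𝕜 E // Continuous p} := inferInstance
  rw [SeminormFamily.withSeminorms_iff_nhds_eq_iInf]
  refine le_antisymm ?_ fun U hU => ?_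
  · simp_rw [le_iInf_iff, ← tendsto_iff_comap]
    exact fun p => (continuous_hatSeminorm p.1 p.2).tendsto' 0 0 (map_zero _)
  -- By regularity U contains a closed neighbourhood V, whose trace on E contains a ball of some
  -- continuous seminorm p.
  · obtain ⟨V, hV, hVc, hVU⟩ := exists_mem_nhds_isClosed_subset hU
    have hV' : (fun x : E => (x : Completion E)) ⁻¹' V ∈ 𝓝 (0 : E) :=
      (Completion.continuous_coe E).continuousAt.preimage_mem_nhds (by
        rw [Completion.coe_zero]; exact hV)
    obtain ⟨⟨s, ε⟩, hε, hs⟩ := (PolynormableSpace.withSeminorms 𝕜 E).hasBasis_zero_ball.mem_iff.1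
      hV'
    dsimp only at hε hs
    set p : Seminorm 𝕜 E := s.sup fun p : {p : Seminorm 𝕜 E // Continuous p} => p.1 with hp
    have hpc : Continuous p := Seminorm.continuous_finsetSup fun i _ => i.2
    -- The ball of the extended seminorm is open, hence lies in the closure of its intersection with
    -- the dense subspace E, and V is closed.
    have hball : {x : Completion E | hatSeminorm p hpc x < ε} ⊆ V := by
      have ho : IsOpen {x : Completion E | hatSeminorm p hpc x < ε} :=
        isOpen_lt (continuous_hatSeminorm p hpc) continuous_const
      have hd := Completion.denseRange_coe (α := E)
      intro x hx
      have h1 := hd.open_subset_closure_inter ho hx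
      refine hVc.closure_subset_iff.2 ?_ h1
      rintro _ ⟨hy, y, rfl⟩
      refine hs ?_
      rw [Seminorm.mem_ball_zero]
      have hy : hatSeminorm p hpc (y : Completion E) < ε := hy
      rwa [hatSeminorm_coe] at hy
    refine mem_iInf_of_mem (⟨p, hpc⟩ : {p : Seminorm 𝕜 E // Continuous p}) ?_
    refine ⟨Set.Iio ε, Iio_mem_nhds hε, fun x hx => hVU (hball ?_)⟩
    exact hx

variable [T0Space G] [CompleteSpace G]

lemma extendLin_coe {f : E →ₗ[𝕜] G} (hf : Continuous f) (x : E) :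
    extendLin f (x : Completion E) = f x := by
  rw [extendLin, dif_pos hf]
  exact ContinuousLinearMap.fromCompletion_apply_coe _ x

lemma extendBilin_coe {B : E →ₗ[𝕜] F →ₗ[𝕜] G} (hB : Continuous fun t : E × F => B t.1 t.2)
    (x : E) (y : F) : extendBilin B (x : Completion E) (y : Completion F) = B x y := by
  rw [extendBilin, dif_pos hB]
  exact extendBilinFun_coe B hB x y

lemma continuous_extendBilin {B : E →ₗ[𝕜] F →ₗ[𝕜] G}
    (hB : Continuous fun t : E × F => B t.1 t.2) :
    Continuous fun t : Completion E × Completion F => extendBilin B t.1 t.2 := by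
  rw [extendBilin, dif_pos hB]
  exact continuous_extendBilinFun B hB

lemma extendBilin_le {B : E →ₗ[𝕜] F →ₗ[𝕜] G} (hB : Continuous fun t : E × F => B t.1 t.2)
    {r : Seminorm 𝕜 G} (hr : Continuous r) {p : Seminorm 𝕜 E} {q : Seminorm 𝕜 F}
    (hp : Continuous p) (hq : Continuous q) (h : ∀ x y, r (B x y) ≤ p x * q y)
    (x : Completion E) (y : Completion F) :
    r (extendBilin B x y) ≤ hatSeminorm p hp x * hatSeminorm q hq y := by
  refine Completion.induction_on₂ x y (isClosed_le (hr.comp (continuous_extendBilin hB))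
    (((continuous_hatSeminorm p hp).comp continuous_fst).mul
      ((continuous_hatSeminorm q hq).comp continuous_snd))) fun a b => ?_
  rw [extendBilin_coe hB, hatSeminorm_coe, hatSeminorm_coe]
  exact h a b

lemma isBoundedBilin_extendBilin [PolynormableSpace 𝕜 G] {B : E →ₗ[𝕜] F →ₗ[𝕜] G}
    (hB : IsBoundedBilin B) : IsBoundedBilin (extendBilin B) := fun r hr => by
  obtain ⟨p, q, hp, hq, h⟩ := hB r hr
  exact ⟨_, _, continuous_hatSeminorm p hp, continuous_hatSeminorm q hq,
    extendBilin_le hB.continuous hr hp hq h⟩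

end Completion

/-! ### Projective tensor products -/

section Projective

variable {𝕜 : Type*} [RCLike 𝕜] {E F G E' F' : Type*}

section Seminorms

variable [AddCommGroup E] [Module 𝕜 E] [TopologicalSpace E]
  [AddCommGroup F] [Module 𝕜 F] [TopologicalSpace F]

instance : PolynormableSpace 𝕜 (ProjTensor 𝕜 E F) :=
  (withSeminorms_ofSeminorms (projFamily 𝕜 E F)).toPolynormableSpace

instance : PolynormableSpace 𝕜 (CTensor 𝕜 E F) := polynormableSpace_completion

lemma withSeminorms_projFamily : WithSeminorms (projFamily 𝕜 E F) :=
  withSeminorms_ofSeminorms (projFamily 𝕜 E F)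

lemma projSeminorm_mono {p p' : Seminorm 𝕜 E} {q q' : Seminorm 𝕜 F} (hp : p ≤ p') (hq : q ≤ q') :
    projSeminorm p q ≤ projSeminorm p' q' := fun t =>
  le_projSeminorm p' q' _ (fun x y => (projSeminorm_tmul_le p q x y).trans
    (mul_le_mul (hp x) (hq y) (apply_nonneg _ _) (apply_nonneg _ _))) t

lemma continuous_projSeminorm {p : Seminorm 𝕜 E} {q : Seminorm 𝕜 F} (hp : Continuous p)
    (hq : Continuous q) :
    Continuous ((projSeminorm p q).comp (toProj 𝕜 E F).symm.toLinearMap) :=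
  withSeminorms_projFamily.continuous_seminorm (⟨p, hp⟩, ⟨q, hq⟩)

variable [IsTopologicalAddGroup E] [IsTopologicalAddGroup F]

/-- The defining family is directed by suprema, and the constant is absorbed into the first factor.
-/
lemma exists_le_projSeminorm {r : Seminorm 𝕜 (ProjTensor 𝕜 E F)} (hr : Continuous r) :
    ∃ p : Seminorm 𝕜 E, ∃ q : Seminorm 𝕜 F, Continuous p ∧ Continuous q ∧
      ∀ t, r (toProj 𝕜 E F t) ≤ projSeminorm p q t := by
  obtain ⟨⟨p, q⟩, C, h⟩ := bound_of_directed withSeminorms_projFamily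
    (fun i j => ⟨(⟨i.1.1 ⊔ j.1.1, continuous_sup_seminorm i.1.2 j.1.2⟩,
      ⟨i.2.1 ⊔ j.2.1, continuous_sup_seminorm i.2.2 j.2.2⟩),
      fun t => projSeminorm_mono le_sup_left le_sup_left ((toProj 𝕜 E F).symm t),
      fun t => projSeminorm_mono le_sup_right le_sup_right ((toProj 𝕜 E F).symm t)⟩) r hr
  refine ⟨C • p.1, q.1, continuous_smul_seminorm p.2 C, q.2, fun t => (h _).trans ?_⟩
  refine le_projSeminorm (C • p.1) q.1 (C • projSeminorm p.1 q.1) (fun x y => ?_) t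
  change (C : ℝ) * projSeminorm p.1 q.1 (x ⊗ₜ y) ≤ (C * p.1 x) * q.1 y
  rw [mul_assoc]
  exact mul_le_mul_of_nonneg_left (projSeminorm_tmul_le _ _ _ _) (NNReal.coe_nonneg C)

lemma exists_le_projSeminorm_tensorHat {r : Seminorm 𝕜 (CTensor 𝕜 E F)} (hr : Continuous r) :
    ∃ p : Seminorm 𝕜 E, ∃ q : Seminorm 𝕜 F, Continuous p ∧ Continuous q ∧
      ∀ t, r (tensorHat 𝕜 E F t) ≤ projSeminorm p q t :=
  exists_le_projSeminorm (continuous_comp_toHat hr)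

end Seminorms

section Maps

variable [AddCommGroup E] [Module 𝕜 E] [UniformSpace E] [IsUniformAddGroup E]
  [UniformContinuousConstSMul 𝕜 E]
  [AddCommGroup F] [Module 𝕜 F] [UniformSpace F] [IsUniformAddGroup F]
  [UniformContinuousConstSMul 𝕜 F]
  [AddCommGroup G] [Module 𝕜 G] [UniformSpace G] [IsUniformAddGroup G]
  [UniformContinuousConstSMul 𝕜 G]
  [AddCommGroup E'] [Module 𝕜 E'] [UniformSpace E'] [IsUniformAddGroup E']
  [UniformContinuousConstSMul 𝕜 E']
  [AddCommGroup F'] [Module 𝕜 F'] [UniformSpace F'] [IsUniformAddGroup F']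
  [UniformContinuousConstSMul 𝕜 F']

lemma tensorHat_apply (t : E ⊗[𝕜] F) :
    tensorHat 𝕜 E F t = ((toProj 𝕜 E F t : ProjTensor 𝕜 E F) : CTensor 𝕜 E F) := rfl

lemma continuous_lift_toProj_symm [PolynormableSpace 𝕜 G] {B : E →ₗ[𝕜] F →ₗ[𝕜] G}
    (hB : IsBoundedBilin B) :
    Continuous (TensorProduct.lift B ∘ₗ (toProj 𝕜 E F).symm.toLinearMap) := by
  refine continuous_of_bound (PolynormableSpace.withSeminorms 𝕜 G) _ fun r => ?_
  obtain ⟨p, q, hp, hq, h⟩ := hB r.1 r.2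
  exact ⟨_, continuous_projSeminorm hp hq, fun t =>
    le_projSeminorm p q (r.1.comp (TensorProduct.lift B)) h ((toProj 𝕜 E F).symm t)⟩

lemma liftHat_tensorHat [PolynormableSpace 𝕜 G] [T0Space G] [CompleteSpace G]
    {B : E →ₗ[𝕜] F →ₗ[𝕜] G} (hB : IsBoundedBilin B) (t : E ⊗[𝕜] F) :
    liftHat B (tensorHat 𝕜 E F t) = TensorProduct.lift B t := by
  rw [liftHat, tensorHat_apply, extendLin_coe (continuous_lift_toProj_symm hB)]
  rfl

lemma continuous_map_toProj_symm {f : E →ₗ[𝕜] E'} {g : F →ₗ[𝕜] F'} (hf : Continuous f)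
    (hg : Continuous g) : Continuous (tensorHat 𝕜 E' F' ∘ₗ TensorProduct.map f g ∘ₗ
      (toProj 𝕜 E F).symm.toLinearMap) := by
  refine continuous_of_bound (PolynormableSpace.withSeminorms 𝕜 (CTensor 𝕜 E' F')) _ fun r => ?_
  obtain ⟨p, q, hp, hq, h⟩ := exists_le_projSeminorm_tensorHat r.2
  have hp' : Continuous (p.comp f) := hp.comp hf
  have hq' : Continuous (q.comp g) := hq.comp hg
  refine ⟨_, continuous_projSeminorm hp' hq', fun t => (h _).trans ?_⟩
  exact le_projSeminorm (p.comp f) (q.comp g) ((projSeminorm p q).comp (TensorProduct.map f g))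
    (fun x y => projSeminorm_tmul_le p q _ _) ((toProj 𝕜 E F).symm t)

lemma mapHat_tensorHat (f : E →L[𝕜] E') (g : F →L[𝕜] F') (t : E ⊗[𝕜] F) :
    mapHat f g (tensorHat 𝕜 E F t) =
      tensorHat 𝕜 E' F' (TensorProduct.map f.toLinearMap g.toLinearMap t) := by
  rw [mapHat, tensorHat_apply, extendLin_coe (continuous_map_toProj_symm f.cont g.cont)]
  rfl

variable (𝕜 E F G) in
/-- The bilinear map `(x ⊗ y, c) ↦ x ⊗ (y ⊗ c)`. -/
def assocAux : ProjTensor 𝕜 E F →ₗ[𝕜] G →ₗ[𝕜] CTensor 𝕜 E (CTensor 𝕜 F G) :=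
  ((TensorProduct.mk 𝕜 (E ⊗[𝕜] F) G).compr₂
    (tensorHat 𝕜 E (CTensor 𝕜 F G) ∘ₗ (tensorHat 𝕜 F G).lTensor E ∘ₗ
      (TensorProduct.assoc 𝕜 E F G).toLinearMap)) ∘ₗ (toProj 𝕜 E F).symm.toLinearMap

/-- The outer seminorm is dominated by some p ⊗ Q, where Q is a continuous seminorm on F ⊗̂ G and is
in turn dominated by some q ⊗ s. -/
lemma isBoundedBilin_assocAux : IsBoundedBilin (assocAux 𝕜 E F G) := fun r hr => by
  obtain ⟨p, Q, hp, hQ, h⟩ := exists_le_projSeminorm_tensorHat hr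
  obtain ⟨q, s, hq, hs, h'⟩ := exists_le_projSeminorm_tensorHat hQ
  refine ⟨_, s, continuous_projSeminorm hp hq, hs, fun t c => ?_⟩
  rw [mul_comm]
  refine le_mul_projSeminorm p q (r.comp ((assocAux 𝕜 E F G).flip c ∘ₗ
    (toProj 𝕜 E F).toLinearMap)) (apply_nonneg s c) (fun x y => ?_) ((toProj 𝕜 E F).symm t)
  change r (tensorHat 𝕜 E (CTensor 𝕜 F G) (x ⊗ₜ tensorHat 𝕜 F G (y ⊗ₜ c))) ≤ _
  have h1 := (h' (y ⊗ₜ c)).trans (projSeminorm_tmul_le q s y c)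
  calc _ ≤ p x * Q (tensorHat 𝕜 F G (y ⊗ₜ c)) := (h _).trans (projSeminorm_tmul_le p Q _ _)
    _ ≤ p x * (q y * s c) := mul_le_mul_of_nonneg_left h1 (apply_nonneg p x)
    _ = _ := by ring

lemma isBoundedBilin_assocBilin : IsBoundedBilin (assocBilin 𝕜 E F G) := fun r hr => by
  obtain ⟨p, q, hp, hq, h⟩ := isBoundedBilin_extendBilin (isBoundedBilin_assocAux (𝕜 := 𝕜)
    (E := E) (F := F) (G := G)) r hr
  exact ⟨p, q.comp (toHat 𝕜 G), hp, continuous_comp_toHat hq, fun x y => h x _⟩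

lemma assocBilin_tensorHat (t : E ⊗[𝕜] F) (c : G) :
    assocBilin 𝕜 E F G (tensorHat 𝕜 E F t) c = tensorHat 𝕜 E (CTensor 𝕜 F G)
      ((tensorHat 𝕜 F G).lTensor E (TensorProduct.assoc 𝕜 E F G (t ⊗ₜ c))) :=
  extendBilin_coe (isBoundedBilin_assocAux (𝕜 := 𝕜) (E := E) (F := F) (G := G)).continuous
    (toProj 𝕜 E F t) c

lemma assocHat_tensorHat (t : (E ⊗[𝕜] F) ⊗[𝕜] G) :
    assocHat 𝕜 E F G (tensorHat 𝕜 (CTensor 𝕜 E F) G ((tensorHat 𝕜 E F).rTensor G t)) =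
      tensorHat 𝕜 E (CTensor 𝕜 F G)
        ((tensorHat 𝕜 F G).lTensor E (TensorProduct.assoc 𝕜 E F G t)) := by
  rw [assocHat, liftHat_tensorHat isBoundedBilin_assocBilin]
  induction t using TensorProduct.induction_on with
  | zero => simp only [map_zero]
  | add x y hx hy => simp only [map_add, hx, hy]
  | tmul t c =>
    rw [LinearMap.rTensor_tmul, TensorProduct.lift.tmul, assocBilin_tensorHat]

/-- The bilinear map `(a ⊗ b, c ⊗ d) ↦ ac ⊗ bd`. -/
def tensorMulAux (mul : E →ₗ[𝕜] E →ₗ[𝕜] E) :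
    ProjTensor 𝕜 E E →ₗ[𝕜] ProjTensor 𝕜 E E →ₗ[𝕜] CTensor 𝕜 E E :=
  ((TensorProduct.map₂ mul mul).compl₁₂ (toProj 𝕜 E E).symm.toLinearMap
    (toProj 𝕜 E E).symm.toLinearMap).compr₂ (tensorHat 𝕜 E E)

lemma isBoundedBilin_tensorMulAux {mul : E →ₗ[𝕜] E →ₗ[𝕜] E} (h : IsBoundedBilin mul) :
    IsBoundedBilin (tensorMulAux mul) := fun r hr => by
  obtain ⟨p, q, hp, hq, hr⟩ := exists_le_projSeminorm_tensorHat hr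
  obtain ⟨p₁, p₂, hp₁, hp₂, h1⟩ := h p hp
  obtain ⟨q₁, q₂, hq₁, hq₂, h2⟩ := h q hq
  refine ⟨_, _, continuous_projSeminorm hp₁ hq₁, continuous_projSeminorm hp₂ hq₂, fun s t => ?_⟩
  refine (hr _).trans ?_
  set s' := (toProj 𝕜 E E).symm s
  set t' := (toProj 𝕜 E E).symm t
  change projSeminorm p q (TensorProduct.map₂ mul mul s' t') ≤
    projSeminorm p₁ q₁ s' * projSeminorm p₂ q₂ t'
  rw [mul_comm]
  refine le_mul_projSeminorm p₁ q₁ ((projSeminorm p q).comp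
    ((TensorProduct.map₂ mul mul).flip t')) (apply_nonneg _ _) (fun a b => ?_) s'
  rw [mul_comm]
  refine le_mul_projSeminorm p₂ q₂ ((projSeminorm p q).comp
    (TensorProduct.map₂ mul mul (a ⊗ₜ b))) (mul_nonneg (apply_nonneg _ _) (apply_nonneg _ _))
    (fun c d => ?_) t'
  rw [Seminorm.comp_apply, TensorProduct.map₂_apply_tmul, TensorProduct.map_tmul]
  refine (projSeminorm_tmul_le p q _ _).trans ?_
  refine (mul_le_mul (h1 a c) (h2 b d) (apply_nonneg _ _)
    (mul_nonneg (apply_nonneg _ _) (apply_nonneg _ _))).trans (le_of_eq ?_)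
  ring

lemma tensorMulHat_tensorHat {mul : E →ₗ[𝕜] E →ₗ[𝕜] E} (h : IsBoundedBilin mul)
    (s t : E ⊗[𝕜] E) : tensorMulHat mul (tensorHat 𝕜 E E s) (tensorHat 𝕜 E E t) =
      tensorHat 𝕜 E E (TensorProduct.map₂ mul mul s t) :=
  extendBilin_coe (isBoundedBilin_tensorMulAux h).continuous (toProj 𝕜 E E s) (toProj 𝕜 E E t)

lemma continuous_tensorMulHat {mul : E →ₗ[𝕜] E →ₗ[𝕜] E} (h : IsBoundedBilin mul) :
    Continuous fun t : CTensor 𝕜 E E × CTensor 𝕜 E E => tensorMulHat mul t.1 t.2 :=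
  continuous_extendBilin (isBoundedBilin_tensorMulAux h).continuous

end Maps

end Projective

/-! ### Continuity of the structure maps -/

section SymTopology

variable {𝕜 : Type*} [RCLike 𝕜] {V : Type*} [AddCommGroup V] [Module 𝕜 V] {R : ℝ}

lemma symSeminormR_symProd_le (p : Seminorm 𝕜 V) {n : ℕ} (f : Fin n → V) :
    symSeminormR R p (symProd 𝕜 V R n f) ≤ factorialWeight R n * ∏ i, p (f i) := by
  rw [symSeminormR_eq]
  exact weightedSym_symProd_le _ _ _

lemma le_symSeminormR (p : Seminorm 𝕜 V) (r : Seminorm 𝕜 (SymR 𝕜 V R))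
    (h : ∀ n (f : Fin n → V), r (symProd 𝕜 V R n f) ≤ factorialWeight R n * ∏ i, p (f i))
    (x : SymR 𝕜 V R) : r x ≤ symSeminormR R p x := by
  rw [symSeminormR_eq]
  exact le_weightedSym _ p r h x

lemma symSeminormR_mono {p q : Seminorm 𝕜 V} (h : p ≤ q) :
    symSeminormR R p ≤ symSeminormR R q := by
  rw [symSeminormR_eq, symSeminormR_eq]
  exact weightedSym_mono le_rfl h

lemma factorialWeight_mul_le (hR : 0 ≤ R) (i j : ℕ) :
    factorialWeight R i * factorialWeight R j ≤ factorialWeight R (i + j) := by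
  rw [factorialWeight, factorialWeight, factorialWeight, ← NNReal.mul_rpow]
  refine NNReal.rpow_le_rpow ?_ hR
  exact_mod_cast Nat.le_of_dvd (Nat.factorial_pos _) (Nat.factorial_mul_factorial_dvd_factorial_add i j)

/-- There are 2^n subsets I, and each term is bounded by means of i! j! ≤ (i+j)!. -/
lemma projSeminorm_shuffle_le (hR : 0 ≤ R) (p q : Seminorm 𝕜 V) {n : ℕ} (f : Fin n → V) :
    projSeminorm (symSeminormR R p) (symSeminormR R q) (shuffle 𝕜 V R n f) ≤
      factorialWeight R n * (2 ^ n * ∏ i, (p ⊔ q) (f i)) := by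
  rw [shuffle, _root_.sum_apply]
  refine (seminorm_sum_le _ _ _).trans ?_
  refine (Finset.sum_le_card_nsmul _ _ (factorialWeight R n * ∏ i, (p ⊔ q) (f i))
    fun I _ => ?_).trans (le_of_eq ?_)
  · let e := finSumEquivOfFinset (s := I) (m := I.card) (n := Iᶜ.card) rfl rfl
    change projSeminorm _ _ (symProd 𝕜 V R I.card (fun i => f (e (Sum.inl i))) ⊗ₜ[𝕜]
      symProd 𝕜 V R Iᶜ.card (fun i => f (e (Sum.inr i)))) ≤ _
    refine (projSeminorm_tmul_le _ _ _ _).trans ?_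
    have h1 := (symSeminormR_mono (R := R) (le_sup_left : p ≤ p ⊔ q) _).trans
      (symSeminormR_symProd_le (R := R) (p ⊔ q) fun i => f (e (Sum.inl i)))
    have h2 := (symSeminormR_mono (R := R) (le_sup_right : q ≤ p ⊔ q) _).trans
      (symSeminormR_symProd_le (R := R) (p ⊔ q) fun i => f (e (Sum.inr i)))
    refine (mul_le_mul h1 h2 (apply_nonneg _ _) (mul_nonneg (NNReal.coe_nonneg _)
      (Finset.prod_nonneg fun _ _ => apply_nonneg _ _))).trans ?_
    rw [mul_mul_mul_comm, ← Equiv.prod_comp e fun i => (p ⊔ q) (f i), Fintype.prod_sum_type]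
    refine mul_le_mul_of_nonneg_right ?_ (mul_nonneg
      (Finset.prod_nonneg fun _ _ => apply_nonneg _ _)
      (Finset.prod_nonneg fun _ _ => apply_nonneg _ _))
    have hc : I.card + Iᶜ.card = n := by rw [Finset.card_add_card_compl, Fintype.card_fin]
    have := factorialWeight_mul_le hR I.card Iᶜ.card
    rw [hc] at this
    exact_mod_cast this
  · rw [Finset.card_univ, Fintype.card_finset, Fintype.card_fin, nsmul_eq_mul]
    push_cast
    ring

/-- The number 2^n of subsets becomes the factor 2 on the seminorm. -/
lemma projSeminorm_coproduct_le (hR : 0 ≤ R) (p q : Seminorm 𝕜 V) (x : SymR 𝕜 V R) :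
    projSeminorm (symSeminormR R p) (symSeminormR R q) (coproduct 𝕜 V R x) ≤
      symSeminormR R ((2 : ℝ≥0) • (p ⊔ q)) x := by
  refine le_symSeminormR _ ((projSeminorm (symSeminormR R p) (symSeminormR R q)).comp
    (coproduct 𝕜 V R)) (fun n f => ?_) x
  have h : coproduct 𝕜 V R (symProd 𝕜 V R n f) = (n.factorial : 𝕜)⁻¹ •
      ∑ σ : Equiv.Perm (Fin n), shuffle 𝕜 V R n (f ∘ σ) := symLift_symProd (shuffle 𝕜 V R) f
  rw [Seminorm.comp_apply, h, map_smul_eq_mul, norm_inv, RCLike.norm_natCast,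
    inv_mul_le_iff₀ (by exact_mod_cast n.factorial_pos), prod_smul_seminorm]
  refine (seminorm_sum_le _ _ _).trans ?_
  refine (Finset.sum_le_card_nsmul _ _ (factorialWeight R n * (2 ^ n * ∏ i, (p ⊔ q) (f i)))
    fun σ _ => ?_).trans (le_of_eq ?_)
  · refine (projSeminorm_shuffle_le hR p q _).trans (le_of_eq ?_)
    rw [← Equiv.prod_comp σ fun i => (p ⊔ q) (f i)]
    rfl
  · rw [Finset.card_univ, Fintype.card_perm, Fintype.card_fin, nsmul_eq_mul]
    simp

lemma symSeminormR_antipode_le (p : Seminorm 𝕜 V) (x : SymR 𝕜 V R) :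
    symSeminormR R p (antipode 𝕜 V R x) ≤ symSeminormR R p x := by
  refine le_symSeminormR p ((symSeminormR R p).comp (antipode 𝕜 V R)) (fun n f => ?_) x
  have h : antipode 𝕜 V R (symProd 𝕜 V R n f) = (-1 : 𝕜) ^ n • symProd 𝕜 V R n f := by
    rw [symProd_apply, antipode, symDesc_symOf, LinearMap.smul_apply]
  rw [Seminorm.comp_apply, h, map_smul_eq_mul, norm_pow, norm_neg, norm_one, one_pow, one_mul]
  exact symSeminormR_symProd_le p f

/-- For p = 0 only the empty product survives, so p_R is the absolute value of the degree-0 part. -/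
lemma norm_counit_le (x : SymR 𝕜 V R) : ‖counit 𝕜 V R x‖ ≤ symSeminormR R 0 x := by
  refine le_symSeminormR 0 ((normSeminorm 𝕜 𝕜).comp (counit 𝕜 V R)) (fun n f => ?_) x
  rw [Seminorm.comp_apply]
  change ‖counit 𝕜 V R (symProd 𝕜 V R n f)‖ ≤ _
  cases n with
  | zero =>
    obtain rfl : f = fun _ => 0 := Subsingleton.elim _ _
    rw [← symPow, counit_symPow_zero]
    simp [factorialWeight]
  | succ n =>
    rw [counit_symProd_of_ne_zero n.succ_ne_zero, norm_zero]
    exact mul_nonneg (NNReal.coe_nonneg _) (Finset.prod_nonneg fun _ _ => apply_nonneg _ _)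

lemma symSeminormR_symMap_le {W : Type*} [AddCommGroup W] [Module 𝕜 W] (φ : V →ₗ[𝕜] W)
    (p : Seminorm 𝕜 W) (x : SymR 𝕜 V R) :
    symSeminormR R p (symMap R φ x) ≤ symSeminormR R (p.comp φ) x := by
  refine le_symSeminormR _ ((symSeminormR R p).comp (symMap R φ)) (fun n f => ?_) x
  rw [Seminorm.comp_apply, symMap_symProd]
  exact symSeminormR_symProd_le p _

variable [TopologicalSpace V]

lemma withSeminorms_symFamily : WithSeminorms (symFamily 𝕜 V R) :=
  withSeminorms_ofSeminorms (symFamily 𝕜 V R)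

instance : PolynormableSpace 𝕜 (SymR 𝕜 V R) := withSeminorms_symFamily.toPolynormableSpace

instance : PolynormableSpace 𝕜 (SymHat 𝕜 V R) := polynormableSpace_completion

lemma continuous_symSeminormR {p : Seminorm 𝕜 V} (hp : Continuous p) :
    Continuous (symSeminormR R p) :=
  withSeminorms_symFamily.continuous_seminorm (⟨p, hp⟩ : {p : Seminorm 𝕜 V // Continuous p})

lemma exists_le_symSeminormR {r : Seminorm 𝕜 (SymR 𝕜 V R)} (hr : Continuous r) :
    ∃ p : Seminorm 𝕜 V, ∃ C : ℝ≥0, Continuous p ∧ r ≤ C • symSeminormR R p := by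
  have h := bound_of_directed withSeminorms_symFamily
    (fun i j => ⟨⟨i.1 ⊔ j.1, continuous_sup_seminorm i.2 j.2⟩,
      symSeminormR_mono le_sup_left, symSeminormR_mono le_sup_right⟩) r hr
  obtain ⟨p, C, h⟩ := h
  exact ⟨p.1, C, p.2, h⟩

lemma continuous_coproduct (hR : 0 ≤ R) : Continuous fun x : SymR 𝕜 V R =>
    toProj 𝕜 (SymR 𝕜 V R) (SymR 𝕜 V R) (coproduct 𝕜 V R x) := by
  refine continuous_of_bound withSeminorms_projFamily
    ((toProj 𝕜 (SymR 𝕜 V R) (SymR 𝕜 V R)).toLinearMap ∘ₗ coproduct 𝕜 V R) fun i => ?_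
  obtain ⟨p, C, hp, h1⟩ := exists_le_symSeminormR i.1.2
  obtain ⟨q, D, hq, h2⟩ := exists_le_symSeminormR i.2.2
  refine ⟨(C * D) • symSeminormR R ((2 : ℝ≥0) • (p ⊔ q)), continuous_smul_seminorm
    (continuous_symSeminormR (continuous_smul_seminorm (continuous_sup_seminorm hp hq) 2)) _,
    fun x => ?_⟩
  change projSeminorm i.1.1 i.2.1 (coproduct 𝕜 V R x) ≤
    ((C * D : ℝ≥0) : ℝ) * symSeminormR R ((2 : ℝ≥0) • (p ⊔ q)) x
  refine le_trans ?_ (mul_le_mul_of_nonneg_left (projSeminorm_coproduct_le hR p q x)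
    (NNReal.coe_nonneg _))
  refine le_mul_projSeminorm _ _ _ (NNReal.coe_nonneg _) (fun a b => ?_) _
  refine (projSeminorm_tmul_le _ _ a b).trans ?_
  refine (mul_le_mul (h1 a) (h2 b) (apply_nonneg _ _) (apply_nonneg _ _)).trans (le_of_eq ?_)
  change (C * symSeminormR R p a) * (D * symSeminormR R q b) = _
  push_cast
  ring

lemma continuous_antipode : Continuous (antipode 𝕜 V R) :=
  continuous_of_bound withSeminorms_symFamily _ fun p =>
    ⟨_, continuous_symSeminormR p.2, symSeminormR_antipode_le p.1⟩

lemma continuous_counit : Continuous (counit 𝕜 V R) :=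
  continuous_of_bound (norm_withSeminorms 𝕜 𝕜) _ fun _ =>
    ⟨_, continuous_symSeminormR continuous_zero, norm_counit_le⟩

lemma continuous_symMap {W : Type*} [AddCommGroup W] [Module 𝕜 W] [TopologicalSpace W]
    {φ : V →ₗ[𝕜] W} (hφ : Continuous φ) : Continuous (symMap R φ) :=
  continuous_of_bound withSeminorms_symFamily _ fun p =>
    ⟨symSeminormR R (p.1.comp φ), continuous_symSeminormR (p.2.comp hφ),
      symSeminormR_symMap_le φ p.1⟩

lemma seminormHat_eq {p : Seminorm 𝕜 V} (hp : Continuous p) (x : SymHat 𝕜 V R) :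
    seminormHat R p x = hatSeminorm (symSeminormR R p) (continuous_symSeminormR hp) x := rfl

lemma seminormHat_coe {p : Seminorm 𝕜 V} (hp : Continuous p) (x : SymR 𝕜 V R) :
    seminormHat R p (x : SymHat 𝕜 V R) = symSeminormR R p x :=
  hatSeminorm_coe _ (continuous_symSeminormR hp) x

lemma continuous_seminormHat {p : Seminorm 𝕜 V} : Continuous (seminormHat (𝕜 := 𝕜) R p) :=
  Completion.continuous_extension

lemma exists_le_seminormHat {r : Seminorm 𝕜 (SymHat 𝕜 V R)} (hr : Continuous r) :
    ∃ p : Seminorm 𝕜 V, ∃ C : ℝ≥0, Continuous p ∧ ∀ x, r x ≤ C * seminormHat R p x := by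
  obtain ⟨p, C, hp, h⟩ := exists_le_symSeminormR (continuous_comp_toHat hr)
  refine ⟨p, C, hp, fun x => ?_⟩
  refine Completion.induction_on x (isClosed_le hr
    (continuous_const.mul continuous_seminormHat)) fun a => ?_
  rw [seminormHat_coe hp]
  exact h a

lemma isBoundedBilin_of_symSeminormR {B : SymR 𝕜 V R →ₗ[𝕜] SymR 𝕜 V R →ₗ[𝕜] SymR 𝕜 V R}
    (h : ∀ p : Seminorm 𝕜 V, Continuous p → ∃ q : Seminorm 𝕜 V, ∃ C : ℝ, 0 ≤ C ∧ Continuous q ∧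
      ∀ x y, symSeminormR R p (B x y) ≤ C * symSeminormR R q x * symSeminormR R q y) :
    IsBoundedBilin B := fun r hr => by
  obtain ⟨p, D, hp, hrp⟩ := exists_le_symSeminormR hr
  obtain ⟨q, C, hC, hq, hle⟩ := h p hp
  refine ⟨(D * C.toNNReal) • symSeminormR R q, symSeminormR R q,
    continuous_smul_seminorm (continuous_symSeminormR hq) _, continuous_symSeminormR hq,
    fun x y => (hrp _).trans ?_⟩
  change (D : ℝ) * symSeminormR R p (B x y) ≤
    ((D * C.toNNReal : ℝ≥0) : ℝ) * symSeminormR R q x * symSeminormR R q y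
  rw [NNReal.coe_mul, Real.coe_toNNReal _ hC, mul_assoc, mul_assoc, ← mul_assoc C]
  exact mul_le_mul_of_nonneg_left (hle x y) (NNReal.coe_nonneg D)

lemma IsBoundedBilin.compr_toHat {E F G : Type*} [AddCommGroup E] [Module 𝕜 E]
    [UniformSpace E] [AddCommGroup F] [Module 𝕜 F] [UniformSpace F] [AddCommGroup G] [Module 𝕜 G]
    [UniformSpace G] [IsUniformAddGroup G] [UniformContinuousConstSMul 𝕜 G]
    {B : E →ₗ[𝕜] F →ₗ[𝕜] G} (h : IsBoundedBilin B) : IsBoundedBilin (B.compr₂ (toHat 𝕜 G)) :=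
  fun _ hr => h _ (continuous_comp_toHat hr)

end SymTopology

/-! ### The completed star product -/

section StarTopology

open Filter Topology

variable {𝕜 : Type*} [RCLike 𝕜] {𝔤 : Type*} [LieRing 𝔤] [LieAlgebra 𝕜 𝔤]
  [TopologicalSpace 𝔤] [AELieAlgebra 𝕜 𝔤] {R : ℝ}

lemma isBoundedBilin_starCoeff (hR : 0 ≤ R) (n : ℕ) :
    IsBoundedBilin (starCoeff 𝕜 𝔤 R n) :=
  isBoundedBilin_of_symSeminormR fun p hp => by
    obtain ⟨q, hq, hpq⟩ := AELieAlgebra.exists_estimate p hp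
    refine ⟨estimateConst R • q, coeffConst n * (n.factorial : ℝ) ^ (1 - R),
      mul_nonneg (coeffConst_nonneg n) (by positivity), continuous_smul_seminorm hq _,
      fun x y => ?_⟩
    have := starCoeff_le hR hpq n (symIncl 𝕜 𝔤 R x) (symIncl 𝕜 𝔤 R y)
    rwa [symmetrize_symIncl, symmetrize_symIncl] at this

lemma symSeminormR_guttStar_le (hR : 1 ≤ R) {p q : Seminorm 𝕜 𝔤} (hpq : IsAsymptoticEstimate p q) (z : 𝕜)
    (x y : SymR 𝕜 𝔤 R) : symSeminormR R p (guttStar 𝕜 𝔤 R z x y) ≤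
      symSeminormR R ((estimateConst R * (‖z‖₊ + 1)) • q) x *
        symSeminormR R ((estimateConst R * (‖z‖₊ + 1)) • q) y := by
  have := guttStar_le hR hpq z (symIncl 𝕜 𝔤 R x) (symIncl 𝕜 𝔤 R y)
  rwa [symmetrize_symIncl, symmetrize_symIncl] at this

lemma isBoundedBilin_guttStar (hR : 1 ≤ R) (z : 𝕜) : IsBoundedBilin (guttStar 𝕜 𝔤 R z) :=
  isBoundedBilin_of_symSeminormR fun p hp => by
    obtain ⟨q, hq, hpq⟩ := AELieAlgebra.exists_estimate p hp
    refine ⟨(estimateConst R * (‖z‖₊ + 1)) • q, 1, zero_le_one, continuous_smul_seminorm hq _,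
      fun x y => ?_⟩
    rw [one_mul]
    exact symSeminormR_guttStar_le hR hpq z x y

/-- The extension by continuity is 0 by default when joint continuity fails, so the bound for R ≥ 1
is needed even for this identity. -/
lemma starHat_coe (hR : 1 ≤ R) (z : 𝕜) (x y : SymR 𝕜 𝔤 R) :
    starHat 𝕜 𝔤 R z (x : SymHat 𝕜 𝔤 R) (y : SymHat 𝕜 𝔤 R) =
      (guttStar 𝕜 𝔤 R z x y : SymR 𝕜 𝔤 R) :=
  extendBilin_coe (isBoundedBilin_guttStar hR z).compr_toHat.continuous x y

lemma continuous_starHat (hR : 1 ≤ R) (z : 𝕜) :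
    Continuous fun t : SymHat 𝕜 𝔤 R × SymHat 𝕜 𝔤 R => starHat 𝕜 𝔤 R z t.1 t.2 :=
  continuous_extendBilin (isBoundedBilin_guttStar hR z).compr_toHat.continuous

lemma isBoundedBilin_starHat (hR : 1 ≤ R) (z : 𝕜) : IsBoundedBilin (starHat 𝕜 𝔤 R z) :=
  isBoundedBilin_extendBilin (isBoundedBilin_guttStar hR z).compr_toHat

lemma starCoeffHat_coe (hR : 0 ≤ R) (n : ℕ) (x y : SymR 𝕜 𝔤 R) :
    starCoeffHat 𝕜 𝔤 R n (x : SymHat 𝕜 𝔤 R) (y : SymHat 𝕜 𝔤 R) =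
      (starCoeff 𝕜 𝔤 R n x y : SymR 𝕜 𝔤 R) :=
  extendBilin_coe (isBoundedBilin_starCoeff hR n).compr_toHat.continuous x y

lemma continuous_starCoeffHat (hR : 0 ≤ R) (n : ℕ) :
    Continuous fun t : SymHat 𝕜 𝔤 R × SymHat 𝕜 𝔤 R => starCoeffHat 𝕜 𝔤 R n t.1 t.2 :=
  continuous_extendBilin (isBoundedBilin_starCoeff hR n).compr_toHat.continuous

lemma seminormHat_starHat_le (hR : 1 ≤ R) {p q : Seminorm 𝕜 𝔤} (hp : Continuous p)
    (hq : Continuous q) (hpq : IsAsymptoticEstimate p q) (z : 𝕜) (x y : SymHat 𝕜 𝔤 R) :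
    seminormHat R p (starHat 𝕜 𝔤 R z x y) ≤
      seminormHat R ((estimateConst R * (‖z‖₊ + 1)) • q) x *
        seminormHat R ((estimateConst R * (‖z‖₊ + 1)) • q) y := by
  refine Completion.induction_on₂ x y (isClosed_le
    (continuous_seminormHat.comp (continuous_starHat hR z))
    ((continuous_seminormHat.comp continuous_fst).mul
      (continuous_seminormHat.comp continuous_snd))) fun a b => ?_
  have hq' := continuous_smul_seminorm hq (estimateConst R * (‖z‖₊ + 1))
  rw [starHat_coe hR, seminormHat_coe hp, seminormHat_coe hq', seminormHat_coe hq']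
  exact symSeminormR_guttStar_le hR hpq z a b

lemma seminormHat_zpow_starCoeffHat_le (hR : 1 ≤ R) {p q : Seminorm 𝕜 𝔤} (hp : Continuous p)
    (hq : Continuous q) (hpq : IsAsymptoticEstimate p q) (z : 𝕜) (n : ℕ) (x y : SymHat 𝕜 𝔤 R) :
    seminormHat R p (z ^ n • starCoeffHat 𝕜 𝔤 R n x y) ≤
      (1 / 8) ^ n * seminormHat R ((estimateConst R * (‖z‖₊ + 1)) • q) x *
        seminormHat R ((estimateConst R * (‖z‖₊ + 1)) • q) y := by
  have hc := continuous_starCoeffHat (𝕜 := 𝕜) (𝔤 := 𝔤) (R := R) (by linarith) n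
  refine Completion.induction_on₂ x y (isClosed_le
    (continuous_seminormHat.comp (hc.const_smul (z ^ n)))
    ((continuous_const.mul (continuous_seminormHat.comp continuous_fst)).mul
      (continuous_seminormHat.comp continuous_snd))) fun a b => ?_
  have hq' := continuous_smul_seminorm hq (estimateConst R * (‖z‖₊ + 1))
  rw [starCoeffHat_coe (by linarith), ← Completion.coe_smul, seminormHat_coe hp,
    seminormHat_coe hq', seminormHat_coe hq']
  exact zpow_starCoeff_le hR hpq z n a b

lemma summable_seminormHat (hR : 1 ≤ R) {p : Seminorm 𝕜 𝔤} (hp : Continuous p) (z : 𝕜)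
    (x y : SymHat 𝕜 𝔤 R) :
    Summable fun n : ℕ => seminormHat R p (z ^ n • starCoeffHat 𝕜 𝔤 R n x y) := by
  obtain ⟨q, hq, hpq⟩ := AELieAlgebra.exists_estimate (𝔤 := 𝔤) p hp
  refine Summable.of_nonneg_of_le (fun n => ?_)
    (fun n => seminormHat_zpow_starCoeffHat_le hR hp hq hpq z n x y) ?_
  · rw [seminormHat_eq hp]
    exact apply_nonneg _ _
  · exact ((summable_geometric_of_lt_one (by norm_num) (by norm_num)).mul_right _).mul_right _

lemma coe_finset_sum {E ι : Type*} [AddCommGroup E] [UniformSpace E] [IsUniformAddGroup E]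
    (F : Finset ι) (f : ι → E) :
    ((∑ i ∈ F, f i : E) : Completion E) = ∑ i ∈ F, (f i : Completion E) :=
  map_sum (Completion.toCompl (α := E)) f F

lemma seminormHat_starHat_sub_sum_le (hR : 1 ≤ R) {p q : Seminorm 𝕜 𝔤} (hp : Continuous p)
    (hq : Continuous q) (hpq : IsAsymptoticEstimate p q) (z : 𝕜) (F : Finset ℕ)
    (x y : SymHat 𝕜 𝔤 R) :
    seminormHat R p (starHat 𝕜 𝔤 R z x y - ∑ n ∈ F, z ^ n • starCoeffHat 𝕜 𝔤 R n x y) ≤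
      (∑' n : {n // n ∉ F}, (1 / 8 : ℝ) ^ (n : ℕ)) *
        seminormHat R ((estimateConst R * (‖z‖₊ + 1)) • q) x *
        seminormHat R ((estimateConst R * (‖z‖₊ + 1)) • q) y := by
  have hc := fun n => continuous_starCoeffHat (𝕜 := 𝕜) (𝔤 := 𝔤) (R := R) (by linarith) n
  refine Completion.induction_on₂ x y (isClosed_le
    (continuous_seminormHat.comp ((continuous_starHat hR z).sub
      (continuous_finsetSum F fun n _ => (hc n).const_smul (z ^ n))))
    ((continuous_const.mul (continuous_seminormHat.comp continuous_fst)).mul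
      (continuous_seminormHat.comp continuous_snd))) fun a b => ?_
  have hq' := continuous_smul_seminorm hq (estimateConst R * (‖z‖₊ + 1))
  have h : starHat 𝕜 𝔤 R z (a : SymHat 𝕜 𝔤 R) (b : SymHat 𝕜 𝔤 R) -
      ∑ n ∈ F, z ^ n • starCoeffHat 𝕜 𝔤 R n (a : SymHat 𝕜 𝔤 R) (b : SymHat 𝕜 𝔤 R) =
      ((guttStar 𝕜 𝔤 R z a b - ∑ n ∈ F, z ^ n • starCoeff 𝕜 𝔤 R n a b : SymR 𝕜 𝔤 R) :
        SymHat 𝕜 𝔤 R) := by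
    rw [starHat_coe hR, Completion.coe_sub, coe_finset_sum]
    congr 1
    refine Finset.sum_congr rfl fun n _ => ?_
    rw [starCoeffHat_coe (by linarith), Completion.coe_smul]
  rw [h, seminormHat_coe hp, seminormHat_coe hq', seminormHat_coe hq']
  exact guttStar_sub_sum_le hR hpq z F a b

lemma hasSum_starHat (hR : 1 ≤ R) (z : 𝕜) (x y : SymHat 𝕜 𝔤 R) :
    HasSum (fun n : ℕ => z ^ n • starCoeffHat 𝕜 𝔤 R n x y) (starHat 𝕜 𝔤 R z x y) := by
  refine ((PolynormableSpace.withSeminorms 𝕜 (SymHat 𝕜 𝔤 R)).tendsto_nhds _ _).2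
    fun r ε hε => ?_
  obtain ⟨p, C, hp, hr⟩ := exists_le_seminormHat r.2
  obtain ⟨q, hq, hpq⟩ := AELieAlgebra.exists_estimate (𝔤 := 𝔤) p hp
  -- For fixed x and y the bound is a multiple of a tail of ∑ 8^(-n), taken over complements of
  -- finite sets.
  have h0 : Tendsto (fun F : Finset ℕ => C * ((∑' n : {n // n ∉ F}, (1 / 8 : ℝ) ^ (n : ℕ)) *
      seminormHat R ((estimateConst R * (‖z‖₊ + 1)) • q) x *
      seminormHat R ((estimateConst R * (‖z‖₊ + 1)) • q) y)) atTop (𝓝 0) := by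
    have := (((tendsto_tsum_compl_atTop_zero fun n : ℕ => (1 / 8 : ℝ) ^ n).mul_const
      (seminormHat R ((estimateConst R * (‖z‖₊ + 1)) • q) x)).mul_const
      (seminormHat R ((estimateConst R * (‖z‖₊ + 1)) • q) y)).const_mul (C : ℝ)
    simpa only [zero_mul, mul_zero] using this
  filter_upwards [h0.eventually_lt_const hε] with F hF
  refine lt_of_le_of_lt ?_ hF
  change r.1 _ ≤ _
  rw [map_sub_rev]
  exact (hr _).trans (mul_le_mul_of_nonneg_left
    (seminormHat_starHat_sub_sum_le hR hp hq hpq z F x y) (NNReal.coe_nonneg C))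

end StarTopology

/-! ### The structure maps on the completion -/

section CompletedMaps

variable {𝕜 : Type*} [RCLike 𝕜] {V W : Type*} [AddCommGroup V] [Module 𝕜 V] [TopologicalSpace V]
  [AddCommGroup W] [Module 𝕜 W] [TopologicalSpace W] {R : ℝ}

variable (𝕜 V R) in
/-- The map `Sym(V) ⊗ Sym(V) → Ŝym(V) ⊗ Ŝym(V)`. -/
def tensorIncl : SymR 𝕜 V R ⊗[𝕜] SymR 𝕜 V R →ₗ[𝕜] SymHat 𝕜 V R ⊗[𝕜] SymHat 𝕜 V R :=
  TensorProduct.map (toHat 𝕜 (SymR 𝕜 V R)) (toHat 𝕜 (SymR 𝕜 V R))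

lemma continuous_coproductToHat (hR : 0 ≤ R) : Continuous (coproductToHat 𝕜 V R) :=
  (continuous_map_toProj_symm continuous_toHat continuous_toHat).comp (continuous_coproduct hR)

lemma coproductHat_coe (hR : 0 ≤ R) (a : SymR 𝕜 V R) :
    coproductHat 𝕜 V R (a : SymHat 𝕜 V R) =
      tensorHat 𝕜 (SymHat 𝕜 V R) (SymHat 𝕜 V R) (tensorIncl 𝕜 V R (coproduct 𝕜 V R a)) :=
  extendLin_coe (continuous_coproductToHat hR) a

lemma counitHat_coe (a : SymR 𝕜 V R) : counitHat 𝕜 V R (a : SymHat 𝕜 V R) = counit 𝕜 V R a :=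
  extendLin_coe continuous_counit a

lemma antipodeHat_coe (a : SymR 𝕜 V R) :
    antipodeHat 𝕜 V R (a : SymHat 𝕜 V R) = (antipode 𝕜 V R a : SymR 𝕜 V R) :=
  extendLin_coe (f := toHat 𝕜 (SymR 𝕜 V R) ∘ₗ antipode 𝕜 V R)
    ((continuous_toHat (𝕜 := 𝕜)).comp continuous_antipode) a

lemma symMapHat_coe {φ : V →ₗ[𝕜] W} (hφ : Continuous φ) (a : SymR 𝕜 V R) :
    symMapHat R φ (a : SymHat 𝕜 V R) = (symMap R φ a : SymR 𝕜 W R) :=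
  extendLin_coe (f := toHat 𝕜 (SymR 𝕜 W R) ∘ₗ symMap R φ)
    ((continuous_toHat (𝕜 := 𝕜)).comp (continuous_symMap hφ)) a

lemma map_coproductHat_left (hR : 0 ≤ R) (u : SymR 𝕜 V R ⊗[𝕜] SymR 𝕜 V R) :
    TensorProduct.map (coproductHat 𝕜 V R).toLinearMap LinearMap.id (tensorIncl 𝕜 V R u) =
      (tensorHat 𝕜 (SymHat 𝕜 V R) (SymHat 𝕜 V R)).rTensor (SymHat 𝕜 V R)
        (TensorProduct.map (tensorIncl 𝕜 V R) (toHat 𝕜 (SymR 𝕜 V R))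
          ((coproduct 𝕜 V R).rTensor (SymR 𝕜 V R) u)) := by
  induction u using TensorProduct.induction_on with
  | zero => simp only [map_zero]
  | add x y hx hy => simp only [map_add, hx, hy]
  | tmul x y =>
    rw [tensorIncl, TensorProduct.map_tmul, TensorProduct.map_tmul, LinearMap.rTensor_tmul,
      TensorProduct.map_tmul, LinearMap.rTensor_tmul, ← tensorIncl]
    exact congrArg (· ⊗ₜ _) (coproductHat_coe hR x)

lemma map_coproductHat_right (hR : 0 ≤ R) (u : SymR 𝕜 V R ⊗[𝕜] SymR 𝕜 V R) :
    TensorProduct.map LinearMap.id (coproductHat 𝕜 V R).toLinearMap (tensorIncl 𝕜 V R u) =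
      (tensorHat 𝕜 (SymHat 𝕜 V R) (SymHat 𝕜 V R)).lTensor (SymHat 𝕜 V R)
        (TensorProduct.map (toHat 𝕜 (SymR 𝕜 V R)) (tensorIncl 𝕜 V R)
          ((coproduct 𝕜 V R).lTensor (SymR 𝕜 V R) u)) := by
  induction u using TensorProduct.induction_on with
  | zero => simp only [map_zero]
  | add x y hx hy => simp only [map_add, hx, hy]
  | tmul x y =>
    rw [tensorIncl, TensorProduct.map_tmul, TensorProduct.map_tmul, LinearMap.lTensor_tmul,
      TensorProduct.map_tmul, LinearMap.lTensor_tmul, ← tensorIncl]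
    exact congrArg (_ ⊗ₜ ·) (coproductHat_coe hR y)

lemma coproductHat_coassoc (hR : 0 ≤ R) (x : SymHat 𝕜 V R) :
    assocHat 𝕜 (SymHat 𝕜 V R) (SymHat 𝕜 V R) (SymHat 𝕜 V R)
      (mapHat (coproductHat 𝕜 V R) (.id 𝕜 (SymHat 𝕜 V R)) (coproductHat 𝕜 V R x)) =
      mapHat (.id 𝕜 (SymHat 𝕜 V R)) (coproductHat 𝕜 V R) (coproductHat 𝕜 V R x) := by
  -- Both sides are continuous and so need only be compared on the dense image of Sym. The other
  -- identities on the completion are obtained in the same way.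
  refine Completion.induction_on x (isClosed_eq ?_ ?_) fun a => ?_
  · exact (assocHat 𝕜 _ _ _).cont.comp ((mapHat _ _).cont.comp (coproductHat 𝕜 V R).cont)
  · exact (mapHat _ _).cont.comp (coproductHat 𝕜 V R).cont
  rw [coproductHat_coe hR, mapHat_tensorHat, mapHat_tensorHat]
  refine (congrArg (fun t => assocHat 𝕜 _ _ _ (tensorHat 𝕜 _ _ t))
    (map_coproductHat_left hR _)).trans ?_
  refine Eq.trans ?_ (congrArg (tensorHat 𝕜 _ _) (map_coproductHat_right hR _)).symm
  rw [assocHat_tensorHat]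
  congr 2
  rw [← coproduct_coassoc]
  exact (TensorProduct.map_map_assoc _ _ _ _).symm

lemma coproductHat_oneHat (hR : 0 ≤ R) : coproductHat 𝕜 V R (oneHat 𝕜 V R) =
    tensorHat 𝕜 _ _ (oneHat 𝕜 V R ⊗ₜ[𝕜] oneHat 𝕜 V R) := by
  rw [oneHat, toHat_apply, coproductHat_coe hR, coproduct_symOne]
  rfl

lemma isBoundedBilin_lsmul {E : Type*} [AddCommGroup E] [Module 𝕜 E] [UniformSpace E]
    (ε : E →L[𝕜] 𝕜) : IsBoundedBilin (LinearMap.lsmul 𝕜 E ∘ₗ ε.toLinearMap) := fun r hr =>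
  ⟨(normSeminorm 𝕜 𝕜).comp ε.toLinearMap, r, continuous_norm.comp ε.cont, hr,
    fun x y => (map_smul_eq_mul r (ε x) y).le⟩

lemma IsBoundedBilin.flip {E F G : Type*} [AddCommGroup E] [Module 𝕜 E] [TopologicalSpace E]
    [AddCommGroup F] [Module 𝕜 F] [TopologicalSpace F] [AddCommGroup G] [Module 𝕜 G]
    [TopologicalSpace G] {B : E →ₗ[𝕜] F →ₗ[𝕜] G} (h : IsBoundedBilin B) :
    IsBoundedBilin B.flip := fun r hr => by
  obtain ⟨p, q, hp, hq, hle⟩ := h r hr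
  exact ⟨q, p, hq, hp, fun x y => (hle y x).trans (mul_comm _ _).le⟩

lemma coproductHat_counit_left (hR : 0 ≤ R) (x : SymHat 𝕜 V R) :
    liftHat (LinearMap.lsmul 𝕜 (SymHat 𝕜 V R) ∘ₗ (counitHat 𝕜 V R).toLinearMap)
      (coproductHat 𝕜 V R x) = x := by
  refine Completion.induction_on x (isClosed_eq
    ((liftHat _).cont.comp (coproductHat 𝕜 V R).cont) continuous_id) fun a => ?_
  rw [coproductHat_coe hR, liftHat_tensorHat (isBoundedBilin_lsmul _)]
  refine Eq.trans ?_ (congrArg (toHat 𝕜 (SymR 𝕜 V R)) (coproduct_counit_left a))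
  generalize coproduct 𝕜 V R a = u
  induction u using TensorProduct.induction_on with
  | zero => simp only [map_zero]
  | add x y hx hy => simp only [map_add, hx, hy]
  | tmul x y =>
    change counitHat 𝕜 V R (x : SymHat 𝕜 V R) • (y : SymHat 𝕜 V R) =
      toHat 𝕜 _ (counit 𝕜 V R x • y)
    rw [counitHat_coe, map_smul, toHat_apply]

lemma coproductHat_counit_right (hR : 0 ≤ R) (x : SymHat 𝕜 V R) :
    liftHat (LinearMap.lsmul 𝕜 (SymHat 𝕜 V R) ∘ₗ (counitHat 𝕜 V R).toLinearMap).flip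
      (coproductHat 𝕜 V R x) = x := by
  refine Completion.induction_on x (isClosed_eq
    ((liftHat _).cont.comp (coproductHat 𝕜 V R).cont) continuous_id) fun a => ?_
  rw [coproductHat_coe hR, liftHat_tensorHat (isBoundedBilin_lsmul _).flip]
  refine Eq.trans ?_ (congrArg (toHat 𝕜 (SymR 𝕜 V R)) (coproduct_counit_right a))
  generalize coproduct 𝕜 V R a = u
  induction u using TensorProduct.induction_on with
  | zero => simp only [map_zero]
  | add x y hx hy => simp only [map_add, hx, hy]
  | tmul x y =>
    change counitHat 𝕜 V R (y : SymHat 𝕜 V R) • (x : SymHat 𝕜 V R) =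
      toHat 𝕜 _ (counit 𝕜 V R y • x)
    rw [counitHat_coe, map_smul, toHat_apply]

lemma counitHat_oneHat : counitHat 𝕜 V R (oneHat 𝕜 V R) = 1 := by
  rw [oneHat, toHat_apply, counitHat_coe, counit_symOne]

/-! ### Functoriality -/

lemma symMapHat_id : symMapHat R (LinearMap.id : V →ₗ[𝕜] V) = .id 𝕜 (SymHat 𝕜 V R) := by
  ext x
  refine Completion.induction_on x (isClosed_eq (symMapHat R _).cont continuous_id) fun a => ?_
  rw [symMapHat_coe continuous_id, symMap_id]
  rfl

lemma symMapHat_comp {U : Type*} [AddCommGroup U] [Module 𝕜 U] [TopologicalSpace U]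
    {ψ : W →ₗ[𝕜] U} {φ : V →ₗ[𝕜] W} (hψ : Continuous ψ) (hφ : Continuous φ) :
    symMapHat R (ψ ∘ₗ φ) = (symMapHat R ψ).comp (symMapHat R φ) := by
  ext x
  refine Completion.induction_on x (isClosed_eq (symMapHat R _).cont
    ((symMapHat R ψ).comp (symMapHat R φ)).cont) fun a => ?_
  have h : Continuous (ψ ∘ₗ φ) := hψ.comp hφ
  rw [symMapHat_coe h, symMap_comp, ContinuousLinearMap.comp_apply, symMapHat_coe hφ,
    symMapHat_coe hψ]
  rfl

lemma symMapHat_oneHat {φ : V →ₗ[𝕜] W} (hφ : Continuous φ) :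
    symMapHat R φ (oneHat 𝕜 V R) = oneHat 𝕜 W R := by
  rw [oneHat, toHat_apply, symMapHat_coe hφ, symMap_symOne]
  rfl

lemma coproductHat_symMapHat (hR : 0 ≤ R) {φ : V →ₗ[𝕜] W} (hφ : Continuous φ)
    (x : SymHat 𝕜 V R) : mapHat (symMapHat R φ) (symMapHat R φ) (coproductHat 𝕜 V R x) =
      coproductHat 𝕜 W R (symMapHat R φ x) := by
  refine Completion.induction_on x (isClosed_eq
    ((mapHat _ _).cont.comp (coproductHat 𝕜 V R).cont)
    ((coproductHat 𝕜 W R).cont.comp (symMapHat R φ).cont)) fun a => ?_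
  rw [symMapHat_coe hφ, coproductHat_coe hR, coproductHat_coe hR, mapHat_tensorHat,
    coproduct_symMap]
  congr 1
  generalize coproduct 𝕜 V R a = u
  induction u using TensorProduct.induction_on with
  | zero => simp only [map_zero]
  | add x y hx hy => simp only [map_add, hx, hy]
  | tmul x y =>
    exact congrArg₂ (· ⊗ₜ[𝕜] ·) (symMapHat_coe hφ x) (symMapHat_coe hφ y)

lemma counitHat_symMapHat {φ : V →ₗ[𝕜] W} (hφ : Continuous φ) (x : SymHat 𝕜 V R) :
    counitHat 𝕜 W R (symMapHat R φ x) = counitHat 𝕜 V R x := by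
  refine Completion.induction_on x (isClosed_eq
    ((counitHat 𝕜 W R).cont.comp (symMapHat R φ).cont) (counitHat 𝕜 V R).cont) fun a => ?_
  rw [symMapHat_coe hφ, counitHat_coe, counitHat_coe, counit_symMap]

lemma antipodeHat_symMapHat {φ : V →ₗ[𝕜] W} (hφ : Continuous φ) (x : SymHat 𝕜 V R) :
    symMapHat R φ (antipodeHat 𝕜 V R x) = antipodeHat 𝕜 W R (symMapHat R φ x) := by
  refine Completion.induction_on x (isClosed_eq
    ((symMapHat R φ).cont.comp (antipodeHat 𝕜 V R).cont)
    ((antipodeHat 𝕜 W R).cont.comp (symMapHat R φ).cont)) fun a => ?_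
  rw [symMapHat_coe hφ, antipodeHat_coe, antipodeHat_coe, symMapHat_coe hφ, antipode_symMap]

end CompletedMaps

/-! ### The completed Hopf algebra -/

section CompletedHopf

variable {𝕜 : Type*} [RCLike 𝕜] {𝔤 : Type*} [LieRing 𝔤] [LieAlgebra 𝕜 𝔤]
  [TopologicalSpace 𝔤] [AELieAlgebra 𝕜 𝔤] {R : ℝ}

lemma guttStar_assoc (z : 𝕜) (x y w : SymR 𝕜 𝔤 R) :
    guttStar 𝕜 𝔤 R z (guttStar 𝕜 𝔤 R z x y) w = guttStar 𝕜 𝔤 R z x (guttStar 𝕜 𝔤 R z y w) := by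
  rw [guttStar_eq]
  exact starOp_assoc z x y w

lemma starHat_assoc (hR : 1 ≤ R) (z : 𝕜) (x y w : SymHat 𝕜 𝔤 R) :
    starHat 𝕜 𝔤 R z (starHat 𝕜 𝔤 R z x y) w = starHat 𝕜 𝔤 R z x (starHat 𝕜 𝔤 R z y w) := by
  have hc := continuous_starHat (𝔤 := 𝔤) hR z
  refine Completion.induction_on₃ x y w (isClosed_eq
    (hc.comp ((hc.comp (continuous_fst.prodMk (continuous_fst.comp continuous_snd))).prodMk
      (continuous_snd.comp continuous_snd)))
    (hc.comp (continuous_fst.prodMk (hc.comp continuous_snd)))) fun a b c => ?_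
  rw [starHat_coe hR, starHat_coe hR, starHat_coe hR, starHat_coe hR, guttStar_assoc]

lemma oneHat_starHat (hR : 1 ≤ R) (z : 𝕜) (x : SymHat 𝕜 𝔤 R) :
    starHat 𝕜 𝔤 R z (oneHat 𝕜 𝔤 R) x = x := by
  refine Completion.induction_on x (isClosed_eq
    ((continuous_starHat hR z).comp (continuous_const.prodMk continuous_id)) continuous_id)
    fun a => ?_
  rw [oneHat, toHat_apply, starHat_coe hR, guttStar_eq, symOne_starOp]

lemma starHat_oneHat (hR : 1 ≤ R) (z : 𝕜) (x : SymHat 𝕜 𝔤 R) :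
    starHat 𝕜 𝔤 R z x (oneHat 𝕜 𝔤 R) = x := by
  refine Completion.induction_on x (isClosed_eq
    ((continuous_starHat hR z).comp (continuous_id.prodMk continuous_const)) continuous_id)
    fun a => ?_
  rw [oneHat, toHat_apply, starHat_coe hR, guttStar_eq, starOp_symOne]

lemma map₂_starHat_tensorIncl (hR : 1 ≤ R) (z : 𝕜) (u v : SymR 𝕜 𝔤 R ⊗[𝕜] SymR 𝕜 𝔤 R) :
    TensorProduct.map₂ (starHat 𝕜 𝔤 R z) (starHat 𝕜 𝔤 R z) (tensorIncl 𝕜 𝔤 R u)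
      (tensorIncl 𝕜 𝔤 R v) =
      tensorIncl 𝕜 𝔤 R (TensorProduct.map₂ (guttStar 𝕜 𝔤 R z) (guttStar 𝕜 𝔤 R z) u v) := by
  induction u using TensorProduct.induction_on with
  | zero => simp only [map_zero, LinearMap.zero_apply]
  | add x y hx hy => simp only [map_add, LinearMap.add_apply, hx, hy]
  | tmul a b =>
    induction v using TensorProduct.induction_on with
    | zero => simp only [map_zero]
    | add x y hx hy => simp only [map_add, hx, hy]
    | tmul c d =>
      exact congrArg₂ (· ⊗ₜ[𝕜] ·) (starHat_coe hR z a c) (starHat_coe hR z b d)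

lemma coproductHat_starHat (hR : 1 ≤ R) (z : 𝕜) (x y : SymHat 𝕜 𝔤 R) :
    coproductHat 𝕜 𝔤 R (starHat 𝕜 𝔤 R z x y) =
      tensorMulHat (starHat 𝕜 𝔤 R z) (coproductHat 𝕜 𝔤 R x) (coproductHat 𝕜 𝔤 R y) := by
  have h0 : 0 ≤ R := zero_le_one.trans hR
  refine Completion.induction_on₂ x y (isClosed_eq
    ((coproductHat 𝕜 𝔤 R).cont.comp (continuous_starHat hR z))
    ((continuous_tensorMulHat (isBoundedBilin_starHat hR z)).comp
      (((coproductHat 𝕜 𝔤 R).cont.comp continuous_fst).prodMk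
        ((coproductHat 𝕜 𝔤 R).cont.comp continuous_snd)))) fun a b => ?_
  rw [starHat_coe hR, coproductHat_coe h0, coproductHat_coe h0, coproductHat_coe h0,
    tensorMulHat_tensorHat (isBoundedBilin_starHat hR z), map₂_starHat_tensorIncl hR,
    guttStar_eq, coproduct_starOp]

lemma counitHat_starHat (hR : 1 ≤ R) (z : 𝕜) (x y : SymHat 𝕜 𝔤 R) :
    counitHat 𝕜 𝔤 R (starHat 𝕜 𝔤 R z x y) = counitHat 𝕜 𝔤 R x * counitHat 𝕜 𝔤 R y := by
  refine Completion.induction_on₂ x y (isClosed_eq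
    ((counitHat 𝕜 𝔤 R).cont.comp (continuous_starHat hR z))
    (((counitHat 𝕜 𝔤 R).cont.comp continuous_fst).mul
      ((counitHat 𝕜 𝔤 R).cont.comp continuous_snd))) fun a b => ?_
  rw [starHat_coe hR, counitHat_coe, counitHat_coe, counitHat_coe, guttStar_eq, counit_starOp]

lemma antipodeHat_left (hR : 1 ≤ R) (z : 𝕜) (x : SymHat 𝕜 𝔤 R) :
    liftHat (starHat 𝕜 𝔤 R z) (mapHat (antipodeHat 𝕜 𝔤 R) (.id 𝕜 (SymHat 𝕜 𝔤 R))
      (coproductHat 𝕜 𝔤 R x)) = counitHat 𝕜 𝔤 R x • oneHat 𝕜 𝔤 R := by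
  -- Joint continuity of scalar multiplication, needed for the continuity of x ↦ ε(x) 1.
  have := (PolynormableSpace.withSeminorms 𝕜 (SymHat 𝕜 𝔤 R)).continuousSMul
  refine Completion.induction_on x (isClosed_eq
    ((liftHat _).cont.comp ((mapHat _ _).cont.comp (coproductHat 𝕜 𝔤 R).cont))
    ((counitHat 𝕜 𝔤 R).cont.smul continuous_const)) fun a => ?_
  rw [coproductHat_coe (zero_le_one.trans hR), mapHat_tensorHat,
    liftHat_tensorHat (isBoundedBilin_starHat hR z), counitHat_coe]
  have h := congrArg (toHat 𝕜 (SymR 𝕜 𝔤 R)) (antipode_left z a)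
  rw [map_smul, ← guttStar_eq] at h
  refine Eq.trans ?_ h
  generalize coproduct 𝕜 𝔤 R a = u
  induction u using TensorProduct.induction_on with
  | zero => simp only [map_zero]
  | add x y hx hy => simp only [map_add, hx, hy]
  | tmul x y =>
    change starHat 𝕜 𝔤 R z (antipodeHat 𝕜 𝔤 R (x : SymHat 𝕜 𝔤 R)) (y : SymHat 𝕜 𝔤 R) =
      (guttStar 𝕜 𝔤 R z (antipode 𝕜 𝔤 R x) y : SymR 𝕜 𝔤 R)
    rw [antipodeHat_coe, starHat_coe hR]

lemma antipodeHat_right (hR : 1 ≤ R) (z : 𝕜) (x : SymHat 𝕜 𝔤 R) :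
    liftHat (starHat 𝕜 𝔤 R z) (mapHat (.id 𝕜 (SymHat 𝕜 𝔤 R)) (antipodeHat 𝕜 𝔤 R)
      (coproductHat 𝕜 𝔤 R x)) = counitHat 𝕜 𝔤 R x • oneHat 𝕜 𝔤 R := by
  have := (PolynormableSpace.withSeminorms 𝕜 (SymHat 𝕜 𝔤 R)).continuousSMul
  refine Completion.induction_on x (isClosed_eq
    ((liftHat _).cont.comp ((mapHat _ _).cont.comp (coproductHat 𝕜 𝔤 R).cont))
    ((counitHat 𝕜 𝔤 R).cont.smul continuous_const)) fun a => ?_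
  rw [coproductHat_coe (zero_le_one.trans hR), mapHat_tensorHat,
    liftHat_tensorHat (isBoundedBilin_starHat hR z), counitHat_coe]
  have h := congrArg (toHat 𝕜 (SymR 𝕜 𝔤 R)) (antipode_right z a)
  rw [map_smul, ← guttStar_eq] at h
  refine Eq.trans ?_ h
  generalize coproduct 𝕜 𝔤 R a = u
  induction u using TensorProduct.induction_on with
  | zero => simp only [map_zero]
  | add x y hx hy => simp only [map_add, hx, hy]
  | tmul x y =>
    change starHat 𝕜 𝔤 R z (x : SymHat 𝕜 𝔤 R) (antipodeHat 𝕜 𝔤 R (y : SymHat 𝕜 𝔤 R)) =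
      (guttStar 𝕜 𝔤 R z x (antipode 𝕜 𝔤 R y) : SymR 𝕜 𝔤 R)
    rw [antipodeHat_coe, starHat_coe hR]

theorem isLocallyConvexHopf_starHat (hR : 1 ≤ R) (z : 𝕜) :
    IsLocallyConvexHopf (starHat 𝕜 𝔤 R z) (oneHat 𝕜 𝔤 R) (coproductHat 𝕜 𝔤 R)
      (counitHat 𝕜 𝔤 R) (antipodeHat 𝕜 𝔤 R) where
  locallyConvex := inferInstance
  continuous_mul := continuous_starHat hR z
  mul_assoc := starHat_assoc hR z
  one_mul := oneHat_starHat hR z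
  mul_one := starHat_oneHat hR z
  coassoc := coproductHat_coassoc (zero_le_one.trans hR)
  counit_left := coproductHat_counit_left (zero_le_one.trans hR)
  counit_right := coproductHat_counit_right (zero_le_one.trans hR)
  comul_mul := coproductHat_starHat hR z
  comul_one := coproductHat_oneHat (zero_le_one.trans hR)
  counit_mul := counitHat_starHat hR z
  counit_one := counitHat_oneHat
  antipode_left := antipodeHat_left hR z
  antipode_right := antipodeHat_right hR z

variable {𝔥 : Type*} [LieRing 𝔥] [LieAlgebra 𝕜 𝔥] [TopologicalSpace 𝔥] [AELieAlgebra 𝕜 𝔥]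

lemma symMap_guttStar (φ : 𝔤 →ₗ⁅𝕜⁆ 𝔥) (z : 𝕜) (x y : SymR 𝕜 𝔤 R) :
    symMap R φ.toLinearMap (guttStar 𝕜 𝔤 R z x y) =
      guttStar 𝕜 𝔥 R z (symMap R φ.toLinearMap x) (symMap R φ.toLinearMap y) := by
  rw [guttStar_eq, guttStar_eq, symMap_starOp]

lemma symMapHat_starHat (hR : 1 ≤ R) {φ : 𝔤 →ₗ⁅𝕜⁆ 𝔥} (hφ : Continuous φ) (z : 𝕜)
    (x y : SymHat 𝕜 𝔤 R) : symMapHat R φ.toLinearMap (starHat 𝕜 𝔤 R z x y) =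
      starHat 𝕜 𝔥 R z (symMapHat R φ.toLinearMap x) (symMapHat R φ.toLinearMap y) := by
  have hφ' : Continuous φ.toLinearMap := hφ
  have hc := (symMapHat R φ.toLinearMap).cont
  refine Completion.induction_on₂ x y (isClosed_eq (hc.comp (continuous_starHat hR z))
    ((continuous_starHat hR z).comp
      ((hc.comp continuous_fst).prodMk (hc.comp continuous_snd)))) fun a b => ?_
  rw [starHat_coe hR, symMapHat_coe hφ', symMapHat_coe hφ', symMapHat_coe hφ', starHat_coe hR,
    symMap_guttStar]

theorem isHopfHom_symMapHat (hR : 1 ≤ R) {φ : 𝔤 →ₗ⁅𝕜⁆ 𝔥} (hφ : Continuous φ) (z : 𝕜) :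
    IsHopfHom
      (starHat 𝕜 𝔤 R z) (oneHat 𝕜 𝔤 R) (coproductHat 𝕜 𝔤 R) (counitHat 𝕜 𝔤 R)
      (antipodeHat 𝕜 𝔤 R)
      (starHat 𝕜 𝔥 R z) (oneHat 𝕜 𝔥 R) (coproductHat 𝕜 𝔥 R) (counitHat 𝕜 𝔥 R)
      (antipodeHat 𝕜 𝔥 R)
      (symMapHat R φ.toLinearMap) where
  map_mul := symMapHat_starHat hR hφ z
  map_one := symMapHat_oneHat hφ
  map_comul := coproductHat_symMapHat (zero_le_one.trans hR) hφ
  map_counit := counitHat_symMapHat hφ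
  map_antipode := antipodeHat_symMapHat hφ

end CompletedHopf

end Gutt

end

/-! ### The theorem. -/

open Gutt in
theorem theorem1 {𝕜 : Type*} [RCLike 𝕜] {𝔤 : Type*} [LieRing 𝔤] [LieAlgebra 𝕜 𝔤]
    [TopologicalSpace 𝔤] [AELieAlgebra 𝕜 𝔤] (R : ℝ) (hR : 1 ≤ R) :
    -- the symmetrization map `Sym(𝔤) → U(𝔤)` used to define the star product is bijective
    Function.Bijective (quantization 𝕜 𝔤 R) ∧
    -- the operators `Cₙ` are continuous and satisfy explicit estimates, for all exponents `≥ 0`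
    (∀ r : ℝ, 0 ≤ r →
      (∀ n, Continuous fun p : SymR 𝕜 𝔤 r × SymR 𝕜 𝔤 r => starCoeff 𝕜 𝔤 r n p.1 p.2) ∧
      ∀ p q : Seminorm 𝕜 𝔤, Continuous p → Continuous q → IsAsymptoticEstimate p q →
        ∀ x y : TensorAlg 𝕜 𝔤,
          (∀ n : ℕ, 1 ≤ n →
            symSeminormR r p (starCoeff 𝕜 𝔤 r n (symmetrize 𝕜 𝔤 r x) (symmetrize 𝕜 𝔤 r y)) ≤
              (n.factorial : ℝ) ^ (1 - r) / (2 * 8 ^ n) *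
                tensorSeminormR r (estimateConst r • q) x *
                tensorSeminormR r (estimateConst r • q) y) ∧
          symSeminormR r p (starCoeff 𝕜 𝔤 r 0 (symmetrize 𝕜 𝔤 r x) (symmetrize 𝕜 𝔤 r y)) ≤
            tensorSeminormR r (estimateConst r • q) x *
              tensorSeminormR r (estimateConst r • q) y) ∧
    -- the star product is continuous, with explicit estimates
    (∀ z : 𝕜,
      (Continuous fun p : SymR 𝕜 𝔤 R × SymR 𝕜 𝔤 R => guttStar 𝕜 𝔤 R z p.1 p.2) ∧
      ∀ p q : Seminorm 𝕜 𝔤, Continuous p → Continuous q → IsAsymptoticEstimate p q →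
        (∀ x y : TensorAlg 𝕜 𝔤,
          symSeminormR R p (guttStar 𝕜 𝔤 R z (symmetrize 𝕜 𝔤 R x) (symmetrize 𝕜 𝔤 R y)) ≤
            tensorSeminormR R ((estimateConst R * (‖z‖₊ + 1)) • q) x *
              tensorSeminormR R ((estimateConst R * (‖z‖₊ + 1)) • q) y) ∧
        ∀ x y : SymHat 𝕜 𝔤 R,
          seminormHat R p (starHat 𝕜 𝔤 R z x y) ≤
            seminormHat R ((estimateConst R * (‖z‖₊ + 1)) • q) x *
              seminormHat R ((estimateConst R * (‖z‖₊ + 1)) • q) y) ∧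
    -- the undeformed coproduct, antipode and counit are continuous, and with the star product
    -- they make the completion a locally convex Hopf algebra
    (Continuous fun x : SymR 𝕜 𝔤 R =>
      toProj 𝕜 (SymR 𝕜 𝔤 R) (SymR 𝕜 𝔤 R) (coproduct 𝕜 𝔤 R x)) ∧
    Continuous (antipode 𝕜 𝔤 R) ∧
    Continuous (counit 𝕜 𝔤 R) ∧
    (∀ z : 𝕜, IsLocallyConvexHopf (starHat 𝕜 𝔤 R z) (oneHat 𝕜 𝔤 R) (coproductHat 𝕜 𝔤 R)
      (counitHat 𝕜 𝔤 R) (antipodeHat 𝕜 𝔤 R)) ∧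
    -- the star product is an entire deformation of the symmetric tensor product
    (∀ x y : SymR 𝕜 𝔤 R, guttStar 𝕜 𝔤 R 0 x y = symMul x y) ∧
    (∀ (x y : SymHat 𝕜 𝔤 R) (z : 𝕜),
      HasSum (fun n : ℕ => z ^ n • starCoeffHat 𝕜 𝔤 R n x y) (starHat 𝕜 𝔤 R z x y) ∧
      ∀ p : Seminorm 𝕜 𝔤, Continuous p →
        Summable fun n : ℕ => seminormHat R p (z ^ n • starCoeffHat 𝕜 𝔤 R n x y)) ∧
    -- functoriality
    symMapHat R (LinearMap.id : 𝔤 →ₗ[𝕜] 𝔤) = .id 𝕜 (SymHat 𝕜 𝔤 R) ∧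
    ∀ (𝔥 : Type*) [LieRing 𝔥] [LieAlgebra 𝕜 𝔥] [TopologicalSpace 𝔥] [AELieAlgebra 𝕜 𝔥]
      (φ : 𝔤 →ₗ⁅𝕜⁆ 𝔥), Continuous φ →
      Continuous (symMap R φ.toLinearMap) ∧
      (∀ ξ : 𝔤, symMap R φ.toLinearMap (symProd 𝕜 𝔤 R 1 ![ξ]) = symProd 𝕜 𝔥 R 1 ![φ ξ]) ∧
      symMap R φ.toLinearMap (symOne 𝕜 𝔤 R) = symOne 𝕜 𝔥 R ∧
      (∀ (z : 𝕜) (x y : SymR 𝕜 𝔤 R), symMap R φ.toLinearMap (guttStar 𝕜 𝔤 R z x y) =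
        guttStar 𝕜 𝔥 R z (symMap R φ.toLinearMap x) (symMap R φ.toLinearMap y)) ∧
      (∀ z : 𝕜, IsHopfHom
        (starHat 𝕜 𝔤 R z) (oneHat 𝕜 𝔤 R) (coproductHat 𝕜 𝔤 R) (counitHat 𝕜 𝔤 R)
        (antipodeHat 𝕜 𝔤 R)
        (starHat 𝕜 𝔥 R z) (oneHat 𝕜 𝔥 R) (coproductHat 𝕜 𝔥 R) (counitHat 𝕜 𝔥 R)
        (antipodeHat 𝕜 𝔥 R)
        (symMapHat R φ.toLinearMap)) ∧
      ∀ (𝔨 : Type*) [LieRing 𝔨] [LieAlgebra 𝕜 𝔨] [TopologicalSpace 𝔨] [AELieAlgebra 𝕜 𝔨]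
        (ψ : 𝔥 →ₗ⁅𝕜⁆ 𝔨), Continuous ψ →
        symMapHat R (ψ.comp φ).toLinearMap =
          (symMapHat R ψ.toLinearMap).comp (symMapHat R φ.toLinearMap) := by
  have h0 : 0 ≤ R := zero_le_one.trans hR
  refine ⟨quantization_bijective, fun r hr => ⟨fun n => (isBoundedBilin_starCoeff hr n).continuous,
    fun p q _ _ hpq x y => ⟨fun n hn => ?_, ?_⟩⟩,
    fun z => ⟨(isBoundedBilin_guttStar hR z).continuous, fun p q hp hq hpq =>
      ⟨guttStar_le hR hpq z, seminormHat_starHat_le hR hp hq hpq z⟩⟩,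
    continuous_coproduct h0, continuous_antipode, continuous_counit,
    isLocallyConvexHopf_starHat hR, fun x y => ?_,
    fun x y z => ⟨hasSum_starHat hR z x y, fun p hp => summable_seminormHat hR hp z x y⟩,
    symMapHat_id, fun 𝔥 _ _ _ _ φ hφ => ⟨continuous_symMap hφ, fun ξ => ?_, symMap_symOne _,
      symMap_guttStar φ, isHopfHom_symMapHat hR hφ,
      fun 𝔨 _ _ _ _ ψ hψ => symMapHat_comp hψ hφ⟩⟩
  · refine (starCoeff_le hr hpq n x y).trans (le_of_eq ?_)
    rw [coeffConst, if_neg (by omega)]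
    ring
  · refine (starCoeff_le hr hpq 0 x y).trans (le_of_eq ?_)
    simp [coeffConst]
  · rw [guttStar_eq, starOp_zero]
  · rw [symMap_symProd]
    congr 1
    ext i
    fin_cases i
    rfl
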